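/- Let $\mathbb K$ be $\mathbb R$ or $\mathbb C$, let $\mathfrak g$ be a finite-dimensional Lie algebra over $\mathbb K$ with basis $(\xi_i)$ and dual basis $(\xi_i^*)$, and let $\mathfrak{sg}=\mathfrak g\ltimes\mathfrak g_{-1}$ be the Lie superalgebra with even part $\mathfrak g$ and odd part the adjoint representation. All brackets are supercommutators, and $f\otimes g$ is defined with the sign rule $(f\otimes g)(a\otimes b)=(-1)^{|g||a|}f(a)\otimes g(b)$. A *differential $\mathfrak{sg}[t]$-module* is a super vector space $\mathcal B$ with compatible degree- and weight-gradings by $\mathbb Z$, an odd operator $d_{\mathcal B}$ of degree $1$ and weight $0$ with $d_{\mathcal B}^2=0$, and operators $L_{\xi,(n)}$ (even, degree $0$, weight $-n$) and $\iota_{\xi,(n)}$ (odd, degree $-1$, weight $-n$), linear in $\xi\in\mathfrak g$, for $n\ge0$, with $[L_{\xi,(m)},L_{\eta,(n)}]=L_{[\xi,\eta],(m+n)}$, $[L_{\xi,(m)},\iota_{\eta,(n)}]=\iota_{[\xi,\eta],(m+n)}$, $[\iota_{\xi,(m)},\iota_{\eta,(n)}]=0$, $[d_{\mathcal B},L_{\xi,(n)}]=0$,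 $[d_{\mathcal B},\iota_{\xi,(n)}]=L_{\xi,(n)}$, and such that for each $v\in\mathcal B$ all $L_{\xi,(n)}v$ and $\iota_{\xi,(n)}v$ vanish for large $n$. Let $\mathcal W(\mathfrak g)$ be the semi-infinite Weil algebra, the tensor product of the $bc$-system and the $\beta\gamma$-system of $\mathfrak g$, with differential $d_{\mathcal W}=D_{(0)}$, where $$D=-\sum_{i,j}\beta^{[\xi_i,\xi_j]}_{-1}\gamma^{\xi_j^*}_0c^{\xi_i^*}_0\mathbf 1-\tfrac12\sum_{i,j}c^{\xi_i^*}_0c^{\xi_j^*}_0b^{[\xi_i,\xi_j]}_{-1}\mathbf 1+\sum_i\gamma^{\xi_i^*}_0b^{\xi_i}_{-1}\mathbf 1,$$ and let $\langle c,\gamma\rangle$ be its vertex subalgebra generated by the vectors $c^{\xi^*}_0\mathbf 1$ and $\gamma^{\xi^*}_0\mathbf 1$, $\xi^*\in\mathfrak g^*$. Here $c$ is odd of degree $1$ and weight $0$, and $\gamma$ is even of degree $2$ and weight $0$. A *chiral $W^*$-module* is a differential $\mathfrak{sg}[t]$-module $\mathcal A$ with a module structure $Y^{\mathcal A}$ over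 the vertex superalgebra $\langle c,\gamma\rangle$, compatible with the gradings, such that, writing $c^{\xi^*,\mathcal A}_{(n)}$ and $\gamma^{\xi^*,\mathcal A}_{(n)}$ for the modes (coefficients of $z^{-n-1}$) of $Y^{\mathcal A}(c^{\xi^*}_0\mathbf 1,z)$ and $Y^{\mathcal A}(\gamma^{\xi^*}_0\mathbf 1,z)$, one has $[d_{\mathcal A},Y^{\mathcal A}(x,z)]=Y^{\mathcal A}(d_{\mathcal W}x,z)$, $[L_{\xi,(m)},c^{\xi^*,\mathcal A}_{(n)}]=c^{\mathrm{ad}^*\xi\cdot\xi^*,\mathcal A}_{(m+n)}$ and $[\iota_{\xi,(m)},c^{\xi^*,\mathcal A}_{(n)}]=\langle\xi^*,\xi\rangle\delta_{m+n,-1}$ for all $x\in\langle c,\gamma\rangle$, $\xi\in\mathfrak g$, $\xi^*\in\mathfrak g^*$, $m\ge0$, $n\in\mathbb Z$, where $\langle\mathrm{ad}^*\xi\cdot\xi^*,\eta\rangle=-\langle\xi^*,[\xi,\eta]\rangle$. Let $\mathcal A$ be a chiral $W^*$-module and $\mathcal B$ a differential $\mathfrak{sg}[t]$-module. Then the sum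 $\phi=\sum_i\sum_{n\ge0}c^{\xi_i^*,\mathcal A}_{(-n-1)}\otimes\iota^{\mathcal B}_{\xi_i,(n)}$, the series $\Phi=\exp(\phi)$ and the infinite sums below are locally finite on $\mathcal A\otimes\mathcal B$, $\Phi$ is an invertible operator on $\mathcal A\otimes\mathcal B$ which preserves all homogeneous components, and the following hold. (1) The total differential is transformed into $$\Phi(d_{\mathcal A}\otimes1+1\otimes d_{\mathcal B})\Phi^{-1}=d_{\mathcal A}\otimes1+1\otimes d_{\mathcal B}-\sum_i\sum_{n\ge0}\gamma^{\xi_i^*,\mathcal A}_{(-n-1)}\otimes\iota^{\mathcal B}_{\xi_i,(n)}+\sum_i\sum_{n\ge0}c^{\xi_i^*,\mathcal A}_{(-n-1)}\otimes L^{\mathcal B}_{\xi_i,(n)}+\sum_{i,j}\sum_{m,n\ge0}c^{\xi_i^*,\mathcal A}_{(n)}c^{\xi_j^*,\mathcal A}_{(-n-m-2)}\otimes\iota^{\mathcal B}_{[\xi_i,\xi_j],(m)}.$$ (2) For all $\xi\in\mathfrak g$ and $n\ge0$, $$\Phi(L^{\mathcal A}_{\xi,(n)}\otimes1+1\otimes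 L^{\mathcal B}_{\xi,(n)})\Phi^{-1}=L^{\mathcal A}_{\xi,(n)}\otimes1+1\otimes L^{\mathcal B}_{\xi,(n)}+\sum_i\sum_{0\le k<n}c^{\xi_i^*,\mathcal A}_{(n-k-1)}\otimes\iota^{\mathcal B}_{[\xi,\xi_i],(k)}.$$ (3) For all $\xi\in\mathfrak g$ and $n\ge0$, $$\Phi(\iota^{\mathcal A}_{\xi,(n)}\otimes1+1\otimes\iota^{\mathcal B}_{\xi,(n)})\Phi^{-1}=\iota^{\mathcal A}_{\xi,(n)}\otimes1.$$ (4) Let $(\mathcal A\otimes\mathcal B)_{bas}$ be the subspace of vectors killed by all $L^{\mathcal A}_{\xi,(n)}\otimes1+1\otimes L^{\mathcal B}_{\xi,(n)}$ and all $\iota^{\mathcal A}_{\xi,(n)}\otimes1+1\otimes\iota^{\mathcal B}_{\xi,(n)}$ ($\xi\in\mathfrak g$, $n\ge0$). Let $C(\mathcal A;\mathcal B)=\Phi((\mathcal A\otimes\mathcal B)_{bas})$ be the chiral Cartan model, with differential $d_{\mathcal A,\mathcal B}$ the restriction of $\Phi(d_{\mathcal A}\otimes1+1\otimes d_{\mathcal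 B})\Phi^{-1}$. Then both are degree-weight-graded complexes, with gradings and parity inherited from $\mathcal A\otimes\mathcal B$, and $\Phi$ restricts to an isomorphism of degree-weight-graded complexes $$\bigl((\mathcal A\otimes\mathcal B)_{bas},\ d_{\mathcal A}\otimes1+1\otimes d_{\mathcal B}\bigr)\longrightarrow\bigl(C(\mathcal A;\mathcal B),\ d_{\mathcal A,\mathcal B}\bigr).$$ -/

import Mathlib

open scoped TensorProduct

noncomputable section

namespace ChiralCartan

/-! ### Locally finite sums and exponentials of operators -/

section LocallyFinite

variable {K V : Type*} [Field K] [AddCommGroup V] [Module K V]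

/-- A family of operators is locally finite if on each vector only finitely many members of the
family are non-zero. -/
def LocFinite {J : Type*} (F : J → Module.End K V) : Prop :=
  ∀ v : V, (Function.support fun j => F j v).Finite

open Classical in
/-- The sum of a locally finite family of operators (and `0` if the family is not locally
finite). -/
def locSum {J : Type*} (F : J → Module.End K V) : Module.End K V :=
  if h : LocFinite F then
    { toFun := fun v => ∑ᶠ j, F j v
      map_add' := fun v w => by
        simp only [map_add]
        exact finsum_add_distrib (h v) (h w)
      map_smul' := fun a v => by
        simp only [map_smul, RingHom.id_apply]
        exact (smul_finsum a fun j => F j v).symm }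
  else 0

/-- The family `φ ^ k / k!`. -/
def expTerm (φ : Module.End K V) (k : ℕ) : Module.End K V :=
  ((k.factorial : K)⁻¹) • φ ^ k

/-- The exponential of a locally nilpotent operator. -/
def locExp (φ : Module.End K V) : Module.End K V := locSum (expTerm φ)

end LocallyFinite

/-! ### Super vector spaces with a degree- and a weight-grading -/

/-- Indices `(parity, degree, weight)`. -/
abbrev Idx : Type := ZMod 2 × ℤ × ℤ

section Super

variable {K V : Type*} [Field K] [AddCommGroup V] [Module K V]

/-- The sign `(-1)^e` of a parity `e`. -/
def sgn (K : Type*) [Field K] (e : ZMod 2) : K := if e = 0 then 1 else -1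

open Classical in
/-- The parity involution `v ↦ (-1)^{|v|} v` of a graded super vector space `V = ⨁ V i`. -/
def parityOp (gr : Idx → Submodule K V) : Module.End K V :=
  if h : DirectSum.IsInternal gr then
    (DirectSum.toModule K Idx V fun i => sgn K i.1 • (gr i).subtype) ∘ₗ
      ((LinearEquiv.ofBijective (DirectSum.coeLinearMap gr) h).symm : V →ₗ[K] _)
  else 0

/-- The even part of an operator, for the parity involution `P`. -/
def evenPart (P X : Module.End K V) : Module.End K V := (2 : K)⁻¹ • (X + P * X * P)

/-- The odd part of an operator, for the parity involution `P`. -/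
def oddPart (P X : Module.End K V) : Module.End K V := (2 : K)⁻¹ • (X - P * X * P)

/-- The bilinear operation which is `(-1)^{|X||Y|} Y X` on homogeneous operators. -/
def superSwap (P X Y : Module.End K V) : Module.End K V :=
  Y * evenPart P X + (P * Y * P) * oddPart P X

/-- The supercommutator `[X, Y] = X Y - (-1)^{|X||Y|} Y X`. -/
def superBracket (P X Y : Module.End K V) : Module.End K V := X * Y - superSwap P X Y

/-- A degree-weight-graded complex: `V` is the direct sum of its components of given parity, degree
and weight, and `d` is an odd operator of degree `1` and weight `0` with square zero. -/
structure IsGradedComplex (gr : Idx → Submodule K V) (d : Module.End K V) : Prop where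
  internal : DirectSum.IsInternal gr
  d_mem : ∀ i : Idx, ∀ v ∈ gr i, d v ∈ gr (i + (1, 1, 0))
  d_sq : d * d = 0

/-- The grading which a subspace inherits from the ambient space. -/
def subGr (gr : Idx → Submodule K V) (S : Submodule K V) (i : Idx) : Submodule K S :=
  (gr i).comap S.subtype

end Super

section SuperTensor

variable {K A B : Type*} [Field K] [AddCommGroup A] [Module K A] [AddCommGroup B] [Module K B]

/-- The tensor product `f ⊗ g` of operators on super vector spaces, with the sign rule
`(f ⊗ g) (a ⊗ b) = (-1)^{|g||a|} f a ⊗ g b`. -/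
def superTensor (PA : Module.End K A) (PB : Module.End K B)
    (f : Module.End K A) (g : Module.End K B) : Module.End K (A ⊗[K] B) :=
  TensorProduct.map f (evenPart PB g) + TensorProduct.map (f * PA) (oddPart PB g)

/-- The grading on a tensor product. -/
def tensorGr (grA : Idx → Submodule K A) (grB : Idx → Submodule K B) (k : Idx) :
    Submodule K (A ⊗[K] B) :=
  ⨆ (i : Idx) (j : Idx) (_ : i + j = k), Submodule.map₂ (TensorProduct.mk K A B) (grA i) (grB j)

end SuperTensor

/-! ### Formal distributions and fields

A formal distribution `F(z) = ∑ F_(n) z^{-n-1}` on `V` is given by its modes `F_(n)`. -/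

section Fields

variable {K V : Type*} [Field K] [AddCommGroup V] [Module K V]

/-- `F(z)` is a field: for each `v` we have `F_(n) v = 0` for all sufficiently large `n`. -/
def IsField (F : ℤ → Module.End K V) : Prop := ∀ v : V, ∃ N : ℤ, ∀ n ≥ N, F n v = 0

/-- The identity field `id_V`, with `(id)_(-1) = id` and all other modes zero. -/
def idField (K V : Type*) [Field K] [AddCommGroup V] [Module K V] : ℤ → Module.End K V :=
  fun n => if n = -1 then 1 else 0

/-- The `j`-th term of the right-hand side of the Borcherds identity,
`(-1)^j binom(l, j) (A_(m+l-j) B_(n+j) - (-1)^l (-1)^{|A||B|} B_(n+l-j) A_(m+j))`. -/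
def borcherdsTerm (P : Module.End K V) (A B : ℤ → Module.End K V) (l m n : ℤ) (j : ℕ) :
    Module.End K V :=
  ((-1 : K) ^ j * ((Ring.choose l j : ℤ) : K)) •
    (A (m + l - j) * B (n + j) - (-1 : K) ^ l • superSwap P (A (m + j)) (B (n + l - j)))

/-- The `n`-th product `A(z)_(n) B(z)` of two fields,
`Res_z (A(z) B(w) i_{z,w} (z - w)^n - (-1)^{|A||B|} B(w) A(z) i_{w,z} (z - w)^n)`;
the `(-1)`-st product is the normally ordered product. -/
def nProd (P : Module.End K V) (A : ℤ → Module.End K V) (n : ℤ) (B : ℤ → Module.End K V) :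
    ℤ → Module.End K V :=
  fun k => locSum (borcherdsTerm P A B n 0 k)

/-- A formal distribution is homogeneous of parity, degree and weight `(e, p, w)` if each mode
`F_(n)` shifts the grading by `(e, p, w - n - 1)`. -/
def IsHomogeneous (gr : Idx → Submodule K V) (i : Idx) (F : ℤ → Module.End K V) : Prop :=
  ∀ (n : ℤ) (j : Idx), ∀ v ∈ gr j, F n v ∈ gr (j + i + (0, 0, -n - 1))

end Fields

/-! ### Fock modules: `bc`-systems and `βγ`-systems -/

section Fock

/-- Generators `x ⊗ t^n` (`x : V`) and `φ ⊗ t^{n-1} dt` (`φ : V^*`) of the Clifford or Heisenberg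
algebra attached to `V`. -/
inductive ModeGen (K V : Type*) [Field K] [AddCommGroup V] [Module K V] : Type _
  | vec (x : V) (n : ℤ) : ModeGen K V
  | dual (φ : Module.Dual K V) (n : ℤ) : ModeGen K V

open ModeGen FreeAlgebra in
/-- The relations of the enveloping algebra of the Heisenberg Lie algebra (`ε = 1`) or of its odd
analogue (`ε = -1`), with the central element set to `1`: linearity of the generators in `x` and
`φ`, and the (super)commutation relations given by the residue pairing
`⟨x, φ⟩ Res_{t=0} t^m t^{n-1} dt = ⟨x, φ⟩ δ_{m+n,0}`. -/
inductive ModeRel (K V : Type*) [Field K] [AddCommGroup V] [Module K V] (ε : K) :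
    FreeAlgebra K (ModeGen K V) → FreeAlgebra K (ModeGen K V) → Prop
  | vec_add (x y : V) (n : ℤ) :
      ModeRel K V ε (ι K (vec (x + y) n)) (ι K (vec x n) + ι K (vec y n))
  | vec_smul (a : K) (x : V) (n : ℤ) :
      ModeRel K V ε (ι K (vec (a • x) n)) (a • ι K (vec x n))
  | dual_add (φ ψ : Module.Dual K V) (n : ℤ) :
      ModeRel K V ε (ι K (dual (φ + ψ) n)) (ι K (dual φ n) + ι K (dual ψ n))
  | dual_smul (a : K) (φ : Module.Dual K V) (n : ℤ) :
      ModeRel K V ε (ι K (dual (a • φ) n)) (a • ι K (dual φ n))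
  | vec_vec (x y : V) (m n : ℤ) :
      ModeRel K V ε (ι K (vec x m) * ι K (vec y n)) (ε • (ι K (vec y n) * ι K (vec x m)))
  | dual_dual (φ ψ : Module.Dual K V) (m n : ℤ) :
      ModeRel K V ε (ι K (dual φ m) * ι K (dual ψ n)) (ε • (ι K (dual ψ n) * ι K (dual φ m)))
  | vec_dual (x : V) (φ : Module.Dual K V) (m n : ℤ) :
      ModeRel K V ε (ι K (vec x m) * ι K (dual φ n))
        (ε • (ι K (dual φ n) * ι K (vec x m)) + algebraMap K _ (if m + n = 0 then φ x else 0))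

variable (K V : Type*) [Field K] [AddCommGroup V] [Module K V] (ε : K)

/-- The Heisenberg (`ε = 1`) or Clifford (`ε = -1`) algebra with the central element set to `1`. -/
abbrev ModeAlg : Type _ := RingQuot (ModeRel K V ε)

variable {K V} in
/-- The class of a generator. -/
def modeGen (a : ModeGen K V) : ModeAlg K V ε :=
  RingQuot.mkAlgHom K (ModeRel K V ε) (FreeAlgebra.ι K a)

/-- The left ideal generated by the annihilation operators: `x ⊗ t^n` with `n ≥ 0` and
`φ ⊗ t^{n-1} dt` with `n ≥ 1`. -/
def annIdeal : Submodule (ModeAlg K V ε) (ModeAlg K V ε) :=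
  Submodule.span (ModeAlg K V ε)
    ({a | ∃ (x : V) (n : ℤ), 0 ≤ n ∧ a = modeGen ε (ModeGen.vec x n)} ∪
      {a | ∃ (φ : Module.Dual K V) (n : ℤ), 1 ≤ n ∧ a = modeGen ε (ModeGen.dual φ n)})

/-- The induced module: the `βγ`-system for `ε = 1`, the `bc`-system for `ε = -1`. -/
abbrev Fock : Type _ := ModeAlg K V ε ⧸ annIdeal K V ε

/-- The vacuum vector. -/
def fockVac : Fock K V ε := Submodule.Quotient.mk 1

/-- The action of `x ⊗ t^n`. -/
def vecOp (x : V) (n : ℤ) : Module.End K (Fock K V ε) :=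
  Algebra.lsmul K K (Fock K V ε) (modeGen ε (ModeGen.vec x n))

/-- The action of `φ ⊗ t^{n-1} dt`. -/
def dualOp (φ : Module.Dual K V) (n : ℤ) : Module.End K (Fock K V ε) :=
  Algebra.lsmul K K (Fock K V ε) (modeGen ε (ModeGen.dual φ n))

variable {K V} in
/-- The generator with its sign changed. -/
def negGen : ModeGen K V → ModeAlg K V ε := fun a => (-1 : K) • modeGen ε a

/-- The automorphism of the mode algebra which changes the sign of all generators. -/
def modeSign : ModeAlg K V ε →ₐ[K] ModeAlg K V ε :=
  RingQuot.liftAlgHom K ⟨FreeAlgebra.lift K (negGen ε), by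
    intro x y h
    have key := RingQuot.mkAlgHom_rel K h
    cases h <;>
      simp only [map_add, map_smul, map_mul, AlgHom.commutes, FreeAlgebra.lift_ι_apply, negGen,
        smul_mul_smul_comm, neg_mul_neg, one_mul, one_smul, smul_comm _ (-1 : K), ← smul_add,
        modeGen] at key ⊢ <;>
      rw [key]⟩

theorem modeSign_gen (a : ModeGen K V) : modeSign K V ε (modeGen ε a) = (-1 : K) • modeGen ε a := by
  simp [modeSign, modeGen, negGen]

theorem annIdeal_le_comap :
    annIdeal K V ε ≤
      (annIdeal K V ε).comap (modeSign K V ε : ModeAlg K V ε →+* ModeAlg K V ε).toSemilinearMap := by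
  refine Submodule.span_le.2 ?_
  rintro a (⟨x, n, hn, rfl⟩ | ⟨φ, n, hn, rfl⟩)
  · change modeSign K V ε _ ∈ annIdeal K V ε
    rw [modeSign_gen]
    exact Submodule.smul_of_tower_mem _ _ (Submodule.subset_span (Or.inl ⟨x, n, hn, rfl⟩))
  · change modeSign K V ε _ ∈ annIdeal K V ε
    rw [modeSign_gen]
    exact Submodule.smul_of_tower_mem _ _ (Submodule.subset_span (Or.inr ⟨φ, n, hn, rfl⟩))

/-- The involution of the Fock module induced by the sign change of all generators; on the
`bc`-system it is the parity involution. -/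
def fockSign : Module.End K (Fock K V ε) where
  toFun := Submodule.mapQ (annIdeal K V ε) (annIdeal K V ε)
    (modeSign K V ε : ModeAlg K V ε →+* ModeAlg K V ε).toSemilinearMap (annIdeal_le_comap K V ε)
  map_add' := map_add _
  map_smul' a v := by
    induction v using Submodule.Quotient.induction_on with
    | _ x =>
      rw [← Submodule.Quotient.mk_smul, Submodule.mapQ_apply]
      change Submodule.Quotient.mk (modeSign K V ε (a • x)) = _
      rw [map_smul]
      rfl

end Fock

/-! ### The semi-infinite Weil algebra -/

section Weil

variable (K g : Type*) [Field K] [LieRing g] [LieAlgebra K g]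

/-- The space underlying the semi-infinite Weil algebra `W(g) = E(g) ⊗ S(g)`, the tensor product of
the `bc`-system and the `βγ`-system. -/
abbrev Weil : Type _ := Fock K g (-1) ⊗[K] Fock K g 1

/-- The parity involution of `W(g)`: `b` and `c` are odd, `β` and `γ` are even. -/
def weilParity : Module.End K (Weil K g) := TensorProduct.map (fockSign K g (-1)) 1

variable {g}

/-- The field `b^x(z)`, with `b_(n) = b_n = x ⊗ t^n`. -/
def bField (x : g) : ℤ → Module.End K (Weil K g) :=
  fun n => TensorProduct.map (vecOp K g (-1) x n) 1

variable {K}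

/-- The field `c^φ(z)`, with `c_(n) = c_{n+1} = φ ⊗ t^n dt`. -/
def cField (φ : Module.Dual K g) : ℤ → Module.End K (Weil K g) :=
  fun n => TensorProduct.map (dualOp K g (-1) φ (n + 1)) 1

variable (K) in
/-- The field `β^x(z)`, with `β_(n) = β_n = x ⊗ t^n`. -/
def betaField (x : g) : ℤ → Module.End K (Weil K g) :=
  fun n => TensorProduct.map 1 (vecOp K g 1 x n)

/-- The field `γ^φ(z)`, with `γ_(n) = γ_{n+1} = φ ⊗ t^n dt`. -/
def gammaField (φ : Module.Dual K g) : ℤ → Module.End K (Weil K g) :=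
  fun n => TensorProduct.map 1 (dualOp K g 1 φ (n + 1))

/-- Monomials in the modes of `b, c, β, γ` applied to the vacuum vector of `W(g)`, with their
parity, degree and weight. The fields `b, c, β, γ` have degrees `-1, 1, -2, 2` and weights
`1, 0, 1, 0`, and the `(n)`-th mode of a field of weight `w` has weight `w - n - 1`. -/
inductive IsMonomial : Idx → Weil K g → Prop
  | vac : IsMonomial 0 (fockVac K g (-1) ⊗ₜ[K] fockVac K g 1)
  | b (x : g) (n : ℤ) (i : Idx) (v : Weil K g) :
      IsMonomial i v → IsMonomial (i + (1, -1, -n)) (bField K x n v)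
  | c (φ : Module.Dual K g) (n : ℤ) (i : Idx) (v : Weil K g) :
      IsMonomial i v → IsMonomial (i + (1, 1, -n - 1)) (cField φ n v)
  | beta (x : g) (n : ℤ) (i : Idx) (v : Weil K g) :
      IsMonomial i v → IsMonomial (i + (0, -2, -n)) (betaField K x n v)
  | gamma (φ : Module.Dual K g) (n : ℤ) (i : Idx) (v : Weil K g) :
      IsMonomial i v → IsMonomial (i + (0, 2, -n - 1)) (gammaField φ n v)

variable (K g) in
/-- The component of `W(g)` of given parity, degree and weight. -/
def weilGr (i : Idx) : Submodule K (Weil K g) := Submodule.span K {v | IsMonomial i v}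

variable (K g) in
/-- The vertex superalgebra `⟨c, γ⟩`. Under the state-field correspondence, vertex superalgebras are
identified with spaces of fields, and `⟨c, γ⟩` with the smallest space of fields on `W(g)` that
contains the identity field and the fields `c^φ(z)`, `γ^φ(z)` and is closed under all `n`-th
products of fields. -/
def weilPrime : Submodule K (ℤ → Module.End K (Weil K g)) :=
  sInf {S | idField K (Weil K g) ∈ S ∧ (∀ φ : Module.Dual K g, cField φ ∈ S) ∧
    (∀ φ : Module.Dual K g, gammaField φ ∈ S) ∧
    ∀ x ∈ S, ∀ y ∈ S, ∀ n : ℤ, nProd (weilParity K g) x n y ∈ S}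

variable (K g) in
theorem idField_mem : idField K (Weil K g) ∈ weilPrime K g :=
  Submodule.mem_sInf.2 fun _ hS => hS.1

theorem cField_mem (φ : Module.Dual K g) : cField φ ∈ weilPrime K g :=
  Submodule.mem_sInf.2 fun _ hS => hS.2.1 φ

theorem gammaField_mem (φ : Module.Dual K g) : gammaField φ ∈ weilPrime K g :=
  Submodule.mem_sInf.2 fun _ hS => hS.2.2.1 φ

theorem nProd_mem {x y : ℤ → Module.End K (Weil K g)} (hx : x ∈ weilPrime K g)
    (hy : y ∈ weilPrime K g) (n : ℤ) : nProd (weilParity K g) x n y ∈ weilPrime K g :=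
  Submodule.mem_sInf.2 fun S hS => hS.2.2.2 x (Submodule.mem_sInf.1 hx S hS) y
    (Submodule.mem_sInf.1 hy S hS) n

/-- The vacuum vector of `⟨c, γ⟩`, as a field. -/
def vacuum' : weilPrime K g := ⟨idField K (Weil K g), idField_mem K g⟩

/-- The element `c^φ_0 1` of `⟨c, γ⟩`, as a field. -/
def c' (φ : Module.Dual K g) : weilPrime K g := ⟨cField φ, cField_mem φ⟩

/-- The element `γ^φ_0 1` of `⟨c, γ⟩`, as a field. -/
def gamma' (φ : Module.Dual K g) : weilPrime K g := ⟨gammaField φ, gammaField_mem φ⟩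

/-- The `n`-th product of the vertex superalgebra `⟨c, γ⟩`. -/
def nProd' (x : weilPrime K g) (n : ℤ) (y : weilPrime K g) : weilPrime K g :=
  ⟨nProd (weilParity K g) x n y, nProd_mem x.2 y.2 n⟩

variable {I : Type*} [Fintype I]

/-- The normally ordered product `:A(z) B(z):` of fields on `W(g)`. -/
def normalOrd (A B : ℤ → Module.End K (Weil K g)) : ℤ → Module.End K (Weil K g) :=
  nProd (weilParity K g) A (-1) B

/-- The field of
`J = - ∑ β^{[ξ_i, ξ_j]} γ^{ξ_j^*} c^{ξ_i^*} - (1/2) ∑ c^{ξ_i^*} c^{ξ_j^*} b^{[ξ_i, ξ_j]}`. -/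
def weilJ (bs : Module.Basis I K g) : ℤ → Module.End K (Weil K g) :=
  - (∑ i, ∑ j, normalOrd (betaField K ⁅bs i, bs j⁆)
      (normalOrd (gammaField (bs.coord j)) (cField (bs.coord i)))) -
    (2 : K)⁻¹ • ∑ i, ∑ j, normalOrd (cField (bs.coord i))
      (normalOrd (cField (bs.coord j)) (bField K ⁅bs i, bs j⁆))

/-- The field of `K = ∑ γ^{ξ_i^*} b^{ξ_i}`. -/
def weilK (bs : Module.Basis I K g) : ℤ → Module.End K (Weil K g) :=
  ∑ i, normalOrd (gammaField (bs.coord i)) (bField K (bs i))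

/-- The differential `d_W = D_(0)` of the semi-infinite Weil complex, where `D = J + K`. -/
def weilD (bs : Module.Basis I K g) : Module.End K (Weil K g) := weilJ bs 0 + weilK bs 0

/-- `x'` is the image of `x` under the differential of `⟨c, γ⟩`, the restriction of `d_W`. On
fields, `d_W` acts as the supercommutator: `(d_W x)(z) = [D_(0), x(z)]`. -/
def IsWeilDiff (bs : Module.Basis I K g) (x x' : weilPrime K g) : Prop :=
  ∀ n : ℤ, (x' : ℤ → Module.End K (Weil K g)) n =
    superBracket (weilParity K g) (weilD bs) ((x : ℤ → Module.End K (Weil K g)) n)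

end Weil

/-! ### Differential `sg[t]`-modules and chiral `W^*`-modules -/

section Modules

/-- A differential `sg[t]`-module: a degree-weight-graded complex with operators
`L_{ξ,(n)} = ρ((ξ, 0) t^n)` and `ι_{ξ,(n)} = ρ((0, ξ) t^n)`, where `ρ` is a representation of the Lie
superalgebra `sg[t] = (g ⋉ g_{-1})[t]` that is continuous and compatible with gradings and
differentials. -/
structure DiffSgtModule (K g A : Type*) [Field K] [LieRing g] [LieAlgebra K g] [AddCommGroup A]
    [Module K A] where
  gr : Idx → Submodule K A
  d : Module.End K A
  isGradedComplex : IsGradedComplex gr d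
  L : ℕ → g →ₗ[K] Module.End K A
  ι : ℕ → g →ₗ[K] Module.End K A
  L_mem : ∀ (n : ℕ) (ξ : g) (i : Idx), ∀ v ∈ gr i, L n ξ v ∈ gr (i + (0, 0, -(n : ℤ)))
  ι_mem : ∀ (n : ℕ) (ξ : g) (i : Idx), ∀ v ∈ gr i, ι n ξ v ∈ gr (i + (1, -1, -(n : ℤ)))
  bracket_L_L : ∀ (m n : ℕ) (ξ η : g),
    superBracket (parityOp gr) (L m ξ) (L n η) = L (m + n) ⁅ξ, η⁆
  bracket_L_ι : ∀ (m n : ℕ) (ξ η : g),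
    superBracket (parityOp gr) (L m ξ) (ι n η) = ι (m + n) ⁅ξ, η⁆
  bracket_ι_ι : ∀ (m n : ℕ) (ξ η : g), superBracket (parityOp gr) (ι m ξ) (ι n η) = 0
  bracket_d_L : ∀ (n : ℕ) (ξ : g), superBracket (parityOp gr) d (L n ξ) = 0
  bracket_d_ι : ∀ (n : ℕ) (ξ : g), superBracket (parityOp gr) d (ι n ξ) = L n ξ
  continuous : ∀ v : A, ∃ k : ℕ, ∀ n ≥ k, ∀ ξ : g, L n ξ v = 0 ∧ ι n ξ v = 0

/-- The coadjoint action `⟨ad^* ξ · φ, η⟩ = - ⟨φ, [ξ, η]⟩`. -/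
def coad {K g : Type*} [Field K] [LieRing g] [LieAlgebra K g] (ξ : g) (φ : Module.Dual K g) :
    Module.Dual K g := - (φ ∘ₗ (LieAlgebra.ad K g ξ : g →ₗ[K] g))

/-- A chiral `W^*`-module: a differential `sg[t]`-module with a module structure `Y` over the vertex
superalgebra `⟨c, γ⟩`, compatible with the gradings, such that `Y` is compatible with the
differentials and the prescribed commutation relations of `L` and `ι` with `c` hold. Here
`Y x n` is the `n`-th mode of `Y(x, z)`. -/
structure ChiralWStarModule {K g I : Type*} [Field K] [LieRing g] [LieAlgebra K g] [Fintype I]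
    (bs : Module.Basis I K g) (A : Type*) [AddCommGroup A] [Module K A]
    extends DiffSgtModule K g A where
  Y : weilPrime K g →ₗ[K] (ℤ → Module.End K A)
  isField : ∀ x, IsField (Y x)
  Y_vacuum : Y vacuum' = idField K A
  borcherds : ∀ (x y : weilPrime K g) (l m n : ℤ),
    locSum (fun j : ℕ => ((Ring.choose m j : ℤ) : K) • Y (nProd' x (l + j) y) (m + n - j)) =
      locSum (borcherdsTerm (parityOp gr) (Y x) (Y y) l m n)
  Y_homogeneous : ∀ (x : weilPrime K g) (i : Idx),
    IsHomogeneous (weilGr K g) i (x : ℤ → Module.End K (Weil K g)) → IsHomogeneous gr i (Y x)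
  bracket_d_Y : ∀ x x' : weilPrime K g, IsWeilDiff bs x x' →
    ∀ n : ℤ, superBracket (parityOp gr) d (Y x n) = Y x' n
  bracket_L_c : ∀ (m : ℕ) (n : ℤ) (ξ : g) (φ : Module.Dual K g),
    superBracket (parityOp gr) (L m ξ) (Y (c' φ) n) = Y (c' (coad ξ φ)) (m + n)
  bracket_ι_c : ∀ (m : ℕ) (n : ℤ) (ξ : g) (φ : Module.Dual K g),
    superBracket (parityOp gr) (ι m ξ) (Y (c' φ) n) = if m + n = -1 then φ ξ • 1 else 0

end Modules

/-! ### Basic subspaces, tensor products and the chiral Cartan model -/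

section Cartan

/-- The chiral basic subspace: the vectors killed by all `ι_{ξ,(n)}` and all `L_{ξ,(n)}`,
`n ≥ 0`. -/
def basicSub {K g V : Type*} [Field K] [LieRing g] [LieAlgebra K g] [AddCommGroup V] [Module K V]
    (L ι : ℕ → g → Module.End K V) : Submodule K V :=
  (⨅ (n : ℕ) (ξ : g), LinearMap.ker (ι n ξ)) ⊓ (⨅ (n : ℕ) (ξ : g), LinearMap.ker (L n ξ))

variable {K g A B I : Type*} [Field K] [LieRing g] [LieAlgebra K g] [AddCommGroup A] [Module K A]
  [AddCommGroup B] [Module K B] [Fintype I] {bs : Module.Basis I K g}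

/-- The mode `c^{φ,A}_(n)`. -/
def ChiralWStarModule.c (M : ChiralWStarModule bs A) (φ : Module.Dual K g) (n : ℤ) :
    Module.End K A := M.Y (c' φ) n

/-- The mode `γ^{φ,A}_(n)`. -/
def ChiralWStarModule.gamma (M : ChiralWStarModule bs A) (φ : Module.Dual K g) (n : ℤ) :
    Module.End K A := M.Y (gamma' φ) n

/-- The tensor product `f ⊗ g` of operators on the super vector spaces underlying two differential
`sg[t]`-modules. -/
def opTensor (M : DiffSgtModule K g A) (N : DiffSgtModule K g B) (f : Module.End K A)
    (h : Module.End K B) : Module.End K (A ⊗[K] B) :=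
  superTensor (parityOp M.gr) (parityOp N.gr) f h

/-- The differential `d_A ⊗ 1 + 1 ⊗ d_B`. -/
def totalD (M : DiffSgtModule K g A) (N : DiffSgtModule K g B) : Module.End K (A ⊗[K] B) :=
  opTensor M N M.d 1 + opTensor M N 1 N.d

/-- The operator `L^A_{ξ,(n)} ⊗ 1 + 1 ⊗ L^B_{ξ,(n)}`. -/
def totalL (M : DiffSgtModule K g A) (N : DiffSgtModule K g B) (n : ℕ) (ξ : g) :
    Module.End K (A ⊗[K] B) :=
  opTensor M N (M.L n ξ) 1 + opTensor M N 1 (N.L n ξ)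

/-- The operator `ι^A_{ξ,(n)} ⊗ 1 + 1 ⊗ ι^B_{ξ,(n)}`. -/
def totalι (M : DiffSgtModule K g A) (N : DiffSgtModule K g B) (n : ℕ) (ξ : g) :
    Module.End K (A ⊗[K] B) :=
  opTensor M N (M.ι n ξ) 1 + opTensor M N 1 (N.ι n ξ)

/-- The terms `c^{ξ_i^*,A}_(-n-1) ⊗ ι^B_{ξ_i,(n)}` of `φ(0)_{≥0}`. -/
def phiTerm (M : ChiralWStarModule bs A) (N : DiffSgtModule K g B) (p : I × ℕ) :
    Module.End K (A ⊗[K] B) :=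
  opTensor M.toDiffSgtModule N (M.c (bs.coord p.1) (-(p.2 : ℤ) - 1)) (N.ι p.2 (bs p.1))

/-- The terms `γ^{ξ_i^*,A}_(-n-1) ⊗ ι^B_{ξ_i,(n)}`. -/
def gammaTerm (M : ChiralWStarModule bs A) (N : DiffSgtModule K g B) (p : I × ℕ) :
    Module.End K (A ⊗[K] B) :=
  opTensor M.toDiffSgtModule N (M.gamma (bs.coord p.1) (-(p.2 : ℤ) - 1)) (N.ι p.2 (bs p.1))

/-- The terms `c^{ξ_i^*,A}_(-n-1) ⊗ L^B_{ξ_i,(n)}`. -/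
def lieTerm (M : ChiralWStarModule bs A) (N : DiffSgtModule K g B) (p : I × ℕ) :
    Module.End K (A ⊗[K] B) :=
  opTensor M.toDiffSgtModule N (M.c (bs.coord p.1) (-(p.2 : ℤ) - 1)) (N.L p.2 (bs p.1))

/-- The terms `c^{ξ_i^*,A}_(n) c^{ξ_j^*,A}_(-n-m-2) ⊗ ι^B_{[ξ_i,ξ_j],(m)}`, with index
`(i, j, m, n)`. -/
def quadTerm (M : ChiralWStarModule bs A) (N : DiffSgtModule K g B) (p : I × I × ℕ × ℕ) :
    Module.End K (A ⊗[K] B) :=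
  opTensor M.toDiffSgtModule N
    (M.c (bs.coord p.1) (p.2.2.2 : ℤ) *
      M.c (bs.coord p.2.1) (-(p.2.2.2 : ℤ) - (p.2.2.1 : ℤ) - 2))
    (N.ι p.2.2.1 ⁅bs p.1, bs p.2.1⁆)

/-- The operator `φ(0)_{≥0} = ∑_i ∑_{n ≥ 0} c^{ξ_i^*,A}_(-n-1) ⊗ ι^B_{ξ_i,(n)}`. -/
def phiZero (M : ChiralWStarModule bs A) (N : DiffSgtModule K g B) : Module.End K (A ⊗[K] B) :=
  locSum (phiTerm M N)

/-- The grading of the tensor product of two differential `sg[t]`-modules. -/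
def totalGr (M : DiffSgtModule K g A) (N : DiffSgtModule K g B) : Idx → Submodule K (A ⊗[K] B) :=
  tensorGr M.gr N.gr

/-- The chiral basic subspace `(A ⊗ B)_bas`. -/
def totalBasic (M : DiffSgtModule K g A) (N : DiffSgtModule K g B) : Submodule K (A ⊗[K] B) :=
  basicSub (totalL M N) (totalι M N)

/-- The chiral Cartan model `C(A; B) = Φ((A ⊗ B)_bas)`, with `Φ = exp(φ(0)_{≥0})`. -/
def cartanModel (M : ChiralWStarModule bs A) (N : DiffSgtModule K g B) :
    Submodule K (A ⊗[K] B) :=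
  (totalBasic M.toDiffSgtModule N).map (locExp (phiZero M N))

/-- A linear isomorphism is an isomorphism of degree-weight-graded complexes if it identifies the
homogeneous components and commutes with the differentials. -/
structure IsGradedComplexIso {U V : Type*} [AddCommGroup U] [Module K U] [AddCommGroup V]
    [Module K V] (grU : Idx → Submodule K U) (dU : Module.End K U) (grV : Idx → Submodule K V)
    (dV : Module.End K V) (f : U ≃ₗ[K] V) : Prop where
  mem_iff : ∀ (i : Idx) (u : U), f u ∈ grV i ↔ u ∈ grU i
  comm : ∀ u : U, f (dU u) = dV (f u)

end Cartan

end ChiralCartan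

end

/-!
The operator `φ = ∑ c^{ξ_i^*}_(-n-1) ⊗ ι_{ξ_i,(n)}` is a locally finite sum of pairwise commuting
operators of square zero, hence locally nilpotent (`phiZero_locNilpotent`), so `Φ = exp φ` is
invertible. If `Y = [φ, X]` and `2 Z = [φ, Y]` with `[φ, Z] = 0`, then `Φ X Φ⁻¹ = X + Y + Z`
(`locExpEquiv_conj`). All three conjugation formulas are of this kind.

* For `X = ι ⊗ 1 + 1 ⊗ ι`, the relation `[ι_{ξ,(m)}, c_(n)] = ⟨ξ^*, ξ⟩ δ_{m+n,-1}` gives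
  `Y = - 1 ⊗ ι` and `Z = 0` (`phiZero_mul_totalι`).
* For `X = L ⊗ 1 + 1 ⊗ L`, the coadjoint action on `c` and the adjoint action on `ι` cancel, except
  for the finitely many modes `0 ≤ k < n` (`phiZero_mul_totalL`); again `Z = 0`.
* For `X = d ⊗ 1 + 1 ⊗ d`, one finds `Y = ∑ c ⊗ L - ∑ [d, c] ⊗ ι` (`phiZero_mul_totalD`). In the
  vertex superalgebra `⟨c, γ⟩` one has
  `d_W c^{ξ_k^*} = γ^{ξ_k^*} - (1/2) ∑ ⟨ξ_k^*, [ξ_i, ξ_j]⟩ :c^{ξ_i^*} c^{ξ_j^*}:` (`isWeilDiff_c'`),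
  and by the Borcherds identity the mode `(-m-1)` of `:c c:` is the sum of finitely many products of
  two modes of negative index and of two infinite sums, which contribute equally by antisymmetry of
  the bracket (`ChiralWStarModule.cc_eq`).
  The commutator of `φ` with `∑ c ⊗ L` consists of exactly the products of two modes of negative
  index, so that `Z` is the sum of the quadratic term of the transformed differential and of
  `∑ ([d, c] - γ) ⊗ ι` (`phiZero_mul_second`). The terms `[d, c] ⊗ ι` cancel in `X + Y + Z`.

The modes of `c` and `γ` on a chiral `W^*`-module supercommute, because the products `x_(l) y` with
`l ≥ 0` of the corresponding fields vanish (`ChiralWStarModule.Y_mul_Y`).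

The basic subspace is an intersection of kernels of homogeneous operators, hence a graded subspace,
and it is stable under the total differential by the relations of `sg[t]`. As `φ`, and hence `Φ`,
preserves homogeneous components, both structures are transported to the chiral Cartan model.
-/

namespace ChiralCartan

/-! ### Locally finite sums of operators -/

section LocSum

variable {K V J : Type*} [Field K] [AddCommGroup V] [Module K V] {F G : J → Module.End K V}

theorem locSum_apply (h : LocFinite F) (v : V) : locSum F v = ∑ᶠ j, F j v := by
  rw [locSum, dif_pos h]; rfl

theorem locSum_apply_eq_sum (h : LocFinite F) {v : V} (s : Finset J)
    (hs : ∀ j ∉ s, F j v = 0) : locSum F v = ∑ j ∈ s, F j v := by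
  rw [locSum_apply h]
  refine finsum_eq_sum_of_support_subset _ fun j hj => ?_
  by_contra hjs
  exact hj (hs j hjs)

theorem locFinite_of_finset (h : ∀ v, ∃ s : Finset J, ∀ j ∉ s, F j v = 0) : LocFinite F := by
  intro v
  obtain ⟨s, hs⟩ := h v
  refine s.finite_toSet.subset fun j hj => ?_
  by_contra hjs
  exact hj (hs j hjs)

theorem LocFinite.exists_finset (h : LocFinite F) (v : V) :
    ∃ s : Finset J, ∀ j ∉ s, F j v = 0 :=
  ⟨(h v).toFinset, fun j hj => by simpa using hj⟩

theorem LocFinite.mul_left (h : LocFinite F) (X : Module.End K V) :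
    LocFinite fun j => X * F j := by
  refine fun v => (h v).subset fun j hj hv => hj ?_
  simp only at hv
  simp [hv]

theorem LocFinite.mul_right (h : LocFinite F) (X : Module.End K V) :
    LocFinite fun j => F j * X := fun v => h (X v)

theorem LocFinite.add (h : LocFinite F) (h' : LocFinite G) : LocFinite fun j => F j + G j := by
  refine fun v => ((h v).union (h' v)).subset fun j hj => ?_
  by_contra hh
  simp only [Set.mem_union, Function.mem_support, not_or, not_not] at hh
  exact hj (by simp [hh.1, hh.2])

theorem LocFinite.smul (h : LocFinite F) (a : J → K) : LocFinite fun j => a j • F j := by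
  refine fun v => (h v).subset fun j hj hv => hj ?_
  simp only at hv
  simp [hv]

theorem LocFinite.sub (h : LocFinite F) (h' : LocFinite G) : LocFinite fun j => F j - G j := by
  convert h.add (h'.smul fun _ => -1) using 2
  simp [sub_eq_add_neg]

theorem locSum_mul_left (h : LocFinite F) (X : Module.End K V) :
    locSum (fun j => X * F j) = X * locSum F := by
  ext v
  obtain ⟨s, hs⟩ := h.exists_finset v
  rw [locSum_apply_eq_sum (h.mul_left X) s (by simp +contextual [hs]), Module.End.mul_apply,
    locSum_apply_eq_sum h s hs, map_sum]
  rfl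

theorem locSum_mul_right (h : LocFinite F) (X : Module.End K V) :
    locSum (fun j => F j * X) = locSum F * X := by
  ext v
  rw [locSum_apply (h.mul_right X), Module.End.mul_apply, locSum_apply h]
  rfl

theorem locSum_sub (h : LocFinite F) (h' : LocFinite G) :
    locSum (fun j => F j - G j) = locSum F - locSum G := by
  ext v
  rw [locSum_apply (h.sub h'), LinearMap.sub_apply, locSum_apply h, locSum_apply h',
    ← finsum_sub_distrib (h v) (h' v)]
  rfl

@[simp]
theorem locSum_zero : locSum (fun _ : J => (0 : Module.End K V)) = 0 := by
  have h : LocFinite (fun _ : J => (0 : Module.End K V)) :=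
    locFinite_of_finset fun _ => ⟨∅, fun _ _ => rfl⟩
  ext v
  rw [locSum_apply_eq_sum h ∅ (fun _ _ => rfl)]
  simp

theorem locSum_eq_single (j : J) (h : ∀ k, k ≠ j → F k = 0) : locSum F = F j := by
  have h' : LocFinite F :=
    locFinite_of_finset fun v => ⟨{j}, fun k hk => by rw [h k (by simpa using hk)]; rfl⟩
  ext v
  rw [locSum_apply_eq_sum h' {j} (fun k hk => by rw [h k (by simpa using hk)]; rfl)]
  simp

theorem locSum_commute (h : LocFinite F) {X : Module.End K V} (hX : ∀ j, Commute (F j) X) :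
    Commute (locSum F) X := by
  rw [Commute, SemiconjBy, ← locSum_mul_left h, ← locSum_mul_right h]
  exact congrArg locSum (funext hX)

/-- A locally finite sum of commuting operators of square zero is locally nilpotent: on the orbit of
a vector only finitely many of the operators act non-trivially. -/
theorem exists_pow_locSum_apply_eq_zero (h : LocFinite F) (hc : ∀ i j, Commute (F i) (F j))
    (hsq : ∀ j, F j * F j = 0) (v : V) : ∃ n, (locSum F ^ n) v = 0 := by
  classical
  obtain ⟨s, hs⟩ := h.exists_finset v
  have key : ∀ n, (locSum F ^ n) v = ((∑ j ∈ s, F j) ^ n) v := by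
    intro n
    induction n with
    | zero => rfl
    | succ n ih =>
      rw [pow_succ', pow_succ', Module.End.mul_apply, Module.End.mul_apply, ih,
        locSum_apply_eq_sum h s, LinearMap.sum_apply]
      intro j hj
      have : Commute (F j) ((∑ j ∈ s, F j) ^ n) :=
        (Commute.sum_right _ _ _ fun i _ => hc j i).pow_right n
      rw [← Module.End.mul_apply, this.eq, Module.End.mul_apply, hs j hj, map_zero]
  have nil : IsNilpotent (∑ j ∈ s, F j) :=
    Commute.isNilpotent_sum (fun j _ => ⟨2, by rw [pow_two, hsq]⟩) fun i j _ _ => hc i j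
  obtain ⟨n, hn⟩ := nil
  exact ⟨n, by rw [key, hn]; rfl⟩

end LocSum

/-! ### Exponentials of locally nilpotent operators -/

section LocExp

variable {K V : Type*} [Field K] [AddCommGroup V] [Module K V] {φ : Module.End K V}

theorem pow_apply_eq_zero_of_le {v : V} {m n : ℕ} (h : (φ ^ m) v = 0) (hmn : m ≤ n) :
    (φ ^ n) v = 0 := by
  rw [← Nat.sub_add_cancel hmn, pow_add, Module.End.mul_apply, h, map_zero]

theorem expTerm_apply_eq_zero {v : V} {m n : ℕ} (h : (φ ^ m) v = 0) (hmn : m ≤ n) :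
    expTerm φ n v = 0 := by
  rw [expTerm, LinearMap.smul_apply, pow_apply_eq_zero_of_le h hmn, smul_zero]

theorem locFinite_expTerm (hφ : ∀ v, ∃ n, (φ ^ n) v = 0) : LocFinite (expTerm φ) := by
  refine locFinite_of_finset fun v => ?_
  obtain ⟨n, hn⟩ := hφ v
  exact ⟨Finset.range n, fun k hk => expTerm_apply_eq_zero hn (by simpa using hk)⟩

theorem locExp_apply (hφ : ∀ v, ∃ n, (φ ^ n) v = 0) {v : V} {m n : ℕ} (h : (φ ^ m) v = 0)
    (hmn : m ≤ n) : locExp φ v = ∑ k ∈ Finset.range n, expTerm φ k v :=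
  locSum_apply_eq_sum (locFinite_expTerm hφ) _ fun k hk =>
    expTerm_apply_eq_zero h (hmn.trans (by simpa using hk))

theorem locExp_mem (hφ : ∀ v, ∃ n, (φ ^ n) v = 0) {S : Submodule K V} (hS : ∀ v ∈ S, φ v ∈ S)
    {v : V} (hv : v ∈ S) : locExp φ v ∈ S := by
  obtain ⟨n, hn⟩ := hφ v
  rw [locExp_apply hφ hn le_rfl]
  refine S.sum_mem fun k hk => S.smul_mem _ ?_
  clear hk
  induction k with
  | zero => exact hv
  | succ k ih => rw [pow_succ']; exact hS _ ih

theorem neg_locNilpotent (hφ : ∀ v, ∃ n, (φ ^ n) v = 0) (v : V) : ∃ n, ((-φ) ^ n) v = 0 := by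
  obtain ⟨n, hn⟩ := hφ v
  refine ⟨n, ?_⟩
  rw [neg_pow, Module.End.mul_apply, hn, map_zero]

variable [CharZero K]

theorem expTerm_succ (φ : Module.End K V) (k : ℕ) :
    ((k + 1 : ℕ) : K) • expTerm φ (k + 1) = φ * expTerm φ k := by
  have h1 : ((k + 1 : ℕ) : K) ≠ 0 := by exact_mod_cast k.succ_ne_zero
  rw [expTerm, expTerm, Nat.factorial_succ, mul_smul_comm, ← pow_succ', smul_smul, Nat.cast_mul,
    mul_inv, mul_inv_cancel_left₀ h1]

/-- The binomial theorem for `(φ - φ) ^ n`, divided by `n !`. -/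
theorem sum_antidiagonal_expTerm (φ : Module.End K V) (n : ℕ) :
    ∑ p ∈ Finset.HasAntidiagonal.antidiagonal n, expTerm φ p.1 * expTerm (-φ) p.2 =
      if n = 0 then 1 else 0 := by
  have h := (Commute.refl φ).neg_right.add_pow' n
  rw [add_neg_cancel] at h
  have h2 : (n.factorial : K) • ∑ p ∈ Finset.HasAntidiagonal.antidiagonal n,
      expTerm φ p.1 * expTerm (-φ) p.2 = (0 : Module.End K V) ^ n := by
    rw [h, Finset.smul_sum]
    refine Finset.sum_congr rfl fun p hp => ?_
    have hn : n.choose p.1 * p.1.factorial * p.2.factorial = n.factorial := by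
      have := Nat.choose_mul_factorial_mul_factorial (Nat.le_add_right p.1 p.2)
      rwa [Nat.add_sub_cancel_left, Finset.HasAntidiagonal.mem_antidiagonal.1 hp] at this
    rw [expTerm, expTerm, smul_mul_smul_comm, smul_smul, ← hn, ← Nat.cast_smul_eq_nsmul K]
    congr 1
    have h1 : (p.1.factorial : K) ≠ 0 := by exact_mod_cast p.1.factorial_ne_zero
    have h2 : (p.2.factorial : K) ≠ 0 := by exact_mod_cast p.2.factorial_ne_zero
    push_cast
    field_simp
  have h3 : (n.factorial : K) ≠ 0 := by exact_mod_cast n.factorial_ne_zero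
  rw [← (smul_right_injective _ h3).eq_iff]
  rw [h2]
  split_ifs with hn
  · subst hn; simp
  · simp [hn]

theorem locExp_mul_locExp_neg (hφ : ∀ v, ∃ n, (φ ^ n) v = 0) :
    locExp φ * locExp (-φ) = 1 := by
  ext v
  obtain ⟨n, hn⟩ := hφ v
  have hn' : ((-φ) ^ n) v = 0 := by rw [neg_pow, Module.End.mul_apply, hn, map_zero]
  -- only finitely many pairs of terms act non-trivially on `v`; group them by total degree
  have hz : ∀ i j, n ≤ i + j → expTerm φ i (expTerm (-φ) j v) = 0 := by
    intro i j hij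
    rw [expTerm, expTerm, LinearMap.smul_apply, LinearMap.smul_apply, map_smul, neg_pow,
      Module.End.mul_apply, ← Module.End.mul_apply (φ ^ i),
      ((Commute.one_right (φ ^ i)).neg_right.pow_right j).eq, Module.End.mul_apply,
      ← Module.End.mul_apply (φ ^ i), ← pow_add, pow_apply_eq_zero_of_le hn hij]
    simp
  rw [Module.End.mul_apply, locExp_apply (neg_locNilpotent hφ) hn' le_rfl, map_sum]
  have h1 : ∀ j ∈ Finset.range n, locExp φ (expTerm (-φ) j v) =
      ∑ i ∈ Finset.range n, expTerm φ i (expTerm (-φ) j v) := by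
    intro j _
    exact locSum_apply_eq_sum (locFinite_expTerm hφ) _ fun i hi =>
      hz i j (by have : n ≤ i := by simpa using hi
                 omega)
  rw [Finset.sum_congr rfl h1, Finset.sum_comm, ← Finset.sum_product',
    ← Finset.sum_fiberwise_of_maps_to (t := Finset.range (n + n)) (g := fun p => p.1 + p.2)
      (by intro p hp; simp at hp ⊢; omega)]
  have h2 : ∀ k ∈ Finset.range (n + n),
      ∑ p ∈ Finset.range n ×ˢ Finset.range n with p.1 + p.2 = k,
        expTerm φ p.1 (expTerm (-φ) p.2 v) = if k = 0 then v else 0 := by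
    intro k _
    by_cases hk : n ≤ k
    · have hv : k = 0 → v = 0 := by
        rintro rfl
        obtain rfl : n = 0 := by omega
        simpa using hn
      rw [Finset.sum_eq_zero]
      · split_ifs with h0
        · exact (hv h0).symm
        · rfl
      · intro p hp
        exact hz _ _ (by have := (Finset.mem_filter.1 hp).2; omega)
    · have := congrArg (fun X => X v) (sum_antidiagonal_expTerm φ k)
      simp only [LinearMap.sum_apply, Module.End.mul_apply] at this
      rw [show ({p ∈ Finset.range n ×ˢ Finset.range n | p.1 + p.2 = k}) =
        Finset.HasAntidiagonal.antidiagonal k from ?_, this]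
      · split_ifs <;> rfl
      · ext p
        simp
        omega
  rw [Finset.sum_congr rfl h2, Finset.sum_ite_eq']
  split_ifs with h0
  · rfl
  · have : n = 0 := by simp at h0; omega
    subst this
    simpa using hn.symm

/-- The exponential of a locally nilpotent operator as an automorphism. -/
noncomputable def locExpEquiv (hφ : ∀ v, ∃ n, (φ ^ n) v = 0) : V ≃ₗ[K] V :=
  LinearEquiv.ofLinearMap (locExp φ) (locExp (-φ)) (locExp_mul_locExp_neg hφ)
    (by have := locExp_mul_locExp_neg (neg_locNilpotent hφ); rwa [neg_neg] at this)

theorem locExpEquiv_toLinearMap (hφ : ∀ v, ∃ n, (φ ^ n) v = 0) :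
    (locExpEquiv hφ).toLinearMap = locExp φ := rfl

theorem locExpEquiv_map_eq (hφ : ∀ v, ∃ n, (φ ^ n) v = 0) {S : Submodule K V}
    (hS : ∀ v ∈ S, φ v ∈ S) : S.map (locExpEquiv hφ).toLinearMap = S := by
  refine le_antisymm ?_ fun v hv => ?_
  · rintro _ ⟨v, hv, rfl⟩
    exact locExp_mem hφ hS hv
  · exact ⟨(locExpEquiv hφ).symm v, locExp_mem (neg_locNilpotent hφ)
      (fun v hv => S.neg_mem (hS v hv)) hv, (locExpEquiv hφ).apply_symm_apply v⟩

/-- The divided powers of `φ` move past `X` according to the Leibniz rule, with at most two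
commutators. -/
theorem expTerm_mul {X Y Z : Module.End K V} (hY : φ * X = X * φ + Y)
    (hZ : φ * Y = Y * φ + (2 : K) • Z) (hC : φ * Z = Z * φ) (k : ℕ) :
    expTerm φ (k + 2) * X =
      X * expTerm φ (k + 2) + Y * expTerm φ (k + 1) + Z * expTerm φ k := by
  have e0 : expTerm φ 0 = 1 := by simp [expTerm]
  have e1 : expTerm φ 1 = φ := by simp [expTerm]
  have e2 : (2 : K) • expTerm φ 2 = φ * φ := by
    have := expTerm_succ φ 1
    rw [e1] at this
    exact_mod_cast this
  have hc : ∀ k, φ * expTerm φ k = expTerm φ k * φ := fun k => by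
    rw [expTerm, mul_smul_comm, smul_mul_assoc, ← pow_succ, ← pow_succ']
  induction k with
  | zero =>
    have h2 : (2 : K) ≠ 0 := two_ne_zero
    apply smul_right_injective _ h2
    simp only [zero_add, smul_add]
    rw [← smul_mul_assoc, e2, ← mul_smul_comm _ X, e2, e1, e0, mul_one, mul_assoc, hY, mul_add,
      ← mul_assoc, hY, hZ, add_mul, mul_assoc, two_smul K (Y * φ)]
    abel
  | succ k ih =>
    have h3 : ((k + 2 + 1 : ℕ) : K) ≠ 0 := by exact_mod_cast (k + 2).succ_ne_zero
    apply smul_right_injective _ h3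
    have a1 : ((k + 2 + 1 : ℕ) : K) • expTerm φ (k + 2) =
        φ * expTerm φ (k + 1) + expTerm φ (k + 2) := by
      rw [← expTerm_succ, Nat.cast_add ((k + 2 : ℕ)), add_smul, Nat.cast_one, one_smul]
    have a2 : ((k + 2 + 1 : ℕ) : K) • expTerm φ (k + 1) =
        φ * expTerm φ k + (2 : K) • expTerm φ (k + 1) := by
      rw [← expTerm_succ, ← add_smul]; push_cast; congr 1; ring
    simp only [smul_add]
    rw [← smul_mul_assoc, expTerm_succ, mul_assoc, ih, ← mul_smul_comm _ X, expTerm_succ,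
      ← mul_smul_comm _ Y, a1, ← mul_smul_comm _ Z, a2]
    simp only [mul_add, ← mul_assoc, hY, hZ, hC]
    simp only [add_mul, mul_assoc, smul_mul_assoc, mul_smul_comm]
    abel

/-- Conjugation by `exp φ` when the third iterated commutator with `φ` vanishes:
`exp φ X exp (-φ) = X + [φ, X] + [φ, [φ, X]] / 2`. -/
theorem locExpEquiv_conj (hφ : ∀ v, ∃ n, (φ ^ n) v = 0) {X Y Z : Module.End K V}
    (hY : φ * X = X * φ + Y) (hZ : φ * Y = Y * φ + (2 : K) • Z) (hC : φ * Z = Z * φ) :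
    (locExpEquiv hφ).conj X = X + Y + Z := by
  suffices h : locExp φ * X = (X + Y + Z) * locExp φ by
    ext v
    have := congrArg (fun T => T ((locExpEquiv hφ).symm v)) h
    rw [LinearEquiv.conj_apply_apply]
    refine this.trans ?_
    change (X + Y + Z) (locExpEquiv hφ ((locExpEquiv hφ).symm v)) = _
    rw [LinearEquiv.apply_symm_apply]
  ext v
  obtain ⟨m, hm⟩ := hφ v
  obtain ⟨m', hm'⟩ := hφ (X v)
  have hle := le_max_left m m'
  have hle' := le_max_right m m'
  set n := max m m'
  have e0 : expTerm φ 0 = 1 := by simp [expTerm]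
  have e1 : expTerm φ 1 = φ := by simp [expTerm]
  simp only [Module.End.mul_apply, LinearMap.add_apply]
  rw [locExp_apply hφ hm' (n := n + 2) (by omega)]
  conv_rhs =>
    rw [locExp_apply hφ hm (n := n + 2) (by omega)]
    enter [1, 2]
    rw [← locExp_apply hφ hm (n := n + 2) (by omega), locExp_apply hφ hm (n := n + 1) (by omega)]
  conv_rhs =>
    enter [2]
    rw [← locExp_apply hφ hm (n := n + 2) (by omega), locExp_apply hφ hm (n := n) (by omega)]
  have key : ∀ k, expTerm φ (k + 2) (X v) =
      X (expTerm φ (k + 2) v) + Y (expTerm φ (k + 1) v) + Z (expTerm φ k v) := fun k =>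
    congrArg (fun T => T v) (expTerm_mul hY hZ hC k)
  have key1 : φ (X v) = X (φ v) + Y v := congrArg (fun T => T v) hY
  rw [Finset.sum_range_succ', Finset.sum_range_succ', Finset.sum_range_succ',
    Finset.sum_range_succ', Finset.sum_range_succ' _ n]
  simp only [map_add, map_sum, e0, e1, zero_add, Module.End.one_apply, add_assoc, key, key1,
    Finset.sum_add_distrib, one_add_one_eq_two]
  abel

end LocExp

end ChiralCartan

namespace ChiralCartan

/-! ### Graded subspaces and homogeneous operators -/

section Graded

variable {K V : Type*} [Field K] [AddCommGroup V] [Module K V] {gr : Idx → Submodule K V}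

theorem ext_of_internal {W : Type*} [AddCommGroup W] [Module K W] (h : DirectSum.IsInternal gr)
    {f f' : V →ₗ[K] W} (hf : ∀ i, ∀ v ∈ gr i, f v = f' v) : f = f' := by
  ext v
  have hv : v ∈ ⨆ i, gr i := by rw [h.submodule_iSup_eq_top]; trivial
  refine Submodule.iSup_induction _ (motive := fun v => f v = f' v) hv hf (by simp) ?_
  intro x y hx hy
  rw [map_add, map_add, hx, hy]

/-- The projection onto a component of a graded space. -/
noncomputable def grProj (h : DirectSum.IsInternal gr) (i : Idx) : Module.End K V :=
  (gr i).subtype ∘ₗ DirectSum.component K Idx (fun i => gr i) i ∘ₗ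
    ((LinearEquiv.ofBijective (DirectSum.coeLinearMap gr) h).symm : V →ₗ[K] _)

theorem ofBijective_symm_of_mem (h : DirectSum.IsInternal gr) {i : Idx} {v : V} (hv : v ∈ gr i) :
    (LinearEquiv.ofBijective (DirectSum.coeLinearMap gr) h).symm v =
      DirectSum.lof K Idx (fun i => gr i) i ⟨v, hv⟩ := by
  rw [LinearEquiv.symm_apply_eq]
  exact (DirectSum.coeLinearMap_lof gr i ⟨v, hv⟩).symm

theorem grProj_mem (h : DirectSum.IsInternal gr) (i : Idx) (v : V) : grProj h i v ∈ gr i :=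
  Subtype.prop _

theorem grProj_of_mem (h : DirectSum.IsInternal gr) {i : Idx} {v : V} (hv : v ∈ gr i) :
    grProj h i v = v := by
  simp [grProj, ofBijective_symm_of_mem h hv, DirectSum.component.lof_self]

theorem grProj_of_ne (h : DirectSum.IsInternal gr) {i j : Idx} (hij : j ≠ i) {v : V}
    (hv : v ∈ gr i) : grProj h j v = 0 := by
  simp [grProj, ofBijective_symm_of_mem h hv, DirectSum.component.of, hij.symm]

theorem exists_eq_sum_grProj (h : DirectSum.IsInternal gr) (v : V) :
    ∃ s : Finset Idx, (∀ i ∉ s, grProj h i v = 0) ∧ v = ∑ i ∈ s, grProj h i v := by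
  classical
  set x := (LinearEquiv.ofBijective (DirectSum.coeLinearMap gr) h).symm v with hx
  have hp : ∀ i, grProj h i v = x i := fun i => rfl
  refine ⟨x.support, fun i hi => ?_, ?_⟩
  · rw [hp, DFinsupp.notMem_support_iff.1 hi]; rfl
  · simp only [hp]
    have := DirectSum.coeLinearMap_eq_dfinsuppSum gr x
    rw [DFinsupp.sum] at this
    rw [← this]
    exact (LinearEquiv.apply_symm_apply (LinearEquiv.ofBijective (DirectSum.coeLinearMap gr) h)
      v).symm

theorem locFinite_grProj (h : DirectSum.IsInternal gr) : LocFinite (grProj h) :=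
  locFinite_of_finset fun v => (exists_eq_sum_grProj h v).imp fun _ hs => hs.1

/-- A homogeneous operator commutes with the projections up to a shift. -/
theorem grProj_apply_of_homogeneous (h : DirectSum.IsInternal gr) {X : Module.End K V} {s : Idx}
    (hX : ∀ i, ∀ v ∈ gr i, X v ∈ gr (i + s)) (i : Idx) (v : V) :
    grProj h (i + s) (X v) = X (grProj h i v) := by
  refine congrArg (fun f : Module.End K V => f v) (ext_of_internal h (f := grProj h (i + s) * X)
    (f' := X * grProj h i) fun j w hw => ?_)
  rw [Module.End.mul_apply, Module.End.mul_apply]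
  by_cases hij : i = j
  · subst hij
    rw [grProj_of_mem h hw, grProj_of_mem h (hX _ _ hw)]
  · rw [grProj_of_ne h hij hw, grProj_of_ne h (fun e => hij (add_right_cancel e)) (hX _ _ hw),
      map_zero]

/-- A family of subspaces that spans and is separated by linear maps is a direct sum
decomposition. -/
theorem isInternal_of_proj {W : Type*} [AddCommGroup W] [Module K W] (e : V →ₗ[K] W)
    (he : Function.Injective e) (D : Idx → V →ₗ[K] W) (h1 : ∀ i, ∀ v ∈ gr i, D i v = e v)
    (h2 : ∀ i j, j ≠ i → ∀ v ∈ gr i, D j v = 0) (htop : ⨆ i, gr i = ⊤) :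
    DirectSum.IsInternal gr := by
  refine (DirectSum.isInternal_submodule_iff_iSupIndep_and_iSup_eq_top gr).2 ⟨?_, htop⟩
  rw [iSupIndep_def]
  intro i
  rw [Submodule.disjoint_def]
  intro v hv hv'
  have hle : ⨆ j, ⨆ (_ : j ≠ i), gr j ≤ LinearMap.ker (D i) :=
    iSup₂_le fun j hj w hw => h2 j i hj.symm w hw
  exact he (by rw [← h1 i v hv, map_zero, hle hv'])

theorem subGr_isInternal (h : DirectSum.IsInternal gr) (S : Submodule K V)
    (hS : ∀ v ∈ S, ∀ i, grProj h i v ∈ S) : DirectSum.IsInternal (subGr gr S) := by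
  refine isInternal_of_proj S.subtype S.injective_subtype (fun i => grProj h i ∘ₗ S.subtype)
    (fun i v hv => grProj_of_mem h hv) (fun i j hij v hv => grProj_of_ne h hij hv) ?_
  rw [eq_top_iff]
  rintro v -
  obtain ⟨s, -, hs⟩ := exists_eq_sum_grProj h (v : V)
  have : v = ∑ i ∈ s, (⟨grProj h i v, hS v v.2 i⟩ : S) := by
    ext
    rw [AddSubmonoidClass.coe_finsetSum]
    exact hs
  rw [this]
  exact Submodule.sum_mem _ fun i _ =>
    Submodule.mem_iSup_of_mem (p := subGr gr S) i (grProj_mem h i (v : V))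

/-! ### Parity -/

theorem sgn_mul_self (e : ZMod 2) : sgn K e * sgn K e = 1 := by
  unfold sgn; split_ifs <;> simp

theorem sgn_one_add (e : ZMod 2) : sgn K (e + 1) = -sgn K e := by
  unfold sgn
  revert e
  have h : ∀ e : ZMod 2, (e + 1 = 0) ↔ ¬ (e = 0) := by decide
  intro e
  simp only [h]
  by_cases h0 : e = 0 <;> simp [h0]

theorem parityOp_apply (h : DirectSum.IsInternal gr) {i : Idx} {v : V} (hv : v ∈ gr i) :
    parityOp gr v = sgn K i.1 • v := by
  rw [parityOp, dif_pos h, LinearMap.comp_apply, LinearEquiv.coe_coe,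
    ofBijective_symm_of_mem h hv, DirectSum.toModule_lof]
  rfl

theorem parityOp_mul_self (h : DirectSum.IsInternal gr) : parityOp gr * parityOp gr = 1 :=
  ext_of_internal h fun i v hv => by
    rw [Module.End.mul_apply, parityOp_apply h hv, map_smul, parityOp_apply h hv, smul_smul,
      sgn_mul_self, one_smul]
    rfl

theorem parityOp_conj_even (h : DirectSum.IsInternal gr) {X : Module.End K V} {p w : ℤ}
    (hX : ∀ i, ∀ v ∈ gr i, X v ∈ gr (i + (0, p, w))) :
    parityOp gr * X * parityOp gr = X :=
  ext_of_internal h fun i v hv => by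
    rw [Module.End.mul_apply, Module.End.mul_apply, parityOp_apply h hv, map_smul, map_smul,
      parityOp_apply h (hX i v hv), smul_smul, Prod.fst_add, add_zero, sgn_mul_self, one_smul]

theorem parityOp_conj_odd (h : DirectSum.IsInternal gr) {X : Module.End K V} {p w : ℤ}
    (hX : ∀ i, ∀ v ∈ gr i, X v ∈ gr (i + (1, p, w))) :
    parityOp gr * X * parityOp gr = -X :=
  ext_of_internal h fun i v hv => by
    rw [Module.End.mul_apply, Module.End.mul_apply, parityOp_apply h hv, map_smul, map_smul,
      parityOp_apply h (hX i v hv), smul_smul, Prod.fst_add, sgn_one_add, mul_neg, sgn_mul_self,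
      neg_smul, one_smul, LinearMap.neg_apply]

end Graded

section Parity

variable {K V : Type*} [Field K] [AddCommGroup V] [Module K V]
  {P X Y : Module.End K V}

theorem oddPart_of_even (h : P * X * P = X) : oddPart P X = 0 := by
  rw [oddPart, h, sub_self, smul_zero]

theorem evenPart_of_odd (h : P * X * P = -X) : evenPart P X = 0 := by
  rw [evenPart, h, add_neg_cancel, smul_zero]

theorem mul_eq_neg_of_odd (hP : P * P = 1) (hX : P * X * P = -X) : P * X = -(X * P) := by
  rw [← neg_mul, ← hX, mul_assoc _ P P, hP, mul_one]

theorem mul_eq_of_even (hP : P * P = 1) (hX : P * X * P = X) : P * X = X * P := by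
  conv_rhs => rw [← hX]
  rw [mul_assoc _ P P, hP, mul_one]

variable [CharZero K]

theorem evenPart_of_even (h : P * X * P = X) : evenPart P X = X := by
  rw [evenPart, h, ← two_smul K X, smul_smul, inv_mul_cancel₀ two_ne_zero, one_smul]

theorem oddPart_of_odd (h : P * X * P = -X) : oddPart P X = X := by
  rw [oddPart, h, sub_neg_eq_add, ← two_smul K X, smul_smul, inv_mul_cancel₀ two_ne_zero, one_smul]

theorem superSwap_of_even (h : P * X * P = X) : superSwap P X Y = Y * X := by
  rw [superSwap, evenPart_of_even h, oddPart_of_even h, mul_zero, add_zero]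

theorem superSwap_of_odd (h : P * X * P = -X) : superSwap P X Y = P * Y * P * X := by
  rw [superSwap, evenPart_of_odd h, oddPart_of_odd h, mul_zero, zero_add]

theorem superSwap_odd_odd (hX : P * X * P = -X) (hY : P * Y * P = -Y) :
    superSwap P X Y = -(Y * X) := by
  rw [superSwap_of_odd hX, hY, neg_mul]

theorem superBracket_even (h : P * X * P = X) : superBracket P X Y = X * Y - Y * X := by
  rw [superBracket, superSwap_of_even h]

theorem superBracket_odd_even (hX : P * X * P = -X) (hY : P * Y * P = Y) :
    superBracket P X Y = X * Y - Y * X := by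
  rw [superBracket, superSwap_of_odd hX, hY]

theorem superBracket_odd_odd (hX : P * X * P = -X) (hY : P * Y * P = -Y) :
    superBracket P X Y = X * Y + Y * X := by
  rw [superBracket, superSwap_odd_odd hX hY, sub_neg_eq_add]

/-- The supercommutator with an odd operator `Y` on the right, for an arbitrary `X`. -/
theorem superBracket_odd_right (hY : P * Y * P = -Y) :
    superBracket P X Y = X * Y - Y * (P * X * P) := by
  have h2 : (2 : K)⁻¹ + (2 : K)⁻¹ = 1 := by norm_num
  rw [superBracket, superSwap, hY, evenPart, oddPart, neg_mul, mul_smul_comm, mul_smul_comm,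
    mul_add, mul_sub, ← sub_eq_add_neg, ← smul_sub]
  congr 1
  rw [add_sub_sub_cancel, ← two_smul K, smul_smul, inv_mul_cancel₀ two_ne_zero, one_smul]

end Parity

/-! ### Gradings of tensor products -/

section TensorGrading

variable {K A B : Type*} [Field K] [AddCommGroup A] [Module K A] [AddCommGroup B] [Module K B]

/-- Local finiteness on a tensor product can be checked on pure tensors. -/
theorem locFinite_of_tmul {J : Type*} {F : J → Module.End K (A ⊗[K] B)}
    (h : ∀ a b, ∃ s : Finset J, ∀ j ∉ s, F j (a ⊗ₜ[K] b) = 0) : LocFinite F := by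
  classical
  refine locFinite_of_finset fun v => ?_
  induction v with
  | zero => exact ⟨∅, by simp⟩
  | tmul a b => exact h a b
  | add x y hx hy =>
    obtain ⟨s, hs⟩ := hx
    obtain ⟨t, ht⟩ := hy
    refine ⟨s ∪ t, fun j hj => ?_⟩
    rw [Finset.mem_union, not_or] at hj
    rw [map_add, hs j hj.1, ht j hj.2, add_zero]

theorem locFinite_map_left {J : Type*} {F : J → Module.End K A} (hF : LocFinite F)
    (G : J → Module.End K B) : LocFinite fun j => TensorProduct.map (F j) (G j) :=
  locFinite_of_tmul fun a b => (hF.exists_finset a).imp fun s hs j hj => by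
    rw [TensorProduct.map_tmul, hs j hj, TensorProduct.zero_tmul]

theorem locFinite_map_right {J : Type*} (F : J → Module.End K A) {G : J → Module.End K B}
    (hG : LocFinite G) : LocFinite fun j => TensorProduct.map (F j) (G j) :=
  locFinite_of_tmul fun a b => (hG.exists_finset b).imp fun s hs j hj => by
    rw [TensorProduct.map_tmul, hs j hj, TensorProduct.tmul_zero]

variable {grA : Idx → Submodule K A} {grB : Idx → Submodule K B}

theorem tmul_mem_tensorGr {i j k : Idx} (hk : i + j = k) {a : A} (ha : a ∈ grA i) {b : B}
    (hb : b ∈ grB j) : a ⊗ₜ[K] b ∈ tensorGr grA grB k :=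
  Submodule.mem_iSup_of_mem i <| Submodule.mem_iSup_of_mem j <| Submodule.mem_iSup_of_mem hk <|
    Submodule.apply_mem_map₂ _ ha hb

theorem tensorGr_le {k : Idx} {S : Submodule K (A ⊗[K] B)}
    (h : ∀ i j, i + j = k → ∀ a ∈ grA i, ∀ b ∈ grB j, a ⊗ₜ[K] b ∈ S) : tensorGr grA grB k ≤ S :=
  iSup_le fun i => iSup_le fun j => iSup_le fun hk => Submodule.map₂_le.2 fun a ha b hb =>
    h i j hk a ha b hb

theorem map_mem_tensorGr {X : Module.End K A} {W : Module.End K B} {s t u : Idx}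
    (hX : ∀ i, ∀ v ∈ grA i, X v ∈ grA (i + s)) (hW : ∀ i, ∀ v ∈ grB i, W v ∈ grB (i + t))
    (hu : s + t = u) (k : Idx) {v : A ⊗[K] B} (hv : v ∈ tensorGr grA grB k) :
    TensorProduct.map X W v ∈ tensorGr grA grB (k + u) := by
  revert v
  change tensorGr grA grB k ≤ (tensorGr grA grB (k + u)).comap (TensorProduct.map X W)
  refine tensorGr_le fun i j hij a ha b hb => ?_
  rw [Submodule.mem_comap, TensorProduct.map_tmul]
  exact tmul_mem_tensorGr (by rw [← hij, ← hu]; abel) (hX i a ha) (hW j b hb)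

theorem locSum_mem {V J : Type*} [AddCommGroup V] [Module K V] {F : J → Module.End K V}
    (hF : LocFinite F) {S : Submodule K V} {v : V} (h : ∀ j, F j v ∈ S) : locSum F v ∈ S := by
  obtain ⟨s, hs⟩ := hF.exists_finset v
  rw [locSum_apply_eq_sum hF s hs]
  exact S.sum_mem fun j _ => h j

theorem tensorGr_isInternal (hA : DirectSum.IsInternal grA) (hB : DirectSum.IsInternal grB) :
    DirectSum.IsInternal (tensorGr grA grB) := by
  have hfin : ∀ k, LocFinite fun i : Idx =>
      TensorProduct.map (grProj hA i) (grProj hB (k - i)) := fun k =>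
    locFinite_map_left (locFinite_grProj hA) _
  have key : ∀ k i j, ∀ a ∈ grA i, ∀ b ∈ grB j,
      locSum (fun i : Idx => TensorProduct.map (grProj hA i) (grProj hB (k - i))) (a ⊗ₜ[K] b) =
        a ⊗ₜ[K] grProj hB (k - i) b := by
    intro k i j a ha b hb
    rw [locSum_apply_eq_sum (hfin k) {i}, Finset.sum_singleton, TensorProduct.map_tmul,
      grProj_of_mem hA ha]
    intro l hl
    rw [TensorProduct.map_tmul, grProj_of_ne hA (by simpa using hl) ha, TensorProduct.zero_tmul]
  refine isInternal_of_proj LinearMap.id Function.injective_id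
    (fun k => locSum fun i : Idx => TensorProduct.map (grProj hA i) (grProj hB (k - i))) ?_ ?_ ?_
  · intro k v hv
    rw [← sub_eq_zero, ← LinearMap.sub_apply, ← LinearMap.mem_ker]
    revert v
    refine tensorGr_le fun i j hij a ha b hb => ?_
    rw [LinearMap.mem_ker, LinearMap.sub_apply, key k i j a ha b hb,
      show k - i = j by rw [← hij]; abel, grProj_of_mem hB hb]
    exact sub_self _
  · intro k l hl v hv
    rw [← LinearMap.mem_ker]
    revert v
    refine tensorGr_le fun i j hij a ha b hb => ?_
    rw [LinearMap.mem_ker, key l i j a ha b hb, grProj_of_ne hB _ hb, TensorProduct.tmul_zero]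
    intro e
    exact hl (by rw [← hij, ← e]; abel)
  · rw [eq_top_iff, ← TensorProduct.span_tmul_eq_top, Submodule.span_le]
    rintro _ ⟨a, b, rfl⟩
    obtain ⟨s, -, hs⟩ := exists_eq_sum_grProj hA a
    obtain ⟨t, -, ht⟩ := exists_eq_sum_grProj hB b
    rw [hs, ht, TensorProduct.sum_tmul]
    refine Submodule.sum_mem _ fun i _ => ?_
    rw [TensorProduct.tmul_sum]
    exact Submodule.sum_mem _ fun j _ => Submodule.mem_iSup_of_mem (i + j)
      (tmul_mem_tensorGr rfl (grProj_mem hA i a) (grProj_mem hB j b))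

end TensorGrading

end ChiralCartan

namespace ChiralCartan

/-! ### Fields and their products -/

section Fields

variable {K V : Type*} [Field K] [AddCommGroup V] [Module K V] {A B : ℤ → Module.End K V}
  {P : Module.End K V}

theorem locSum_eq_sum {J : Type*} {F : J → Module.End K V} (s : Finset J)
    (h : ∀ k ∉ s, F k = 0) : locSum F = ∑ j ∈ s, F j := by
  have h' : LocFinite F := locFinite_of_finset fun v => ⟨s, fun k hk => by rw [h k hk]; rfl⟩
  ext v
  rw [locSum_apply_eq_sum h' s (fun k hk => by rw [h k hk]; rfl), LinearMap.sum_apply]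

theorem locSum_smul {J : Type*} {F : J → Module.End K V} (h : LocFinite F) (a : K) :
    locSum (fun j => a • F j) = a • locSum F := by
  have := locSum_mul_left h (a • (1 : Module.End K V))
  simpa only [smul_mul_assoc, one_mul] using this

theorem isField_iff_eventually :
    IsField A ↔ ∀ v, ∀ᶠ n in Filter.atTop, A n v = 0 := by
  simp only [IsField, Filter.eventually_atTop]

theorem IsField.eventually (h : IsField A) (n : ℤ) (v : V) :
    ∀ᶠ j : ℕ in Filter.atTop, A (n + j) v = 0 :=
  (Filter.tendsto_atTop_add_const_left _ n tendsto_natCast_atTop_atTop).eventually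
    (isField_iff_eventually.1 h v)

theorem superSwap_apply_eq_zero {X Y : Module.End K V} {v : V} (h : X v = 0) (h' : X (P v) = 0) :
    superSwap P X Y v = 0 := by
  simp [superSwap, evenPart, oddPart, h, h']

theorem locFinite_borcherdsTerm (hA : IsField A) (hB : IsField B) (l m n : ℤ) :
    LocFinite (borcherdsTerm P A B l m n) := by
  refine locFinite_of_finset fun v => ?_
  obtain ⟨N, hN⟩ := Filter.eventually_atTop.1
    ((hB.eventually n v).and ((hA.eventually m v).and (hA.eventually m (P v))))
  refine ⟨Finset.range N, fun j hj => ?_⟩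
  obtain ⟨h1, h2, h3⟩ := hN j (by simpa using hj)
  simp [borcherdsTerm, h1, superSwap_apply_eq_zero h2 h3]

theorem isField_nProd (hA : IsField A) (hB : IsField B) (n : ℤ) : IsField (nProd P A n B) := by
  rw [isField_iff_eventually]
  intro v
  obtain ⟨N, hN⟩ := Filter.eventually_atTop.1
    ((hA.eventually 0 v).and (hA.eventually 0 (P v)))
  have hBv := isField_iff_eventually.1 hB
  have hfin : ∀ᶠ k : ℤ in Filter.atTop, ∀ j ∈ Finset.range N,
      superSwap P (A (0 + j)) (B (k + n - j)) v = 0 := by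
    rw [Filter.eventually_all_finset]
    intro j _
    have ht : Filter.Tendsto (fun k : ℤ => k + n - j) Filter.atTop Filter.atTop :=
      (Filter.tendsto_atTop_add_const_right _ (n - j) Filter.tendsto_id).congr
        fun k => by simp only [id]; ring
    filter_upwards [ht.eventually (hBv (evenPart P (A (0 + j)) v)),
      ht.eventually (hBv (P (oddPart P (A (0 + j)) v)))] with k h1 h2
    rw [superSwap, LinearMap.add_apply, Module.End.mul_apply, Module.End.mul_apply,
      Module.End.mul_apply, Module.End.mul_apply, h1, h2, map_zero, add_zero]
  have hBk : ∀ᶠ k : ℤ in Filter.atTop, ∀ k' ≥ k, B k' v = 0 :=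
    Filter.eventually_forall_ge_atTop.2 (hBv v)
  filter_upwards [hfin, hBk] with k h1 h2
  rw [nProd, locSum_apply_eq_sum (locFinite_borcherdsTerm hA hB n 0 k) ∅, Finset.sum_empty]
  intro j _
  have h3 : superSwap P (A (0 + j)) (B (k + n - j)) v = 0 := by
    by_cases hj : j < N
    · exact h1 j (by simpa using hj)
    · obtain ⟨h3, h4⟩ := hN j (by omega)
      exact superSwap_apply_eq_zero h3 h4
  simp only [borcherdsTerm, LinearMap.smul_apply, LinearMap.sub_apply, Module.End.mul_apply, h3,
    h2 (k + j) (by omega), map_zero, smul_zero, sub_zero]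

theorem borcherdsTerm_zero_zero (m n : ℤ) :
    borcherdsTerm P A B 0 m n 0 = A m * B n - superSwap P (A m) (B n) := by
  simp [borcherdsTerm]

theorem borcherdsTerm_zero_succ (m n : ℤ) {j : ℕ} (hj : j ≠ 0) :
    borcherdsTerm P A B 0 m n j = 0 := by
  rw [borcherdsTerm, Ring.choose_zero_pos _ (Nat.pos_of_ne_zero hj)]
  simp

theorem choose_neg_one (j : ℕ) : Ring.choose (-1 : ℤ) j = (-1) ^ j := by
  rw [Ring.choose_neg', Ring.multichoose_one]
  simp [Int.negOnePow_def, Units.smul_def]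

/-- The terms of the normally ordered product. -/
theorem borcherdsTerm_neg_one (m n : ℤ) (j : ℕ) :
    borcherdsTerm P A B (-1) m n j =
      A (m - 1 - j) * B (n + j) + superSwap P (A (m + j)) (B (n - 1 - j)) := by
  rw [borcherdsTerm, choose_neg_one]
  push_cast
  rw [← mul_pow, neg_one_mul, neg_neg, one_pow, one_smul, zpow_neg_one, inv_neg_one, neg_one_smul,
    sub_neg_eq_add, ← sub_eq_add_neg, ← sub_eq_add_neg]

/-- Two fields that supercommute have vanishing `l`-th products for `l ≥ 0`. -/
theorem nProd_eq_zero (h : ∀ m n, A m * B n = superSwap P (A m) (B n)) (l : ℕ) (k : ℤ) :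
    nProd P A l B k = 0 := by
  rw [nProd, locSum_eq_sum (Finset.range (l + 1))]
  · simp only [borcherdsTerm, ← h, Ring.choose_natCast, smul_sub, Finset.sum_sub_distrib]
    rw [sub_eq_zero, ← Finset.sum_range_reflect]
    refine Finset.sum_congr rfl fun j hj => ?_
    have hj : j ≤ l := by simpa [Nat.lt_succ_iff] using hj
    have e : l + 1 - 1 - j = l - j := by omega
    rw [e, smul_smul, Nat.choose_symm hj, Nat.cast_sub hj]
    congr 1
    · rw [zpow_natCast, mul_right_comm]
      congr 1
      rw [← pow_add, show j + l = (l - j) + (j + j) by omega, pow_add, ← two_mul, pow_mul]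
      simp
    · congr 2 <;> ring
  · intro j hj
    rw [borcherdsTerm, Ring.choose_natCast, Nat.choose_eq_zero_of_lt (by simpa using hj)]
    simp

theorem nProd_zero_right (P : Module.End K V) (A : ℤ → Module.End K V) (n k : ℤ) :
    nProd P A n (fun _ => 0) k = 0 := by
  rw [nProd, locSum_eq_sum ∅]
  · rfl
  · intro j _
    simp [borcherdsTerm, superSwap]

theorem nProd_shift_right (hA : IsField A) (hB : IsField B) (a : K) (n p k : ℤ) :
    nProd P A n (fun m => a • B (m + p)) k = a • nProd P A n B (k + p) := by
  rw [nProd, nProd, ← locSum_smul (locFinite_borcherdsTerm hA hB n 0 (k + p))]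
  congr 1
  funext j
  have e1 : k + j + p = k + p + j := by ring
  have e2 : k + n - j + p = k + p + n - j := by ring
  simp only [borcherdsTerm, superSwap, e1, e2, mul_smul_comm, smul_mul_assoc, smul_sub, smul_add]
  simp only [smul_comm a]

theorem superSwap_smul_one [CharZero K] (hP : P * P = 1) (X : Module.End K V) (a : K) :
    superSwap P X (a • 1) = a • X := by
  rw [superSwap, mul_smul_comm, smul_mul_assoc, mul_one, smul_mul_assoc, smul_mul_assoc, hP,
    one_mul, one_mul, ← smul_add, evenPart, oddPart, ← smul_add, add_add_sub_cancel,
    ← two_smul K X, smul_smul,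
    smul_smul, inv_mul_cancel_right₀ two_ne_zero]

/-- The normally ordered product with a distribution that has a single scalar mode. -/
theorem nProd_neg_one_single [CharZero K] (hP : P * P = 1) (a : K) (p k : ℤ) :
    nProd P A (-1) (fun m => if m = -1 - p then a • 1 else 0) k = a • A (k + p) := by
  rw [nProd]
  have hs : ∀ X : Module.End K V, superSwap P X 0 = 0 := fun X => by simp [superSwap]
  rcases lt_or_ge (k + p) 0 with h | h
  · obtain ⟨j, hj⟩ := Int.eq_ofNat_of_zero_le (show 0 ≤ -1 - p - k by omega)
    rw [locSum_eq_single j, borcherdsTerm_neg_one, if_pos (by omega), if_neg (by omega), hs,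
      add_zero, mul_smul_comm, mul_one, show (0 : ℤ) - 1 - j = k + p by omega]
    intro i hi
    rw [borcherdsTerm_neg_one, if_neg (by omega), if_neg (by omega), hs, mul_zero, add_zero]
  · obtain ⟨j, hj⟩ := Int.eq_ofNat_of_zero_le h
    rw [locSum_eq_single j, borcherdsTerm_neg_one, if_neg (by omega), if_pos (by omega),
      superSwap_smul_one hP, mul_zero, zero_add, show (0 : ℤ) + j = k + p by omega]
    intro i hi
    rw [borcherdsTerm_neg_one, if_neg (by omega), if_neg (by omega), hs, mul_zero, add_zero]

end Fields

/-! ### Supercommutators with an odd operator -/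

section Twist

variable {K V : Type*} [Field K] [AddCommGroup V] [Module K V] {P C X Y : Module.End K V}

/-- The map `X ↦ X C - C (P X P)`, which for odd `C` is the supercommutator `X ↦ [X, C]`. -/
def oddBracket (P C : Module.End K V) : Module.End K V →ₗ[K] Module.End K V where
  toFun X := X * C - C * (P * X * P)
  map_add' X Y := by simp only [mul_add, add_mul]; abel
  map_smul' a X := by
    simp only [mul_smul_comm, smul_mul_assoc, smul_sub, RingHom.id_apply]

theorem oddBracket_apply (P C X : Module.End K V) :
    oddBracket P C X = X * C - C * (P * X * P) := rfl

theorem conj_mul (hP : P * P = 1) : P * (X * Y) * P = P * X * P * (P * Y * P) := by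
  calc P * (X * Y) * P = P * X * 1 * Y * P := by simp only [mul_assoc, one_mul]
    _ = _ := by rw [← hP]; simp only [mul_assoc]

theorem conj_conj (hP : P * P = 1) : P * (P * X * P) * P = X := by
  calc P * (P * X * P) * P = (P * P) * X * (P * P) := by simp only [mul_assoc]
    _ = X := by rw [hP, one_mul, mul_one]

theorem oddBracket_mul (hP : P * P = 1) :
    oddBracket P C (X * Y) = X * oddBracket P C Y + oddBracket P C X * (P * Y * P) := by
  simp only [oddBracket_apply]
  rw [conj_mul hP, mul_sub, sub_mul]
  simp only [mul_assoc]
  abel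

theorem oddBracket_conj (hP : P * P = 1) (hC : P * C * P = -C) :
    oddBracket P C (P * X * P) = -(P * oddBracket P C X * P) := by
  simp only [oddBracket_apply]
  rw [conj_conj hP, mul_sub, sub_mul, conj_mul hP, conj_mul hP, conj_conj hP, hC]
  noncomm_ring

theorem oddBracket_superSwap (hP : P * P = 1) (hC : P * C * P = -C) (hX : oddBracket P C X = 0) :
    oddBracket P C (superSwap P X Y) = superSwap P X (oddBracket P C Y) := by
  have hX' : oddBracket P C (P * X * P) = 0 := by rw [oddBracket_conj hP hC, hX]; simp
  have hE : oddBracket P C (evenPart P X) = 0 := by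
    rw [evenPart, map_smul, map_add, hX, hX', add_zero, smul_zero]
  have hO : oddBracket P C (oddPart P X) = 0 := by
    rw [oddPart, map_smul, map_sub, hX, hX', sub_zero, smul_zero]
  have hPE : P * evenPart P X * P = evenPart P X := by
    rw [evenPart, mul_smul_comm, smul_mul_assoc, mul_add, add_mul, conj_conj hP, add_comm]
  have hPO : P * oddPart P X * P = -oddPart P X := by
    rw [oddPart, mul_smul_comm, smul_mul_assoc, mul_sub, sub_mul, conj_conj hP, ← smul_neg,
      neg_sub]
  rw [superSwap, map_add, oddBracket_mul hP, oddBracket_mul hP, hE, hO, hPE, hPO,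
    oddBracket_conj hP hC, superSwap]
  simp

theorem oddBracket_locSum {J : Type*} {F : J → Module.End K V} (h : LocFinite F) :
    oddBracket P C (locSum F) = locSum fun j => oddBracket P C (F j) := by
  simp only [oddBracket_apply]
  rw [locSum_sub (h.mul_right C) (((h.mul_left P).mul_right P).mul_left C), locSum_mul_right h,
    locSum_mul_left ((h.mul_left P).mul_right P), locSum_mul_right (h.mul_left P),
    locSum_mul_left h]

/-- An odd operator that supercommutes with the left factor acts on a product of fields through the
right factor. -/
theorem oddBracket_nProd {A B : ℤ → Module.End K V} (hP : P * P = 1) (hC : P * C * P = -C)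
    (hA : IsField A) (hB : IsField B) (h : ∀ m, oddBracket P C (A m) = 0) (n k : ℤ) :
    oddBracket P C (nProd P A n B k) = nProd P A n (fun m => oddBracket P C (B m)) k := by
  rw [nProd, oddBracket_locSum (locFinite_borcherdsTerm hA hB n 0 k), nProd]
  congr 1
  funext j
  rw [borcherdsTerm, map_smul, map_sub, map_smul, oddBracket_superSwap hP hC (h _),
    oddBracket_mul hP, h, zero_mul, add_zero, borcherdsTerm]

theorem oddBracket_nProd_nProd_of_eq_zero {A B D : ℤ → Module.End K V} (hP : P * P = 1)
    (hC : P * C * P = -C) (hA : IsField A) (hB : IsField B) (hD : IsField D)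
    (hA' : ∀ m, oddBracket P C (A m) = 0) (hB' : ∀ m, oddBracket P C (B m) = 0)
    (hD' : ∀ m, oddBracket P C (D m) = 0) (k : ℤ) :
    oddBracket P C (nProd P A (-1) (nProd P B (-1) D) k) = 0 := by
  rw [oddBracket_nProd hP hC hA (isField_nProd hB hD _) hA']
  simp only [oddBracket_nProd hP hC hB hD hB', hD', nProd_zero_right]

theorem oddBracket_nProd_of_eq_single [CharZero K] {A B : ℤ → Module.End K V} (hP : P * P = 1)
    (hC : P * C * P = -C) (hA : IsField A) (hB : IsField B)
    (hA' : ∀ m, oddBracket P C (A m) = 0) {a : K} {p : ℤ}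
    (hB' : ∀ m, oddBracket P C (B m) = if m = -1 - p then a • 1 else 0) (k : ℤ) :
    oddBracket P C (nProd P A (-1) B k) = a • A (k + p) := by
  rw [oddBracket_nProd hP hC hA hB hA']
  simp only [hB', nProd_neg_one_single hP]

theorem oddBracket_nProd_nProd_of_eq_single [CharZero K] {A B D : ℤ → Module.End K V}
    (hP : P * P = 1) (hC : P * C * P = -C) (hA : IsField A) (hB : IsField B) (hD : IsField D)
    (hA' : ∀ m, oddBracket P C (A m) = 0) (hB' : ∀ m, oddBracket P C (B m) = 0) {a : K} {p : ℤ}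
    (hD' : ∀ m, oddBracket P C (D m) = if m = -1 - p then a • 1 else 0) (k : ℤ) :
    oddBracket P C (nProd P A (-1) (nProd P B (-1) D) k) = a • nProd P A (-1) B (k + p) := by
  rw [oddBracket_nProd hP hC hA (isField_nProd hB hD _) hA']
  simp only [oddBracket_nProd_of_eq_single hP hC hB hD hB' hD']
  exact nProd_shift_right hA hB a (-1) p k

/-! ### Tensor products with a parity involution on the left factor -/

variable {B : Type*} [AddCommGroup B] [Module K B] {S D : Module.End K V}

theorem map_one_mul_self (hS : S * S = 1) :
    TensorProduct.map S (1 : Module.End K B) * TensorProduct.map S 1 = 1 := by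
  rw [← TensorProduct.map_mul, hS, one_mul, TensorProduct.map_one]

theorem map_one_conj_left (hS : S * S = 1) (hX : S * X = -(X * S)) :
    TensorProduct.map S (1 : Module.End K B) * TensorProduct.map X 1 * TensorProduct.map S 1 =
      -TensorProduct.map X 1 := by
  rw [← TensorProduct.map_mul, ← TensorProduct.map_mul, hX, neg_mul, mul_assoc, hS, mul_one,
    one_mul, one_mul]
  refine TensorProduct.ext' fun v w => ?_
  rw [TensorProduct.map_tmul, LinearMap.neg_apply, LinearMap.neg_apply, TensorProduct.map_tmul,
    TensorProduct.neg_tmul]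

theorem map_one_conj_right (hS : S * S = 1) (Y : Module.End K B) :
    TensorProduct.map S (1 : Module.End K B) * TensorProduct.map 1 Y * TensorProduct.map S 1 =
      TensorProduct.map 1 Y := by
  rw [← TensorProduct.map_mul, ← TensorProduct.map_mul, mul_one, hS, one_mul, mul_one]

theorem oddBracket_map_left (hS : S * S = 1) (hX : S * X = -(X * S)) :
    oddBracket (TensorProduct.map S (1 : Module.End K B)) (TensorProduct.map D 1)
      (TensorProduct.map X 1) = TensorProduct.map (X * D + D * X) 1 := by
  rw [oddBracket_apply, map_one_conj_left hS hX]
  refine TensorProduct.ext' fun v w => ?_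
  simp only [LinearMap.sub_apply, Module.End.mul_apply, LinearMap.neg_apply, map_neg,
    TensorProduct.map_tmul, LinearMap.add_apply, TensorProduct.add_tmul, sub_neg_eq_add,
    Module.End.one_apply]

theorem oddBracket_map_right (hS : S * S = 1) (Y : Module.End K B) :
    oddBracket (TensorProduct.map S (1 : Module.End K B)) (TensorProduct.map D 1)
      (TensorProduct.map 1 Y) = 0 := by
  rw [oddBracket_apply, map_one_conj_right hS, ← TensorProduct.map_mul, ← TensorProduct.map_mul,
    one_mul, mul_one, mul_one, one_mul, sub_self]

end Twist

end ChiralCartan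

namespace ChiralCartan

/-! ### Operators on the Fock modules -/

section Relations

variable {K E : Type*} [Field K] [AddCommGroup E] [Module K E] {X Y S : Module.End K E} {a c : K}

theorem mul_eq_smul_of_eq_add (h : X * Y = a • (Y * X) + c • 1) (hc : c = 0) :
    X * Y = a • (Y * X) := by
  rw [h, hc, zero_smul, add_zero]

theorem mul_eq_smul_symm (ha : a * a = 1) (h : X * Y = a • (Y * X)) : Y * X = a • (X * Y) := by
  rw [h, smul_smul, ha, one_smul]

theorem add_eq_of_mul_eq (h : X * Y = (-1 : K) • (Y * X) + c • 1) : X * Y + Y * X = c • 1 := by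
  rw [h, neg_one_smul]
  abel

theorem add_eq_zero_of_mul_eq (h : X * Y = (-1 : K) • (Y * X)) : X * Y + Y * X = 0 := by
  rw [h, neg_one_smul, neg_add_cancel]

theorem apply_apply_eq_self (h : ∀ v, S (X v) = -(X (S v))) {v : E} (hv : S (S v) = v) :
    S (S (X v)) = X v := by
  rw [h, map_neg, h, hv, neg_neg]

theorem map_ite_smul_one {A : Type*} [AddCommGroup A] [Module K A] {p q : Prop} [Decidable p]
    [Decidable q] (a : K) (h : p ↔ q) :
    TensorProduct.map ((if p then a else 0) • 1 : Module.End K E) (1 : Module.End K A) =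
      if q then a • 1 else 0 := by
  by_cases hp : p
  · rw [if_pos hp, if_pos (h.1 hp), TensorProduct.map_smul_left, TensorProduct.map_one]
  · rw [if_neg hp, if_neg (fun hq => hp (h.2 hq)), zero_smul, TensorProduct.map_zero_left]

end Relations

section Fock

variable {K V : Type*} [Field K] [AddCommGroup V] [Module K V] (ε : K)

theorem modeGen_vec_vec (x y : V) (m n : ℤ) :
    modeGen ε (.vec x m) * modeGen ε (.vec y n) =
      ε • (modeGen ε (.vec y n) * modeGen ε (.vec x m) : ModeAlg K V ε) := by
  simpa [modeGen] using RingQuot.mkAlgHom_rel K (ModeRel.vec_vec (ε := ε) x y m n)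

theorem modeGen_dual_dual (φ ψ : Module.Dual K V) (m n : ℤ) :
    modeGen ε (.dual φ m) * modeGen ε (.dual ψ n) =
      ε • (modeGen ε (.dual ψ n) * modeGen ε (.dual φ m) : ModeAlg K V ε) := by
  simpa [modeGen] using RingQuot.mkAlgHom_rel K (ModeRel.dual_dual (ε := ε) φ ψ m n)

theorem modeGen_vec_dual (x : V) (φ : Module.Dual K V) (m n : ℤ) :
    modeGen ε (.vec x m) * modeGen ε (.dual φ n) =
      ε • (modeGen ε (.dual φ n) * modeGen ε (.vec x m) : ModeAlg K V ε) +
        algebraMap K _ (if m + n = 0 then φ x else 0) := by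
  simpa only [modeGen, map_mul, map_add, map_smul, AlgHom.commutes] using
    RingQuot.mkAlgHom_rel K (ModeRel.vec_dual (ε := ε) x φ m n)

theorem modeGen_dual_add (φ ψ : Module.Dual K V) (n : ℤ) :
    modeGen ε (.dual (φ + ψ) n) = modeGen ε (.dual φ n) + modeGen ε (.dual ψ n) := by
  simpa [modeGen] using RingQuot.mkAlgHom_rel K (ModeRel.dual_add (ε := ε) φ ψ n)

theorem modeGen_dual_smul (a : K) (φ : Module.Dual K V) (n : ℤ) :
    modeGen ε (.dual (a • φ) n) = a • modeGen ε (.dual φ n) := by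
  simpa [modeGen] using RingQuot.mkAlgHom_rel K (ModeRel.dual_smul (ε := ε) a φ n)

theorem dualOp_mul_dualOp (φ ψ : Module.Dual K V) (m n : ℤ) :
    dualOp K V ε φ m * dualOp K V ε ψ n = ε • (dualOp K V ε ψ n * dualOp K V ε φ m) := by
  simp only [dualOp, ← map_mul, ← map_smul, modeGen_dual_dual ε φ ψ m n]

theorem vecOp_mul_vecOp (x y : V) (m n : ℤ) :
    vecOp K V ε x m * vecOp K V ε y n = ε • (vecOp K V ε y n * vecOp K V ε x m) := by
  simp only [vecOp, ← map_mul, ← map_smul, modeGen_vec_vec ε x y m n]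

theorem vecOp_mul_dualOp (x : V) (φ : Module.Dual K V) (m n : ℤ) :
    vecOp K V ε x m * dualOp K V ε φ n = ε • (dualOp K V ε φ n * vecOp K V ε x m) +
      (if m + n = 0 then φ x else 0) • 1 := by
  simp only [vecOp, dualOp, ← map_mul, ← map_smul, modeGen_vec_dual ε x φ m n, map_add,
    AlgHom.commutes]
  exact congrArg _ (Algebra.algebraMap_eq_smul_one _)

theorem vecOp_mul_dualOp_of_ne (x : V) (φ : Module.Dual K V) {m n : ℤ} (h : m + n ≠ 0) :
    vecOp K V ε x m * dualOp K V ε φ n = ε • (dualOp K V ε φ n * vecOp K V ε x m) :=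
  mul_eq_smul_of_eq_add (vecOp_mul_dualOp ε x φ m n) (if_neg h)

/-- A subspace of the Fock module that contains the vacuum vector and is stable under all generators
is the whole module. -/
theorem fock_eq_top {S : Submodule K (Fock K V ε)} (h1 : fockVac K V ε ∈ S)
    (hv : ∀ x n, ∀ v ∈ S, vecOp K V ε x n v ∈ S)
    (hd : ∀ φ n, ∀ v ∈ S, dualOp K V ε φ n v ∈ S) : S = ⊤ := by
  have key : ∀ a : FreeAlgebra K (ModeGen K V), ∀ v ∈ S,
      RingQuot.mkAlgHom K (ModeRel K V ε) a • v ∈ S := by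
    intro a
    induction a using FreeAlgebra.induction with
    | grade0 r =>
      intro v hv
      rw [AlgHom.commutes, algebraMap_smul]
      exact S.smul_mem r hv
    | grade1 x =>
      cases x with
      | vec x n => exact hv x n
      | dual φ n => exact hd φ n
    | mul a b ha hb =>
      intro v hv
      rw [map_mul, mul_smul]
      exact ha _ (hb _ hv)
    | add a b ha hb =>
      intro v hv
      rw [map_add, add_smul]
      exact S.add_mem (ha _ hv) (hb _ hv)
  rw [eq_top_iff]
  rintro v -
  obtain ⟨a, rfl⟩ := Submodule.Quotient.mk_surjective _ v
  obtain ⟨b, rfl⟩ := RingQuot.mkAlgHom_surjective K (ModeRel K V ε) a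
  have := key b _ h1
  rwa [fockVac, ← Submodule.Quotient.mk_smul, smul_eq_mul, mul_one] at this

/-- The vectors that are killed by almost all modes `F_(n)`, `n ≥ 0`. -/
def fieldSub {W : Type*} [AddCommGroup W] [Module K W] (F : ℤ → Module.End K W) :
    Submodule K W where
  carrier := {v | ∀ᶠ n in Filter.atTop, F n v = 0}
  zero_mem' := by simp
  add_mem' := by
    intro a b ha hb
    simp only [Set.mem_ofPred_eq] at ha hb ⊢
    filter_upwards [ha, hb] with n h1 h2
    rw [map_add, h1, h2, add_zero]
  smul_mem' := by
    intro a v ha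
    simp only [Set.mem_ofPred_eq] at ha ⊢
    filter_upwards [ha] with n h1
    rw [map_smul, h1, smul_zero]

theorem mem_fieldSub {W : Type*} [AddCommGroup W] [Module K W] {F : ℤ → Module.End K W} {v : W} :
    v ∈ fieldSub F ↔ ∀ᶠ n in Filter.atTop, F n v = 0 := Iff.rfl

theorem isField_iff_fieldSub_eq_top {W : Type*} [AddCommGroup W] [Module K W]
    {F : ℤ → Module.End K W} : IsField F ↔ fieldSub F = ⊤ := by
  rw [isField_iff_eventually, Submodule.eq_top_iff']
  rfl

/-- If `F_(n)` commutes with `X` up to a scalar factor for almost all `n ≥ 0`, then `X` preserves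
the vectors killed by almost all `F_(n)`. -/
theorem apply_mem_fieldSub {W : Type*} [AddCommGroup W] [Module K W] {F : ℤ → Module.End K W}
    {X : Module.End K W} {a : K} (h : ∀ᶠ n in Filter.atTop, F n * X = a • (X * F n)) {v : W}
    (hv : v ∈ fieldSub F) : X v ∈ fieldSub F := by
  rw [mem_fieldSub] at hv ⊢
  filter_upwards [h, hv] with n h1 h2
  rw [← Module.End.mul_apply, h1, LinearMap.smul_apply, Module.End.mul_apply, h2, map_zero,
    smul_zero]

theorem vecOp_mul_dualOp_eventually (x : V) (φ : Module.Dual K V) (n : ℤ) :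
    ∀ᶠ m in Filter.atTop,
      vecOp K V ε x m * dualOp K V ε φ n = ε • (dualOp K V ε φ n * vecOp K V ε x m) := by
  filter_upwards [Filter.eventually_gt_atTop (-n)] with m hm
  exact vecOp_mul_dualOp_of_ne ε x φ (by omega)

theorem dualOp_mul_vecOp_eventually (hε : ε * ε = 1) (x : V) (φ : Module.Dual K V) (m : ℤ) :
    ∀ᶠ n in Filter.atTop,
      dualOp K V ε φ n * vecOp K V ε x m = ε • (vecOp K V ε x m * dualOp K V ε φ n) := by
  filter_upwards [Filter.eventually_gt_atTop (-m)] with n hn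
  exact mul_eq_smul_symm hε (vecOp_mul_dualOp_of_ne ε x φ (by omega))

theorem isField_vecOp (x : V) : IsField (vecOp K V ε x) := by
  rw [isField_iff_fieldSub_eq_top]
  refine fock_eq_top ε ?_ ?_ ?_
  · rw [mem_fieldSub]
    filter_upwards [Filter.eventually_ge_atTop 0] with n hn
    change modeGen ε (.vec x n) • fockVac K V ε = 0
    rw [fockVac, ← Submodule.Quotient.mk_smul, smul_eq_mul, mul_one,
      Submodule.Quotient.mk_eq_zero]
    exact Submodule.subset_span (Or.inl ⟨x, n, hn, rfl⟩)
  · intro y n v hv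
    exact apply_mem_fieldSub (Filter.Eventually.of_forall fun m => vecOp_mul_vecOp ε x y m n) hv
  · intro φ n v hv
    exact apply_mem_fieldSub (vecOp_mul_dualOp_eventually ε x φ n) hv

theorem isField_dualOp (hε : ε * ε = 1) (φ : Module.Dual K V) : IsField (dualOp K V ε φ) := by
  rw [isField_iff_fieldSub_eq_top]
  refine fock_eq_top ε ?_ ?_ ?_
  · rw [mem_fieldSub]
    filter_upwards [Filter.eventually_ge_atTop 1] with n hn
    change modeGen ε (.dual φ n) • fockVac K V ε = 0
    rw [fockVac, ← Submodule.Quotient.mk_smul, smul_eq_mul, mul_one,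
      Submodule.Quotient.mk_eq_zero]
    exact Submodule.subset_span (Or.inr ⟨φ, n, hn, rfl⟩)
  · intro y n v hv
    exact apply_mem_fieldSub (dualOp_mul_vecOp_eventually ε hε y φ n) hv
  · intro ψ n v hv
    exact apply_mem_fieldSub
      (Filter.Eventually.of_forall fun m => dualOp_mul_dualOp ε φ ψ m n) hv

theorem fockSign_smul (a : ModeAlg K V ε) (v : Fock K V ε) :
    fockSign K V ε (a • v) = modeSign K V ε a • fockSign K V ε v :=
  (Submodule.mapQ (annIdeal K V ε) (annIdeal K V ε)
    (modeSign K V ε : ModeAlg K V ε →+* ModeAlg K V ε).toSemilinearMap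
      (annIdeal_le_comap K V ε)).map_smulₛₗ a v

theorem fockSign_vac : fockSign K V ε (fockVac K V ε) = fockVac K V ε := by
  change Submodule.Quotient.mk (modeSign K V ε 1) = _
  rw [map_one]
  rfl

theorem fockSign_modeGen (s : ModeGen K V) (v : Fock K V ε) :
    fockSign K V ε (modeGen ε s • v) = -(modeGen ε s • fockSign K V ε v) := by
  rw [fockSign_smul, modeSign_gen, smul_assoc]
  exact neg_one_smul K (modeGen ε s • fockSign K V ε v)

theorem fockSign_mul_self : fockSign K V ε * fockSign K V ε = 1 := by
  have h : LinearMap.eqLocus (fockSign K V ε * fockSign K V ε : Module.End K (Fock K V ε))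
      (1 : Module.End K (Fock K V ε)) = ⊤ := by
    refine fock_eq_top ε ?_ (fun x n v hv => ?_) (fun φ n v hv => ?_)
    · change fockSign K V ε (fockSign K V ε (fockVac K V ε)) = fockVac K V ε
      rw [fockSign_vac, fockSign_vac]
    · exact apply_apply_eq_self (X := vecOp K V ε x n) (fockSign_modeGen ε (.vec x n)) hv
    · exact apply_apply_eq_self (X := dualOp K V ε φ n) (fockSign_modeGen ε (.dual φ n)) hv
  refine LinearMap.ext fun v => ?_
  have hv : v ∈ (⊤ : Submodule K (Fock K V ε)) := Submodule.mem_top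
  rw [← h] at hv
  exact hv

theorem fockSign_mul_vecOp (x : V) (n : ℤ) :
    fockSign K V ε * vecOp K V ε x n = -(vecOp K V ε x n * fockSign K V ε) :=
  LinearMap.ext fun v => fockSign_modeGen ε (.vec x n) v

theorem fockSign_mul_dualOp (φ : Module.Dual K V) (n : ℤ) :
    fockSign K V ε * dualOp K V ε φ n = -(dualOp K V ε φ n * fockSign K V ε) :=
  LinearMap.ext fun v => fockSign_modeGen ε (.dual φ n) v

end Fock

/-! ### The differential of the semi-infinite Weil algebra on the generators `c` -/

section Weil

variable {K g : Type*} [Field K] [LieRing g] [LieAlgebra K g]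

theorem isField_map_left {A B : Type*} [AddCommGroup A] [Module K A] [AddCommGroup B] [Module K B]
    {F : ℤ → Module.End K A} (hF : IsField F) (X : Module.End K B) :
    IsField fun n => TensorProduct.map (F n) X := by
  rw [isField_iff_fieldSub_eq_top, eq_top_iff, ← TensorProduct.span_tmul_eq_top, Submodule.span_le]
  rintro _ ⟨a, b, rfl⟩
  filter_upwards [isField_iff_eventually.1 hF a] with n hn
  rw [TensorProduct.map_tmul, hn, TensorProduct.zero_tmul]

theorem isField_map_right {A B : Type*} [AddCommGroup A] [Module K A] [AddCommGroup B]
    [Module K B] (X : Module.End K A) {F : ℤ → Module.End K B} (hF : IsField F) :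
    IsField fun n => TensorProduct.map X (F n) := by
  rw [isField_iff_fieldSub_eq_top, eq_top_iff, ← TensorProduct.span_tmul_eq_top, Submodule.span_le]
  rintro _ ⟨a, b, rfl⟩
  filter_upwards [isField_iff_eventually.1 hF b] with n hn
  rw [TensorProduct.map_tmul, hn, TensorProduct.tmul_zero]

theorem IsField.shift {V : Type*} [AddCommGroup V] [Module K V] {F : ℤ → Module.End K V}
    (hF : IsField F) (p : ℤ) : IsField fun n => F (n + p) := by
  intro v
  obtain ⟨N, hN⟩ := hF v
  exact ⟨N - p, fun n hn => hN _ (by omega)⟩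

theorem isField_bField (x : g) : IsField (bField K x) :=
  isField_map_left (isField_vecOp (-1) x) 1

theorem isField_cField (φ : Module.Dual K g) : IsField (cField φ) :=
  isField_map_left ((isField_dualOp (-1) (by simp) φ).shift 1) 1

theorem isField_betaField (x : g) : IsField (betaField K x) :=
  isField_map_right 1 (isField_vecOp 1 x)

theorem isField_gammaField (φ : Module.Dual K g) : IsField (gammaField φ) :=
  isField_map_right 1 ((isField_dualOp 1 (by simp) φ).shift 1)

variable (K g) in
theorem weilParity_mul_self : weilParity K g * weilParity K g = 1 :=
  map_one_mul_self (fockSign_mul_self (-1))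

theorem weilParity_conj_c (φ : Module.Dual K g) (n : ℤ) :
    weilParity K g * cField φ n * weilParity K g = -cField φ n :=
  map_one_conj_left (fockSign_mul_self (-1)) (fockSign_mul_dualOp _ φ (n + 1))

theorem dualOp_anticomm (φ ψ : Module.Dual K g) (m n : ℤ) :
    dualOp K g (-1) φ m * dualOp K g (-1) ψ n +
      dualOp K g (-1) ψ n * dualOp K g (-1) φ m = 0 :=
  add_eq_zero_of_mul_eq (dualOp_mul_dualOp (-1) φ ψ m n)

theorem vecOp_anticomm_dualOp (x : g) (φ : Module.Dual K g) (m n : ℤ) :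
    vecOp K g (-1) x m * dualOp K g (-1) φ n + dualOp K g (-1) φ n * vecOp K g (-1) x m =
      (if m + n = 0 then φ x else 0) • 1 :=
  add_eq_of_mul_eq (vecOp_mul_dualOp (-1) x φ m n)

theorem oddBracket_cField_cField (φ ψ : Module.Dual K g) (n m : ℤ) :
    oddBracket (weilParity K g) (cField φ n) (cField ψ m) = 0 :=
  (oddBracket_map_left (fockSign_mul_self (-1)) (fockSign_mul_dualOp _ ψ (m + 1))).trans
    ((congrArg (fun X => TensorProduct.map X 1) (dualOp_anticomm ψ φ (m + 1) (n + 1))).trans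
      (TensorProduct.map_zero_left _))

theorem oddBracket_cField_gammaField (φ ψ : Module.Dual K g) (n m : ℤ) :
    oddBracket (weilParity K g) (cField φ n) (gammaField ψ m) = 0 :=
  oddBracket_map_right (fockSign_mul_self (-1)) _

theorem oddBracket_cField_betaField (φ : Module.Dual K g) (x : g) (n m : ℤ) :
    oddBracket (weilParity K g) (cField φ n) (betaField K x m) = 0 :=
  oddBracket_map_right (fockSign_mul_self (-1)) _

/-- The only contraction with `c` among the generators. -/
theorem oddBracket_cField_bField (φ : Module.Dual K g) (x : g) (n m : ℤ) :
    oddBracket (weilParity K g) (cField φ n) (bField K x m) =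
      if m = -1 - n then φ x • 1 else 0 := by
  refine (oddBracket_map_left (fockSign_mul_self (-1)) (fockSign_mul_vecOp _ x m)).trans
    ((congrArg (fun X => TensorProduct.map X 1) (vecOp_anticomm_dualOp x φ m (n + 1))).trans ?_)
  exact map_ite_smul_one _ (by omega)

theorem map_one_superSwap_left {K A B : Type*} [Field K] [CharZero K] [AddCommGroup A] [Module K A]
    [AddCommGroup B] [Module K B] {S X Y : Module.End K A} (hS : S * S = 1)
    (hX : S * X = -(X * S)) (hY : S * Y = -(Y * S)) (h : X * Y + Y * X = 0) :
    TensorProduct.map X (1 : Module.End K B) * TensorProduct.map Y 1 =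
      superSwap (TensorProduct.map S 1) (TensorProduct.map X 1) (TensorProduct.map Y 1) := by
  rw [superSwap_odd_odd (map_one_conj_left hS hX) (map_one_conj_left hS hY),
    ← TensorProduct.map_mul, ← TensorProduct.map_mul, eq_neg_of_add_eq_zero_left h, mul_one]
  refine TensorProduct.ext' fun v w => ?_
  rw [TensorProduct.map_tmul, LinearMap.neg_apply, LinearMap.neg_apply, TensorProduct.map_tmul,
    TensorProduct.neg_tmul]

theorem map_one_superSwap_right {K A B : Type*} [Field K] [CharZero K] [AddCommGroup A]
    [Module K A] [AddCommGroup B] [Module K B] {S X : Module.End K A} (hS : S * S = 1)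
    (hX : S * X = -(X * S)) (Y : Module.End K B) :
    TensorProduct.map X (1 : Module.End K B) * TensorProduct.map 1 Y =
      superSwap (TensorProduct.map S 1) (TensorProduct.map X 1) (TensorProduct.map 1 Y) := by
  rw [superSwap_of_odd (map_one_conj_left hS hX), map_one_conj_right hS, ← TensorProduct.map_mul,
    ← TensorProduct.map_mul, one_mul, mul_one, mul_one, one_mul]

theorem cField_mul_cField [CharZero K] (φ ψ : Module.Dual K g) (m n : ℤ) :
    cField φ m * cField ψ n = superSwap (weilParity K g) (cField φ m) (cField ψ n) :=
  map_one_superSwap_left (fockSign_mul_self (-1)) (fockSign_mul_dualOp _ φ (m + 1))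
    (fockSign_mul_dualOp _ ψ (n + 1)) (dualOp_anticomm φ ψ (m + 1) (n + 1))

theorem cField_mul_gammaField [CharZero K] (φ ψ : Module.Dual K g) (m n : ℤ) :
    cField φ m * gammaField ψ n = superSwap (weilParity K g) (cField φ m) (gammaField ψ n) :=
  map_one_superSwap_right (fockSign_mul_self (-1)) (fockSign_mul_dualOp _ φ (m + 1)) _

theorem dualOp_add (φ ψ : Module.Dual K g) (n : ℤ) :
    dualOp K g (-1) (φ + ψ) n = dualOp K g (-1) φ n + dualOp K g (-1) ψ n := by
  simp only [dualOp, modeGen_dual_add, map_add]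

theorem dualOp_smul (a : K) (φ : Module.Dual K g) (n : ℤ) :
    dualOp K g (-1) (a • φ) n = a • dualOp K g (-1) φ n := by
  simp only [dualOp, modeGen_dual_smul, map_smul]

variable (K g) in
/-- The generators `c^φ` of `⟨c, γ⟩` depend linearly on `φ`. -/
noncomputable def cLinear : Module.Dual K g →ₗ[K] weilPrime K g where
  toFun := c'
  map_add' φ ψ := Subtype.ext (funext fun n =>
    (congrArg (fun X => TensorProduct.map X 1) (dualOp_add φ ψ (n + 1))).trans
      (TensorProduct.map_add_left _ _ _))
  map_smul' a φ := Subtype.ext (funext fun n =>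
    (congrArg (fun X => TensorProduct.map X 1) (dualOp_smul a φ (n + 1))).trans
      (TensorProduct.map_smul_left _ _ _))

theorem cLinear_apply (φ : Module.Dual K g) : cLinear K g φ = c' φ := rfl

theorem isHomogeneous_cField (φ : Module.Dual K g) :
    IsHomogeneous (weilGr K g) (1, 1, 0) (cField φ) := by
  intro n j v hv
  induction hv using Submodule.span_induction with
  | mem v hv =>
    refine Submodule.subset_span ?_
    have := IsMonomial.c φ n j v hv
    rwa [show j + (1, 1, -n - 1) = j + (1, 1, 0) + (0, 0, -n - 1) by
      rw [add_assoc]; congr 1; ext <;> simp] at this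
  | zero => rw [map_zero]; exact Submodule.zero_mem _
  | add x y _ _ hx hy => rw [map_add]; exact Submodule.add_mem _ hx hy
  | smul a x _ hx => rw [map_smul]; exact Submodule.smul_mem _ a hx

theorem isHomogeneous_gammaField (φ : Module.Dual K g) :
    IsHomogeneous (weilGr K g) (0, 2, 0) (gammaField φ) := by
  intro n j v hv
  induction hv using Submodule.span_induction with
  | mem v hv =>
    refine Submodule.subset_span ?_
    have := IsMonomial.gamma φ n j v hv
    rwa [show j + (0, 2, -n - 1) = j + (0, 2, 0) + (0, 0, -n - 1) by
      rw [add_assoc]; congr 1; ext <;> simp] at this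
  | zero => rw [map_zero]; exact Submodule.zero_mem _
  | add x y _ _ hx hy => rw [map_add]; exact Submodule.add_mem _ hx hy
  | smul a x _ hx => rw [map_smul]; exact Submodule.smul_mem _ a hx

variable [CharZero K] {I : Type*} [Fintype I]

/-- The supercommutator of `J_(0)` with `c^φ`: only `b` contracts with `c`. -/
theorem oddBracket_cField_weilJ (bs : Module.Basis I K g) (φ : Module.Dual K g) (n : ℤ) :
    oddBracket (weilParity K g) (cField φ n) (weilJ bs 0) = (-(2 : K)⁻¹) • ∑ i, ∑ j,
      φ ⁅bs i, bs j⁆ • nProd (weilParity K g) (cField (bs.coord i)) (-1)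
        (cField (bs.coord j)) n := by
  have hP := weilParity_mul_self K g
  have hC := weilParity_conj_c φ n
  -- the linearity argument, separated from the concrete module of operators
  have key : ∀ {W W' : Type _} [AddCommGroup W] [Module K W] [AddCommGroup W'] [Module K W']
      (f : W →ₗ[K] W') (F G : I → I → W) (H : I → I → W'), (∀ i j, f (F i j) = 0) →
      (∀ i j, f (G i j) = H i j) →
      f (-(∑ i, ∑ j, F i j) - (2 : K)⁻¹ • ∑ i, ∑ j, G i j) =
        (-(2 : K)⁻¹) • ∑ i, ∑ j, H i j := by
    intro W W' _ _ _ _ f F G H hF hG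
    simp only [map_sub, map_neg, map_smul, map_sum, hF, hG, Finset.sum_const_zero, neg_zero,
      zero_sub, neg_smul]
  have e : weilJ bs 0 = -(∑ i, ∑ j, normalOrd (betaField K ⁅bs i, bs j⁆)
      (normalOrd (gammaField (bs.coord j)) (cField (bs.coord i))) 0) -
      (2 : K)⁻¹ • ∑ i, ∑ j, normalOrd (cField (bs.coord i))
        (normalOrd (cField (bs.coord j)) (bField K ⁅bs i, bs j⁆)) 0 := by
    simp only [weilJ, Pi.sub_apply, Pi.neg_apply, Pi.smul_apply, Finset.sum_apply]
  rw [e]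
  refine key (oddBracket (weilParity K g) (cField φ n)) _ _ _ (fun i j => ?_) (fun i j => ?_)
  · exact oddBracket_nProd_nProd_of_eq_zero hP hC (isField_betaField _) (isField_gammaField _)
      (isField_cField _) (oddBracket_cField_betaField φ _ n) (oddBracket_cField_gammaField φ _ n)
      (oddBracket_cField_cField φ _ n) 0
  · refine (oddBracket_nProd_nProd_of_eq_single hP hC (isField_cField _) (isField_cField _)
      (isField_bField _) (oddBracket_cField_cField φ _ n) (oddBracket_cField_cField φ _ n)
      (oddBracket_cField_bField φ _ n) 0).trans ?_
    rw [zero_add]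

/-- The supercommutator of `K_(0)` with `c^{ξ_k^*}`: the contraction of `b^{ξ_i}` with `c^{ξ_k^*}`
leaves only the summand `i = k`. -/
theorem oddBracket_cField_weilK (bs : Module.Basis I K g) (k : I) (n : ℤ) :
    oddBracket (weilParity K g) (cField (bs.coord k) n) (weilK bs 0) =
      gammaField (bs.coord k) n := by
  classical
  -- the linearity argument, separated from the concrete module of operators
  have key : ∀ {W W' : Type _} [AddCommGroup W] [Module K W] [AddCommGroup W'] [Module K W']
      (f : W →ₗ[K] W') (F : I → W) (H : I → W'), (∀ i, f (F i) = bs.coord k (bs i) • H i) →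
      f (∑ i, F i) = H k := by
    intro W W' _ _ _ _ f F H hF
    simp only [map_sum, hF, Module.Basis.coord_apply, Module.Basis.repr_self,
      Finsupp.single_apply, ite_smul, one_smul, zero_smul, Finset.sum_ite_eq', Finset.mem_univ,
      if_true]
  have e : weilK bs 0 = ∑ i, normalOrd (gammaField (bs.coord i)) (bField K (bs i)) 0 := by
    simp only [weilK, Finset.sum_apply]
  rw [e]
  refine key (oddBracket (weilParity K g) (cField (bs.coord k) n)) _
    (fun i => gammaField (bs.coord i) n) (fun i => ?_)
  refine (oddBracket_nProd_of_eq_single (weilParity_mul_self K g) (weilParity_conj_c _ n)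
    (isField_gammaField _) (isField_bField _) (oddBracket_cField_gammaField _ _ n)
    (oddBracket_cField_bField _ _ n) 0).trans ?_
  rw [zero_add]

/-- The element `γ^{ξ_k^*} - (1/2) ∑ ⟨ξ_k^*, [ξ_i, ξ_j]⟩ :c^{ξ_i^*} c^{ξ_j^*}:` of `⟨c, γ⟩`. -/
noncomputable def dc' (bs : Module.Basis I K g) (k : I) : weilPrime K g :=
  gamma' (bs.coord k) + (-(2 : K)⁻¹) • ∑ i, ∑ j,
    bs.coord k ⁅bs i, bs j⁆ • nProd' (c' (bs.coord i)) (-1) (c' (bs.coord j))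

/-- The Weil differential of `c^{ξ_k^*}`. -/
theorem isWeilDiff_c' (bs : Module.Basis I K g) (k : I) :
    IsWeilDiff bs (c' (bs.coord k)) (dc' bs k) := by
  intro n
  refine Eq.symm ((superBracket_odd_right (weilParity_conj_c _ n)).trans ?_)
  refine (map_add (oddBracket (weilParity K g) (cField (bs.coord k) n)) _ _).trans ?_
  rw [oddBracket_cField_weilJ, oddBracket_cField_weilK, add_comm]
  simp only [dc', Submodule.coe_add, SetLike.val_smul, AddSubmonoidClass.coe_finsetSum,
    Pi.add_apply, Pi.smul_apply, Finset.sum_apply]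
  rfl

end Weil

end ChiralCartan

namespace ChiralCartan

/-! ### Commutation relations in differential `sg[t]`-modules -/

namespace DiffSgtModule

variable {K g A : Type*} [Field K] [LieRing g] [LieAlgebra K g] [AddCommGroup A] [Module K A]
  (M : DiffSgtModule K g A)

theorem internal : DirectSum.IsInternal M.gr := M.isGradedComplex.internal

theorem parity_mul_self : parityOp M.gr * parityOp M.gr = 1 := parityOp_mul_self M.internal

theorem parity_conj_d : parityOp M.gr * M.d * parityOp M.gr = -M.d :=
  parityOp_conj_odd M.internal M.isGradedComplex.d_mem

theorem parity_conj_L (n : ℕ) (ξ : g) : parityOp M.gr * M.L n ξ * parityOp M.gr = M.L n ξ :=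
  parityOp_conj_even M.internal (M.L_mem n ξ)

theorem parity_conj_ι (n : ℕ) (ξ : g) : parityOp M.gr * M.ι n ξ * parityOp M.gr = -M.ι n ξ :=
  parityOp_conj_odd M.internal (M.ι_mem n ξ)

/-- A vector killed by all `L_{ξ,(n)}` and `ι_{ξ,(n)}` with `n ≥ k`. -/
def IsBounded (M : DiffSgtModule K g A) (k : ℕ) (v : A) : Prop :=
  ∀ n ≥ k, ∀ ξ : g, M.L n ξ v = 0 ∧ M.ι n ξ v = 0

theorem exists_isBounded (v : A) : ∃ k, M.IsBounded k v := M.continuous v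

variable {M} in
theorem IsBounded.mono {k l : ℕ} {v : A} (h : M.IsBounded k v) (hkl : k ≤ l) : M.IsBounded l v :=
  fun n hn ξ => h n (hkl.trans hn) ξ

variable [CharZero K]

theorem L_mul_L (m n : ℕ) (ξ η : g) :
    M.L m ξ * M.L n η = M.L n η * M.L m ξ + M.L (m + n) ⁅ξ, η⁆ := by
  rw [← M.bracket_L_L, superBracket_even (M.parity_conj_L m ξ), add_sub_cancel]

theorem L_mul_ι (m n : ℕ) (ξ η : g) :
    M.L m ξ * M.ι n η = M.ι n η * M.L m ξ + M.ι (m + n) ⁅ξ, η⁆ := by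
  rw [← M.bracket_L_ι, superBracket_even (M.parity_conj_L m ξ), add_sub_cancel]

theorem ι_mul_ι (m n : ℕ) (ξ η : g) : M.ι m ξ * M.ι n η = -(M.ι n η * M.ι m ξ) := by
  have := M.bracket_ι_ι m n ξ η
  rw [superBracket_odd_odd (M.parity_conj_ι m ξ) (M.parity_conj_ι n η)] at this
  exact eq_neg_of_add_eq_zero_left this

theorem ι_mul_self (n : ℕ) (ξ : g) : M.ι n ξ * M.ι n ξ = 0 := by
  have h : (2 : K) • (M.ι n ξ * M.ι n ξ) = 0 := by
    rw [two_smul]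
    nth_rw 1 [M.ι_mul_ι]
    exact neg_add_cancel _
  exact (smul_eq_zero.1 h).resolve_left two_ne_zero

theorem d_mul_L (n : ℕ) (ξ : g) : M.d * M.L n ξ = M.L n ξ * M.d := by
  have := M.bracket_d_L n ξ
  rw [superBracket_odd_even M.parity_conj_d (M.parity_conj_L n ξ)] at this
  exact sub_eq_zero.1 this

theorem d_mul_ι (n : ℕ) (ξ : g) : M.d * M.ι n ξ = -(M.ι n ξ * M.d) + M.L n ξ := by
  rw [← M.bracket_d_ι, superBracket_odd_odd M.parity_conj_d (M.parity_conj_ι n ξ)]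
  abel

variable {M}

theorem IsBounded.L {k : ℕ} {v : A} (h : M.IsBounded k v) (m : ℕ) (η : g) :
    M.IsBounded k (M.L m η v) := by
  intro n hn ξ
  have h1 := congrArg (fun X => X v) (M.L_mul_L n m ξ η)
  have h2 := congrArg (fun X => X v) (M.L_mul_ι m n η ξ)
  simp only [Module.End.mul_apply, LinearMap.add_apply, (h n hn ξ).1, (h n hn ξ).2, map_zero,
    (h (n + m) (by omega) _).1, (h (m + n) (by omega) _).2, add_zero] at h1 h2
  exact ⟨h1, h2.symm⟩

theorem IsBounded.ι {k : ℕ} {v : A} (h : M.IsBounded k v) (m : ℕ) (η : g) :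
    M.IsBounded k (M.ι m η v) := by
  intro n hn ξ
  have h1 := congrArg (fun X => X v) (M.L_mul_ι n m ξ η)
  have h2 := congrArg (fun X => X v) (M.ι_mul_ι n m ξ η)
  simp only [Module.End.mul_apply, LinearMap.add_apply, LinearMap.neg_apply, (h n hn ξ).1,
    (h n hn ξ).2, map_zero, (h (n + m) (by omega) _).2, add_zero, neg_zero] at h1 h2
  exact ⟨h1, h2⟩

theorem IsBounded.d {k : ℕ} {v : A} (h : M.IsBounded k v) : M.IsBounded k (M.d v) := by
  intro n hn ξ
  have h1 := congrArg (fun X => X v) (M.d_mul_L n ξ)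
  have h2 := congrArg (fun X => X v) (M.d_mul_ι n ξ)
  simp only [Module.End.mul_apply, LinearMap.add_apply, LinearMap.neg_apply, (h n hn ξ).1,
    (h n hn ξ).2, map_zero, add_zero] at h1 h2
  exact ⟨h1.symm, neg_eq_zero.1 h2.symm⟩

end DiffSgtModule

/-! ### Commutation relations in chiral `W^*`-modules -/

theorem locSum_add {K V J : Type*} [Field K] [AddCommGroup V] [Module K V]
    {F G : J → Module.End K V} (h : LocFinite F) (h' : LocFinite G) :
    locSum (fun j => F j + G j) = locSum F + locSum G := by
  ext v
  rw [locSum_apply (h.add h'), LinearMap.add_apply, locSum_apply h, locSum_apply h',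
    ← finsum_add_distrib (h v) (h' v)]
  rfl

/-- Splitting off the first `N` terms of a locally finite sum. -/
theorem locSum_eq_sum_range_add {K V : Type*} [Field K] [AddCommGroup V] [Module K V]
    {F : ℕ → Module.End K V} (h : LocFinite F) (N : ℕ) :
    locSum F = ∑ j ∈ Finset.range N, F j + locSum fun j => F (N + j) := by
  ext v
  have h' : LocFinite fun j => F (N + j) := fun v =>
    (h v).preimage (f := fun j => N + j) (add_right_injective N).injOn
  obtain ⟨s, hs⟩ := h.exists_finset v
  obtain ⟨m, hm⟩ := s.exists_nat_subset_range
  have hF : ∀ j, m ≤ j → F j v = 0 := fun j hj =>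
    hs j fun hjs => by have := Finset.mem_range.1 (hm hjs); omega
  rw [LinearMap.add_apply, LinearMap.sum_apply,
    locSum_apply_eq_sum h (Finset.range (N + m)) (fun j hj => hF j (by simp at hj; omega)),
    locSum_apply_eq_sum h' (Finset.range m) (fun j hj => hF _ (by simp at hj; omega)),
    Finset.sum_range_add]

/-- The `l`-th products of two supercommuting fields of `⟨c, γ⟩` vanish for `l ≥ 0`. -/
theorem nProd'_eq_zero {K g : Type*} [Field K] [LieRing g] [LieAlgebra K g] {x y : weilPrime K g}
    (h : ∀ m n, (x : ℤ → Module.End K (Weil K g)) m * (y : ℤ → Module.End K (Weil K g)) n =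
      superSwap (weilParity K g) ((x : ℤ → Module.End K (Weil K g)) m)
        ((y : ℤ → Module.End K (Weil K g)) n)) (l : ℕ) : nProd' x l y = 0 :=
  Subtype.ext (funext fun k => nProd_eq_zero h l k)

namespace ChiralWStarModule

variable {K g A I : Type*} [Field K] [LieRing g] [LieAlgebra K g] [AddCommGroup A] [Module K A]
  [Fintype I] {bs : Module.Basis I K g} (M : ChiralWStarModule bs A)

theorem isField_c (φ : Module.Dual K g) : IsField (M.c φ) := M.isField (c' φ)

theorem c_mem (φ : Module.Dual K g) (n : ℤ) (i : Idx) (v : A) (hv : v ∈ M.gr i) :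
    M.c φ n v ∈ M.gr (i + (1, 1, -n - 1)) := by
  have := M.Y_homogeneous (c' φ) (1, 1, 0) (isHomogeneous_cField φ) n i v hv
  rwa [add_assoc, show ((1, 1, 0) + (0, 0, -n - 1) : Idx) = (1, 1, -n - 1) by ext <;> simp] at this

theorem gamma_mem (φ : Module.Dual K g) (n : ℤ) (i : Idx) (v : A) (hv : v ∈ M.gr i) :
    M.gamma φ n v ∈ M.gr (i + (0, 2, -n - 1)) := by
  have := M.Y_homogeneous (gamma' φ) (0, 2, 0) (isHomogeneous_gammaField φ) n i v hv
  rwa [add_assoc, show ((0, 2, 0) + (0, 0, -n - 1) : Idx) = (0, 2, -n - 1) by ext <;> simp] at this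

theorem parity_conj_c (φ : Module.Dual K g) (n : ℤ) :
    parityOp M.gr * M.c φ n * parityOp M.gr = -M.c φ n :=
  parityOp_conj_odd M.internal (M.c_mem φ n)

theorem parity_conj_gamma (φ : Module.Dual K g) (n : ℤ) :
    parityOp M.gr * M.gamma φ n * parityOp M.gr = M.gamma φ n :=
  parityOp_conj_even M.internal (M.gamma_mem φ n)

/-- If all products `x_(l) y`, `l ≥ 0`, vanish, then the fields of `x` and `y` supercommute. -/
theorem Y_mul_Y {x y : weilPrime K g} (h : ∀ l : ℕ, nProd' x l y = 0) (m n : ℤ) :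
    M.Y x m * M.Y y n = superSwap (parityOp M.gr) (M.Y x m) (M.Y y n) := by
  have hb := M.borcherds x y 0 m n
  have h0 : (fun j : ℕ => ((Ring.choose m j : ℤ) : K) •
      M.Y (nProd' x (0 + j) y) (m + n - j)) = fun _ => 0 := by
    funext j
    rw [zero_add, h, map_zero]
    exact smul_zero _
  rw [h0, locSum_zero, locSum_eq_single 0 fun j hj => borcherdsTerm_zero_succ m n hj,
    borcherdsTerm_zero_zero] at hb
  exact sub_eq_zero.1 hb.symm

/-- The field of the normally ordered product `x_(-1) y`. -/
theorem Y_nProd'_neg_one (x y : weilPrime K g) (n : ℤ) :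
    M.Y (nProd' x (-1) y) n =
      locSum (borcherdsTerm (parityOp M.gr) (M.Y x) (M.Y y) (-1) 0 n) := by
  rw [← M.borcherds, locSum_eq_single 0]
  · simp
  · intro j hj
    rw [Ring.choose_zero_pos _ (Nat.pos_of_ne_zero hj), Int.cast_zero, zero_smul]

theorem bracket_L_mul_c [CharZero K] (m : ℕ) (ξ : g) (φ : Module.Dual K g) (n : ℤ) :
    M.L m ξ * M.c φ n = M.c φ n * M.L m ξ + M.c (coad ξ φ) (m + n) := by
  have := M.bracket_L_c m n ξ φ
  rw [superBracket_even (M.parity_conj_L m ξ)] at this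
  rw [c, c, ← this, add_sub_cancel]

theorem bracket_ι_mul_c [CharZero K] (m : ℕ) (ξ : g) (φ : Module.Dual K g) (n : ℤ) :
    M.ι m ξ * M.c φ n + M.c φ n * M.ι m ξ = if m + n = -1 then φ ξ • 1 else 0 := by
  rw [← M.bracket_ι_c m n ξ φ]
  exact (superBracket_odd_odd (M.parity_conj_ι m ξ) (M.parity_conj_c φ n)).symm

/-- The coadjoint action on `c`, in coordinates. -/
theorem c_coad (ξ : g) (φ : Module.Dual K g) (n : ℤ) :
    M.c (coad ξ φ) n = -∑ j, φ ⁅ξ, bs j⁆ • M.c (bs.coord j) n := by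
  have h : M.c (coad ξ φ) n = ∑ j, (coad ξ φ) (bs j) • M.c (bs.coord j) n := by
    have h1 : coad ξ φ = ∑ j, (coad ξ φ) (bs j) • bs.coord j :=
      (bs.sum_dual_apply_smul_coord _).symm
    have h2 := congrArg (fun ψ => M.Y (cLinear K g ψ) n) h1
    simp only [map_sum, map_smul, cLinear_apply, Finset.sum_apply, Pi.smul_apply] at h2
    exact h2
  rw [h, ← Finset.sum_neg_distrib]
  refine Finset.sum_congr rfl fun j _ => ?_
  rw [← neg_smul]
  rfl

theorem parity_conj_bracket_d_mul_c (φ : Module.Dual K g) (n : ℤ) :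
    parityOp M.gr * (M.d * M.c φ n + M.c φ n * M.d) * parityOp M.gr =
      M.d * M.c φ n + M.c φ n * M.d := by
  rw [mul_add, add_mul, conj_mul M.parity_mul_self, conj_mul M.parity_mul_self, M.parity_conj_c,
    M.parity_conj_d, neg_mul_neg, neg_mul_neg]

variable [CharZero K]

theorem c_mul_c (φ ψ : Module.Dual K g) (m n : ℤ) :
    M.c φ m * M.c ψ n = -(M.c ψ n * M.c φ m) := by
  rw [← superSwap_odd_odd (M.parity_conj_c φ m) (M.parity_conj_c ψ n)]
  exact M.Y_mul_Y (nProd'_eq_zero (cField_mul_cField φ ψ)) m n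

theorem c_mul_gamma (φ ψ : Module.Dual K g) (m n : ℤ) :
    M.c φ m * M.gamma ψ n = M.gamma ψ n * M.c φ m := by
  have h := M.Y_mul_Y (x := c' φ) (y := gamma' ψ)
    (nProd'_eq_zero (cField_mul_gammaField φ ψ)) m n
  have h2 := superSwap_of_odd (Y := M.gamma ψ n) (M.parity_conj_c φ m)
  rw [M.parity_conj_gamma] at h2
  exact h.trans h2

/-- The modes of the normally ordered product `:c^φ c^ψ:`. -/
noncomputable def cc (φ ψ : Module.Dual K g) (n : ℤ) : Module.End K A :=
  locSum (borcherdsTerm (parityOp M.gr) (M.c φ) (M.c ψ) (-1) 0 n)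

/-- The part `∑_{n ≥ 0} c^φ_(n) c^ψ_(-n-m-2)` of the modes of `:c^φ c^ψ:`. -/
noncomputable def ccPos (φ ψ : Module.Dual K g) (m : ℕ) : Module.End K A :=
  locSum fun n : ℕ => M.c φ n * M.c ψ (-(n : ℤ) - (m : ℤ) - 2)

theorem locFinite_ccPos (φ ψ : Module.Dual K g) (m : ℕ) :
    LocFinite fun n : ℕ => M.c φ n * M.c ψ (-(n : ℤ) - (m : ℤ) - 2) := by
  refine locFinite_of_finset fun v => ?_
  obtain ⟨N, hN⟩ := Filter.eventually_atTop.1 ((M.isField_c φ).eventually 0 v)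
  refine ⟨Finset.range N, fun n hn => ?_⟩
  have := hN n (by simpa using hn)
  rw [zero_add] at this
  rw [M.c_mul_c, LinearMap.neg_apply, Module.End.mul_apply, this, map_zero, neg_zero]

/-- The mode `(-m-1)` of `:c^φ c^ψ:`: the products of two modes of negative index are separated
from the remaining products, which form two infinite sums that differ by exchanging `φ` and `ψ`. -/
theorem cc_eq (φ ψ : Module.Dual K g) (m : ℕ) :
    M.cc φ ψ (-(m : ℤ) - 1) =
      ∑ s ∈ Finset.range (m + 1), M.c φ (-(s : ℤ) - 1) * M.c ψ (-((m - s : ℕ) : ℤ) - 1) +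
        M.ccPos φ ψ m - M.ccPos ψ φ m := by
  have hterm : borcherdsTerm (parityOp M.gr) (M.c φ) (M.c ψ) (-1) 0 (-(m : ℤ) - 1) = fun s : ℕ =>
      M.c φ (-(s : ℤ) - 1) * M.c ψ ((s : ℤ) - m - 1) +
        M.c φ s * M.c ψ (-(s : ℤ) - (m : ℤ) - 2) := by
    funext s
    rw [borcherdsTerm_neg_one, superSwap_odd_odd (M.parity_conj_c _ _) (M.parity_conj_c _ _),
      ← M.c_mul_c]
    congr 3 <;> ring
  have hfin : LocFinite fun s : ℕ => M.c φ (-(s : ℤ) - 1) * M.c ψ ((s : ℤ) - m - 1) := by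
    refine locFinite_of_finset fun v => ?_
    obtain ⟨N, hN⟩ := Filter.eventually_atTop.1 ((M.isField_c ψ).eventually (-(m : ℤ) - 1) v)
    refine ⟨Finset.range N, fun s hs => ?_⟩
    have := hN s (by simpa using hs)
    rw [Module.End.mul_apply, show (s : ℤ) - m - 1 = -(m : ℤ) - 1 + s by ring, this, map_zero]
  -- from index `m + 1` on, the second factor has non-negative index and is moved to the left
  have htail : (fun s : ℕ => M.c φ (-((m + 1 + s : ℕ) : ℤ) - 1) *
      M.c ψ (((m + 1 + s : ℕ) : ℤ) - m - 1)) =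
      fun s : ℕ => (-1 : K) • (M.c ψ s * M.c φ (-(s : ℤ) - (m : ℤ) - 2)) := by
    funext s
    rw [neg_one_smul, M.c_mul_c ψ φ, neg_neg]
    congr 2 <;> push_cast <;> ring
  rw [cc, hterm, locSum_add hfin (M.locFinite_ccPos φ ψ m),
    locSum_eq_sum_range_add hfin (m + 1), htail, locSum_smul (M.locFinite_ccPos ψ φ m),
    neg_one_smul]
  have hsum : ∀ s ∈ Finset.range (m + 1), M.c φ (-(s : ℤ) - 1) * M.c ψ ((s : ℤ) - m - 1) =
      M.c φ (-(s : ℤ) - 1) * M.c ψ (-((m - s : ℕ) : ℤ) - 1) := by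
    intro s hs
    have : s ≤ m := by simpa [Nat.lt_succ_iff] using hs
    rw [Nat.cast_sub this]
    congr 2
    ring
  rw [Finset.sum_congr rfl hsum, ccPos, ccPos]
  abel

/-- The differential of `c^{ξ_k^*}`: `[d, c^{ξ_k^*}] = γ^{ξ_k^*} - (1/2) ∑ ⟨ξ_k^*, [ξ_i, ξ_j]⟩
:c^{ξ_i^*} c^{ξ_j^*}:`. -/
theorem bracket_d_mul_c (k : I) (n : ℤ) :
    M.d * M.c (bs.coord k) n + M.c (bs.coord k) n * M.d =
      M.gamma (bs.coord k) n + (-(2 : K)⁻¹) • ∑ i, ∑ j,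
        bs.coord k ⁅bs i, bs j⁆ • M.cc (bs.coord i) (bs.coord j) n := by
  have h := M.bracket_d_Y _ _ (isWeilDiff_c' bs k) n
  have h1 := superBracket_odd_odd M.parity_conj_d (M.parity_conj_c (bs.coord k) n)
  refine h1.symm.trans (h.trans ?_)
  simp only [dc', map_add, map_smul, map_sum, Pi.add_apply, Pi.smul_apply, Finset.sum_apply,
    Y_nProd'_neg_one]
  rfl

theorem cc_commute_c (φ ψ χ : Module.Dual K g) (m n : ℤ) :
    Commute (M.c χ n) (M.cc φ ψ m) := by
  refine (locSum_commute (locFinite_borcherdsTerm (M.isField_c φ) (M.isField_c ψ) _ _ _)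
    fun j => ?_).symm
  rw [borcherdsTerm_neg_one, superSwap_odd_odd (M.parity_conj_c _ _) (M.parity_conj_c _ _)]
  have key : ∀ φ ψ p q, Commute (M.c φ p * M.c ψ q) (M.c χ n) := by
    intro φ ψ p q
    rw [Commute, SemiconjBy, mul_assoc, M.c_mul_c ψ χ, mul_neg, ← mul_assoc, M.c_mul_c φ χ,
      neg_mul, neg_neg, mul_assoc]
  exact (key _ _ _ _).add_left (key _ _ _ _).neg_left

theorem bracket_d_mul_c_commute_c (k : I) (χ : Module.Dual K g) (m n : ℤ) :
    Commute (M.c χ n) (M.d * M.c (bs.coord k) m + M.c (bs.coord k) m * M.d) := by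
  rw [bracket_d_mul_c]
  exact Commute.add_right (M.c_mul_gamma _ _ _ _)
    ((Commute.sum_right _ _ _ fun i _ => Commute.sum_right _ _ _ fun j _ =>
      (M.cc_commute_c _ _ _ _ _).smul_right _).smul_right _)

end ChiralWStarModule

end ChiralCartan

namespace ChiralCartan

/-! ### Operators on the tensor product -/

section Tensor

variable {K g A B I : Type*} [Field K] [LieRing g] [LieAlgebra K g] [AddCommGroup A] [Module K A]
  [AddCommGroup B] [Module K B]

theorem map_commute_of_anticomm {X X' : Module.End K A} {W W' : Module.End K B}
    (hX : X * X' = -(X' * X)) (hW : W * W' = -(W' * W)) :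
    Commute (TensorProduct.map X W) (TensorProduct.map X' W') := by
  refine TensorProduct.ext' fun a b => ?_
  have h1 := congrArg (fun T => T a) hX
  have h2 := congrArg (fun T => T b) hW
  simp only [Module.End.mul_apply, LinearMap.neg_apply] at h1 h2
  simp only [Module.End.mul_apply, TensorProduct.map_tmul, h1, h2, TensorProduct.neg_tmul,
    TensorProduct.tmul_neg, neg_neg]

theorem locSum_map_tmul [Fintype I] (F : I × ℕ → Module.End K A) {H : I × ℕ → Module.End K B}
    (hH : LocFinite H) (a : A) {b : B} {k : ℕ} (hb : ∀ p, k ≤ p.2 → H p b = 0) :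
    locSum (fun p => TensorProduct.map (F p) (H p)) (a ⊗ₜ[K] b) =
      ∑ i, ∑ n ∈ Finset.range k, F (i, n) a ⊗ₜ[K] H (i, n) b := by
  rw [locSum_apply_eq_sum (locFinite_map_right F hH) (Finset.univ ×ˢ Finset.range k),
    Finset.sum_product]
  · rfl
  · intro p hp
    rw [TensorProduct.map_tmul, hb p (by simpa using hp), TensorProduct.tmul_zero]

variable (M : DiffSgtModule K g A) (N : DiffSgtModule K g B)

/-- The pointwise form of the commutation of the parity involution with an odd operator. -/
theorem parity_apply_of_odd {X : Module.End K A}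
    (hX : parityOp M.gr * X * parityOp M.gr = -X) (a : A) :
    parityOp M.gr (X a) = -(X (parityOp M.gr a)) :=
  congrArg (fun T => T a) (mul_eq_neg_of_odd M.parity_mul_self hX)

theorem parity_apply_of_even {X : Module.End K A}
    (hX : parityOp M.gr * X * parityOp M.gr = X) (a : A) :
    parityOp M.gr (X a) = X (parityOp M.gr a) :=
  congrArg (fun T => T a) (mul_eq_of_even M.parity_mul_self hX)

theorem parity_parity_apply (a : A) : parityOp M.gr (parityOp M.gr a) = a :=
  congrArg (fun T => T a) M.parity_mul_self

theorem mem_basicSub {V : Type*} [AddCommGroup V] [Module K V] {L ι : ℕ → g → Module.End K V}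
    {v : V} : v ∈ basicSub L ι ↔ (∀ n ξ, ι n ξ v = 0) ∧ ∀ n ξ, L n ξ v = 0 := by
  simp only [basicSub, Submodule.mem_inf, Submodule.mem_iInf, LinearMap.mem_ker]

theorem parityOp_mem (i : Idx) (v : A) (hv : v ∈ M.gr i) : parityOp M.gr v ∈ M.gr (i + 0) := by
  rw [parityOp_apply M.internal hv, add_zero]
  exact Submodule.smul_mem _ _ hv

theorem one_mem (i : Idx) (v : A) (hv : v ∈ M.gr i) : (1 : Module.End K A) v ∈ M.gr (i + 0) := by
  rwa [add_zero]

theorem totalGr_isInternal : DirectSum.IsInternal (totalGr M N) :=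
  tensorGr_isInternal M.internal N.internal

variable [CharZero K]

theorem opTensor_one (f : Module.End K A) :
    opTensor M N f 1 = TensorProduct.map f 1 := by
  have h : parityOp N.gr * 1 * parityOp N.gr = 1 := by rw [mul_one, N.parity_mul_self]
  rw [opTensor, superTensor, evenPart_of_even h, oddPart_of_even h, TensorProduct.map_zero_right,
    add_zero]

theorem opTensor_L (f : Module.End K A) (n : ℕ) (ξ : g) :
    opTensor M N f (N.L n ξ) = TensorProduct.map f (N.L n ξ) := by
  rw [opTensor, superTensor, evenPart_of_even (N.parity_conj_L n ξ),
    oddPart_of_even (N.parity_conj_L n ξ), TensorProduct.map_zero_right, add_zero]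

theorem opTensor_ι (f : Module.End K A) (n : ℕ) (ξ : g) :
    opTensor M N f (N.ι n ξ) = TensorProduct.map (f * parityOp M.gr) (N.ι n ξ) := by
  rw [opTensor, superTensor, evenPart_of_odd (N.parity_conj_ι n ξ),
    oddPart_of_odd (N.parity_conj_ι n ξ), TensorProduct.map_zero_right, zero_add]

theorem opTensor_d (f : Module.End K A) :
    opTensor M N f N.d = TensorProduct.map (f * parityOp M.gr) N.d := by
  rw [opTensor, superTensor, evenPart_of_odd N.parity_conj_d,
    oddPart_of_odd N.parity_conj_d, TensorProduct.map_zero_right, zero_add]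

theorem totalD_eq :
    totalD M N = TensorProduct.map M.d 1 + TensorProduct.map (parityOp M.gr) N.d := by
  rw [totalD, opTensor_one, opTensor_d, one_mul]

theorem totalL_eq (n : ℕ) (ξ : g) :
    totalL M N n ξ = TensorProduct.map (M.L n ξ) 1 + TensorProduct.map 1 (N.L n ξ) := by
  rw [totalL, opTensor_one, opTensor_L]

theorem totalι_eq (n : ℕ) (ξ : g) :
    totalι M N n ξ =
      TensorProduct.map (M.ι n ξ) 1 + TensorProduct.map (parityOp M.gr) (N.ι n ξ) := by
  rw [totalι, opTensor_one, opTensor_ι, one_mul]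

theorem totalD_mul_self : totalD M N * totalD M N = 0 := by
  rw [totalD_eq]
  refine TensorProduct.ext' fun a b => ?_
  have h1 : M.d (M.d a) = 0 := congrArg (fun T => T a) M.isGradedComplex.d_sq
  have h2 : N.d (N.d b) = 0 := congrArg (fun T => T b) N.isGradedComplex.d_sq
  simp only [Module.End.mul_apply, LinearMap.add_apply, map_add, TensorProduct.map_tmul,
    Module.End.one_apply, h1, h2, parity_apply_of_odd M M.parity_conj_d, TensorProduct.neg_tmul,
    TensorProduct.zero_tmul, TensorProduct.tmul_zero, LinearMap.zero_apply]
  abel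

theorem totalL_mul_totalD (n : ℕ) (ξ : g) :
    totalL M N n ξ * totalD M N = totalD M N * totalL M N n ξ := by
  rw [totalD_eq, totalL_eq]
  refine TensorProduct.ext' fun a b => ?_
  have h1 : M.d (M.L n ξ a) = M.L n ξ (M.d a) := congrArg (fun T => T a) (M.d_mul_L n ξ)
  have h2 : N.d (N.L n ξ b) = N.L n ξ (N.d b) := congrArg (fun T => T b) (N.d_mul_L n ξ)
  simp only [Module.End.mul_apply, LinearMap.add_apply, map_add, TensorProduct.map_tmul,
    Module.End.one_apply, h1, h2, parity_apply_of_even M (M.parity_conj_L n ξ)]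
  abel

theorem totalι_mul_totalD (n : ℕ) (ξ : g) :
    totalι M N n ξ * totalD M N = totalL M N n ξ - totalD M N * totalι M N n ξ := by
  rw [totalD_eq, totalL_eq, totalι_eq]
  refine TensorProduct.ext' fun a b => ?_
  have h1 : M.d (M.ι n ξ a) = -(M.ι n ξ (M.d a)) + M.L n ξ a :=
    congrArg (fun T => T a) (M.d_mul_ι n ξ)
  have h2 : N.d (N.ι n ξ b) = -(N.ι n ξ (N.d b)) + N.L n ξ b :=
    congrArg (fun T => T b) (N.d_mul_ι n ξ)
  simp only [Module.End.mul_apply, LinearMap.add_apply, LinearMap.sub_apply, map_add,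
    TensorProduct.map_tmul, Module.End.one_apply, h1, h2,
    parity_apply_of_odd M (M.parity_conj_ι n ξ), parity_apply_of_odd M M.parity_conj_d,
    parity_parity_apply, TensorProduct.add_tmul, TensorProduct.tmul_add, TensorProduct.neg_tmul,
    TensorProduct.tmul_neg]
  abel

theorem totalD_mem_totalBasic {v : A ⊗[K] B} (hv : v ∈ totalBasic M N) :
    totalD M N v ∈ totalBasic M N := by
  rw [totalBasic, mem_basicSub] at hv ⊢
  refine ⟨fun n ξ => ?_, fun n ξ => ?_⟩
  · rw [← Module.End.mul_apply, totalι_mul_totalD, LinearMap.sub_apply, Module.End.mul_apply,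
      hv.1, hv.2, map_zero, sub_zero]
  · rw [← Module.End.mul_apply, totalL_mul_totalD, Module.End.mul_apply, hv.2, map_zero]

theorem totalD_mem (i : Idx) (v : A ⊗[K] B) (hv : v ∈ totalGr M N i) :
    totalD M N v ∈ totalGr M N (i + (1, 1, 0)) := by
  rw [totalD_eq]
  exact Submodule.add_mem _
    (map_mem_tensorGr M.isGradedComplex.d_mem (one_mem N) (add_zero _) i hv)
    (map_mem_tensorGr (parityOp_mem M) N.isGradedComplex.d_mem (zero_add _) i hv)

theorem totalL_mem (n : ℕ) (ξ : g) (i : Idx) (v : A ⊗[K] B) (hv : v ∈ totalGr M N i) :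
    totalL M N n ξ v ∈ totalGr M N (i + (0, 0, -(n : ℤ))) := by
  rw [totalL_eq]
  exact Submodule.add_mem _
    (map_mem_tensorGr (M.L_mem n ξ) (one_mem N) (add_zero _) i hv)
    (map_mem_tensorGr (one_mem M) (N.L_mem n ξ) (zero_add _) i hv)

theorem totalι_mem (n : ℕ) (ξ : g) (i : Idx) (v : A ⊗[K] B) (hv : v ∈ totalGr M N i) :
    totalι M N n ξ v ∈ totalGr M N (i + (1, -1, -(n : ℤ))) := by
  rw [totalι_eq]
  exact Submodule.add_mem _
    (map_mem_tensorGr (M.ι_mem n ξ) (one_mem N) (add_zero _) i hv)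
    (map_mem_tensorGr (parityOp_mem M) (N.ι_mem n ξ) (zero_add _) i hv)

/-- The basic subspace is the intersection of kernels of homogeneous operators, hence graded. -/
theorem grProj_mem_totalBasic {v : A ⊗[K] B} (hv : v ∈ totalBasic M N) (i : Idx) :
    grProj (totalGr_isInternal M N) i v ∈ totalBasic M N := by
  rw [totalBasic, mem_basicSub] at hv ⊢
  refine ⟨fun n ξ => ?_, fun n ξ => ?_⟩
  · rw [← grProj_apply_of_homogeneous _ (totalι_mem M N n ξ), hv.1, map_zero]
  · rw [← grProj_apply_of_homogeneous _ (totalL_mem M N n ξ), hv.2, map_zero]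

end Tensor

/-! ### The operator `φ` and its commutators -/

section Phi

variable {K g A B I : Type*} [Field K] [LieRing g] [LieAlgebra K g] [AddCommGroup A]
  [Module K A] [AddCommGroup B] [Module K B] [Fintype I] {bs : Module.Basis I K g}
  (M : ChiralWStarModule bs A) (N : DiffSgtModule K g B)

theorem locFinite_ι (ξ : I → g) : LocFinite fun p : I × ℕ => N.ι p.2 (ξ p.1) := by
  refine locFinite_of_finset fun b => ?_
  obtain ⟨k, hk⟩ := N.exists_isBounded b
  exact ⟨Finset.univ ×ˢ Finset.range k, fun p hp => (hk p.2 (by simpa using hp) _).2⟩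

theorem locFinite_L (ξ : I → g) : LocFinite fun p : I × ℕ => N.L p.2 (ξ p.1) := by
  refine locFinite_of_finset fun b => ?_
  obtain ⟨k, hk⟩ := N.exists_isBounded b
  exact ⟨Finset.univ ×ˢ Finset.range k, fun p hp => (hk p.2 (by simpa using hp) _).1⟩

/-- The modes `c_(p)` with `p ≥ P` kill a given vector, uniformly over the basis. -/
theorem exists_c_eq_zero (a : A) : ∃ m : ℕ, ∀ n ≥ m, ∀ i, M.c (bs.coord i) (n : ℤ) a = 0 := by
  have h : ∀ᶠ n : ℕ in Filter.atTop, ∀ i, M.c (bs.coord i) (n : ℤ) a = 0 := by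
    rw [Filter.eventually_all]
    intro i
    filter_upwards [(M.isField_c (bs.coord i)).eventually 0 a] with n hn
    rwa [zero_add] at hn
  exact Filter.eventually_atTop.1 h

/-- Expansion of `ξ` in the basis, in a pure tensor with second factor `ι_{ξ,(m)} b`. -/
theorem sum_coord_tmul_ι (x : A) (m : ℕ) (ξ : g) (b : B) :
    ∑ i, bs.coord i ξ • (x ⊗ₜ[K] N.ι m (bs i) b) = x ⊗ₜ[K] N.ι m ξ b := by
  conv_rhs => rw [← bs.sum_repr ξ, map_sum, LinearMap.sum_apply, TensorProduct.tmul_sum]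
  refine Finset.sum_congr rfl fun i _ => ?_
  rw [map_smul, LinearMap.smul_apply, TensorProduct.tmul_smul]
  rfl

variable [CharZero K]

theorem phiTerm_eq : phiTerm M N = fun p => TensorProduct.map
    (M.c (bs.coord p.1) (-(p.2 : ℤ) - 1) * parityOp M.gr) (N.ι p.2 (bs p.1)) :=
  funext fun _ => opTensor_ι _ _ _ _ _

theorem gammaTerm_eq : gammaTerm M N = fun p => TensorProduct.map
    (M.gamma (bs.coord p.1) (-(p.2 : ℤ) - 1) * parityOp M.gr) (N.ι p.2 (bs p.1)) :=
  funext fun _ => opTensor_ι _ _ _ _ _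

theorem lieTerm_eq : lieTerm M N = fun p => TensorProduct.map
    (M.c (bs.coord p.1) (-(p.2 : ℤ) - 1)) (N.L p.2 (bs p.1)) :=
  funext fun _ => opTensor_L _ _ _ _ _

theorem quadTerm_eq : quadTerm M N = fun p => TensorProduct.map
    (M.c (bs.coord p.1) (p.2.2.2 : ℤ) *
      M.c (bs.coord p.2.1) (-(p.2.2.2 : ℤ) - (p.2.2.1 : ℤ) - 2) * parityOp M.gr)
    (N.ι p.2.2.1 ⁅bs p.1, bs p.2.1⁆) :=
  funext fun _ => opTensor_ι _ _ _ _ _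

theorem locFinite_phiTerm : LocFinite (phiTerm M N) := by
  rw [phiTerm_eq]
  exact locFinite_map_right _ (locFinite_ι N bs)

theorem locFinite_gammaTerm : LocFinite (gammaTerm M N) := by
  rw [gammaTerm_eq]
  exact locFinite_map_right _ (locFinite_ι N bs)

theorem locFinite_lieTerm : LocFinite (lieTerm M N) := by
  rw [lieTerm_eq]
  exact locFinite_map_right _ (locFinite_L N bs)

variable {M N} in
theorem phiZero_tmul (a : A) {b : B} {k : ℕ} (hb : N.IsBounded k b) :
    phiZero M N (a ⊗ₜ[K] b) = ∑ i, ∑ n ∈ Finset.range k,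
      M.c (bs.coord i) (-(n : ℤ) - 1) (parityOp M.gr a) ⊗ₜ[K] N.ι n (bs i) b := by
  rw [phiZero, phiTerm_eq]
  exact locSum_map_tmul _ (locFinite_ι N bs) a fun p hp => (hb _ hp _).2

variable {M N} in
theorem lieTerm_tmul (a : A) {b : B} {k : ℕ} (hb : N.IsBounded k b) :
    locSum (lieTerm M N) (a ⊗ₜ[K] b) = ∑ i, ∑ n ∈ Finset.range k,
      M.c (bs.coord i) (-(n : ℤ) - 1) a ⊗ₜ[K] N.L n (bs i) b := by
  rw [lieTerm_eq]
  exact locSum_map_tmul _ (locFinite_L N bs) a fun p hp => (hb _ hp _).1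

theorem quadTerm_tmul_eq_zero (a : A) {b : B} {k m : ℕ} (hb : N.IsBounded k b)
    (hm : ∀ n ≥ m, ∀ i, M.c (bs.coord i) (n : ℤ) (parityOp M.gr a) = 0) (p : I × I × ℕ × ℕ)
    (hp : p ∉ (Finset.univ ×ˢ Finset.univ ×ˢ Finset.range k ×ˢ Finset.range m :
      Finset (I × I × ℕ × ℕ))) : quadTerm M N p (a ⊗ₜ[K] b) = 0 := by
  simp only [Finset.mem_product, Finset.mem_univ, true_and, Finset.mem_range, not_and_or,
    not_lt] at hp
  rw [quadTerm_eq]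
  simp only [TensorProduct.map_tmul]
  rcases hp with h | h
  · rw [(hb _ h _).2, TensorProduct.tmul_zero]
  · rw [M.c_mul_c, Module.End.mul_apply, LinearMap.neg_apply, Module.End.mul_apply, hm _ h,
      map_zero, neg_zero, TensorProduct.zero_tmul]

theorem locFinite_quadTerm : LocFinite (quadTerm M N) := by
  refine locFinite_of_tmul fun a b => ?_
  obtain ⟨k, hk⟩ := N.exists_isBounded b
  obtain ⟨m, hm⟩ := exists_c_eq_zero M (parityOp M.gr a)
  exact ⟨_, quadTerm_tmul_eq_zero M N a hk hm⟩

variable {M N} in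
theorem quadTerm_tmul (a : A) {b : B} {k : ℕ} (hb : N.IsBounded k b) :
    locSum (quadTerm M N) (a ⊗ₜ[K] b) = ∑ i, ∑ j, ∑ n ∈ Finset.range k,
      M.ccPos (bs.coord i) (bs.coord j) n (parityOp M.gr a) ⊗ₜ[K] N.ι n ⁅bs i, bs j⁆ b := by
  obtain ⟨m, hm⟩ := exists_c_eq_zero M (parityOp M.gr a)
  rw [locSum_apply_eq_sum (locFinite_quadTerm M N) _ (quadTerm_tmul_eq_zero M N a hb hm)]
  simp only [Finset.sum_product]
  refine Finset.sum_congr rfl fun i _ => Finset.sum_congr rfl fun j _ =>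
    Finset.sum_congr rfl fun n _ => ?_
  rw [ChiralWStarModule.ccPos, locSum_apply_eq_sum (M.locFinite_ccPos _ _ n) (Finset.range m),
    TensorProduct.sum_tmul, quadTerm_eq]
  · rfl
  · intro s hs
    rw [M.c_mul_c, LinearMap.neg_apply, Module.End.mul_apply, hm s (by simpa using hs), map_zero,
      neg_zero]

/-- The terms of `φ` commute with `e ⊗ ι` for every even operator `e` that commutes with the modes
of `c`. -/
theorem phiZero_commute_of_even {e : Module.End K A} (he : parityOp M.gr * e * parityOp M.gr = e)
    (hc : ∀ i n, Commute (M.c (bs.coord i) n) e) (n : ℕ) (ξ : g) :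
    Commute (phiZero M N) (TensorProduct.map (e * parityOp M.gr) (N.ι n ξ)) := by
  refine locSum_commute (locFinite_phiTerm M N) fun p => ?_
  rw [phiTerm_eq]
  refine map_commute_of_anticomm ?_ (N.ι_mul_ι _ _ _ _)
  have h1 := mul_eq_of_even M.parity_mul_self he
  have h2 := mul_eq_neg_of_odd M.parity_mul_self (M.parity_conj_c (bs.coord p.1) (-(p.2 : ℤ) - 1))
  generalize parityOp M.gr = P at *
  calc M.c (bs.coord p.1) (-(p.2 : ℤ) - 1) * P * (e * P)
      = M.c (bs.coord p.1) (-(p.2 : ℤ) - 1) * (P * e) * P := by simp only [mul_assoc]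
    _ = (M.c (bs.coord p.1) (-(p.2 : ℤ) - 1) * e) * P * P := by rw [h1]; simp only [mul_assoc]
    _ = e * M.c (bs.coord p.1) (-(p.2 : ℤ) - 1) * P * P := by rw [(hc _ _).eq]
    _ = -(e * (-(M.c (bs.coord p.1) (-(p.2 : ℤ) - 1) * P)) * P) := by
      rw [mul_neg, neg_mul, neg_neg, mul_assoc e]
    _ = -(e * P * (M.c (bs.coord p.1) (-(p.2 : ℤ) - 1) * P)) := by
      rw [← h2]; simp only [mul_assoc]

theorem phiTerm_commute_c (p : I × ℕ) (φ : Module.Dual K g) (m : ℤ) (n : ℕ) (ξ : g) :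
    Commute (phiTerm M N p) (TensorProduct.map (M.c φ m * parityOp M.gr) (N.ι n ξ)) := by
  rw [phiTerm_eq]
  refine map_commute_of_anticomm ?_ (N.ι_mul_ι _ _ _ _)
  have h1 := mul_eq_neg_of_odd M.parity_mul_self (M.parity_conj_c φ m)
  have h2 := mul_eq_neg_of_odd M.parity_mul_self (M.parity_conj_c (bs.coord p.1) (-(p.2 : ℤ) - 1))
  have h3 := M.c_mul_c (bs.coord p.1) φ (-(p.2 : ℤ) - 1) m
  generalize parityOp M.gr = P at *
  rw [mul_assoc, ← mul_assoc P, h1, mul_assoc, ← mul_assoc P, h2, neg_mul, neg_mul, mul_neg,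
    mul_neg, ← mul_assoc, ← mul_assoc, h3, ← mul_assoc, ← mul_assoc]
  simp only [neg_mul]

theorem phiTerm_mul_self (p : I × ℕ) : phiTerm M N p * phiTerm M N p = 0 := by
  rw [phiTerm_eq]
  simp only
  rw [← TensorProduct.map_mul, N.ι_mul_self, TensorProduct.map_zero_right]

theorem phiZero_locNilpotent (v : A ⊗[K] B) : ∃ n, (phiZero M N ^ n) v = 0 := by
  refine exists_pow_locSum_apply_eq_zero (locFinite_phiTerm M N) (fun p q => ?_)
    (phiTerm_mul_self M N) v
  have := phiTerm_commute_c M N p (bs.coord q.1) (-(q.2 : ℤ) - 1) q.2 (bs q.1)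
  rwa [phiTerm_eq M N] at this ⊢

/-- `φ` preserves all homogeneous components. -/
theorem phiZero_mem (i : Idx) (v : A ⊗[K] B) (hv : v ∈ totalGr M.toDiffSgtModule N i) :
    phiZero M N v ∈ totalGr M.toDiffSgtModule N i := by
  refine locSum_mem (locFinite_phiTerm M N) fun p => ?_
  rw [phiTerm_eq, ← add_zero i]
  refine map_mem_tensorGr (s := (1, 1, (p.2 : ℤ))) (fun j w hw => ?_) (N.ι_mem p.2 (bs p.1)) ?_ i hv
  · have := M.c_mem (bs.coord p.1) (-(p.2 : ℤ) - 1) _ _ (parityOp_mem M.toDiffSgtModule j w hw)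
    rwa [add_zero, show -(-(p.2 : ℤ) - 1) - 1 = p.2 by ring] at this
  · ext
    · exact (by decide : (1 : ZMod 2) + 1 = 0)
    · simp
    · simp

/-- The commutator of `φ` with `ι ⊗ 1 + 1 ⊗ ι`. -/
theorem phiZero_mul_totalι (n : ℕ) (ξ : g) :
    phiZero M N * totalι M.toDiffSgtModule N n ξ =
      totalι M.toDiffSgtModule N n ξ * phiZero M N +
        (-1 : K) • TensorProduct.map (parityOp M.gr) (N.ι n ξ) := by
  classical
  rw [totalι_eq]
  refine TensorProduct.ext' fun a b => ?_
  obtain ⟨k', hk'⟩ := N.exists_isBounded b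
  -- the bound must exceed `n`, so that the mode paired with `ι_{ξ,(n)}` occurs in the sum
  have hk := hk'.mono (le_max_left k' (n + 1))
  have hn : n < max k' (n + 1) := by omega
  set k := max k' (n + 1)
  have hc : ∀ (i : I) (m : ℕ), M.c (bs.coord i) (-(m : ℤ) - 1) (M.ι n ξ (parityOp M.gr a)) =
      (if m = n then bs.coord i ξ • parityOp M.gr a else 0) -
        M.ι n ξ (M.c (bs.coord i) (-(m : ℤ) - 1) (parityOp M.gr a)) := by
    intro i m
    have := congrArg (fun T => T (parityOp M.gr a))
      (M.bracket_ι_mul_c n ξ (bs.coord i) (-(m : ℤ) - 1))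
    simp only [LinearMap.add_apply, Module.End.mul_apply] at this
    rw [eq_sub_iff_add_eq, add_comm, this]
    by_cases hmn : m = n
    · rw [if_pos (by omega), if_pos hmn]; rfl
    · rw [if_neg (by omega), if_neg hmn]; rfl
  have hι : ∀ i m, N.ι m (bs i) (N.ι n ξ b) = -(N.ι n ξ (N.ι m (bs i) b)) := fun i m =>
    congrArg (fun T => T b) (N.ι_mul_ι m n (bs i) ξ)
  have hsum : ∑ i, ∑ m ∈ Finset.range k,
      (if m = n then bs.coord i ξ • parityOp M.gr a else 0) ⊗ₜ[K] N.ι m (bs i) b =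
      parityOp M.gr a ⊗ₜ[K] N.ι n ξ b := by
    rw [← sum_coord_tmul_ι (bs := bs) N _ n ξ]
    refine Finset.sum_congr rfl fun i _ => ?_
    rw [Finset.sum_eq_single n, if_pos rfl, TensorProduct.smul_tmul']
    · intro m _ hmn
      rw [if_neg hmn, TensorProduct.zero_tmul]
    · intro h
      exact absurd (Finset.mem_range.2 hn) h
  simp only [Module.End.mul_apply, LinearMap.add_apply, map_add, TensorProduct.map_tmul,
    Module.End.one_apply, phiZero_tmul _ hk, phiZero_tmul _ (hk.ι n ξ), map_sum,
    parity_apply_of_odd _ (M.parity_conj_ι n ξ), parity_apply_of_odd _ (M.parity_conj_c _ _),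
    parity_parity_apply, map_neg, hc, hι, LinearMap.smul_apply, TensorProduct.neg_tmul,
    TensorProduct.tmul_neg, TensorProduct.sub_tmul, Finset.sum_neg_distrib,
    Finset.sum_sub_distrib, Finset.sum_add_distrib, hsum, neg_one_smul]
  abel

theorem phiZero_commute_parity_ι (n : ℕ) (ξ : g) :
    Commute (phiZero M N) (TensorProduct.map (parityOp M.gr) (N.ι n ξ)) := by
  have := phiZero_commute_of_even M N (e := 1) (by rw [mul_one, M.parity_mul_self])
    (fun _ _ => Commute.one_right _) n ξ
  rwa [one_mul] at this

end Phi

end ChiralCartan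

namespace ChiralCartan

/-! ### The commutators of `φ` with the Lie derivatives and the differential -/

section Commutators

variable {K g A B I : Type*} [Field K] [LieRing g] [LieAlgebra K g] [AddCommGroup A]
  [Module K A] [AddCommGroup B] [Module K B] [Fintype I] {bs : Module.Basis I K g}
  (M : ChiralWStarModule bs A) (N : DiffSgtModule K g B)

/-- The coadjoint action on the `c`-factor is dual to the adjoint action on the `ι`-factor. -/
theorem sum_c_coad_tmul_ι (x : A) (p : ℤ) (m : ℕ) (ξ : g) (b : B) :
    ∑ i, M.c (coad ξ (bs.coord i)) p x ⊗ₜ[K] N.ι m (bs i) b =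
      -∑ j, M.c (bs.coord j) p x ⊗ₜ[K] N.ι m ⁅ξ, bs j⁆ b := by
  simp only [M.c_coad, LinearMap.neg_apply, LinearMap.sum_apply, LinearMap.smul_apply,
    TensorProduct.neg_tmul, TensorProduct.sum_tmul, Finset.sum_neg_distrib]
  rw [Finset.sum_comm]
  refine congrArg _ (Finset.sum_congr rfl fun j _ => ?_)
  rw [← sum_coord_tmul_ι (bs := bs) N _ m]
  exact Finset.sum_congr rfl fun i _ => (TensorProduct.smul_tmul' _ _ _).symm

/-- The terms of `∑_i ∑_n [d, c^{ξ_i^*}_(-n-1)] ⊗ ι_{ξ_i,(n)}`. -/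
noncomputable def dcTerm (p : I × ℕ) : Module.End K (A ⊗[K] B) :=
  TensorProduct.map ((M.d * M.c (bs.coord p.1) (-(p.2 : ℤ) - 1) +
    M.c (bs.coord p.1) (-(p.2 : ℤ) - 1) * M.d) * parityOp M.gr) (N.ι p.2 (bs p.1))

theorem locFinite_dcTerm : LocFinite (dcTerm M N) := locFinite_map_right _ (locFinite_ι N bs)

theorem sum_sum_range_comm {V : Type*} [AddCommMonoid V] (s : Finset ℕ) (f : I → I → ℕ → V) :
    ∑ i, ∑ j, ∑ l ∈ s, f i j l = ∑ l ∈ s, ∑ i, ∑ j, f i j l := by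
  rw [Finset.sum_comm (s := s)]
  exact Finset.sum_congr rfl fun i _ => Finset.sum_comm

theorem sum_range_sum_range_comm {V : Type*} [AddCommMonoid V] (s : Finset ℕ)
    (f : I → ℕ → I → ℕ → V) :
    ∑ i, ∑ m ∈ s, ∑ j, ∑ n ∈ s, f i m j n = ∑ j, ∑ n ∈ s, ∑ i, ∑ m ∈ s, f i m j n := by
  have h := Finset.sum_comm (s := (Finset.univ : Finset I) ×ˢ s)
    (t := (Finset.univ : Finset I) ×ˢ s) (f := fun p q => f p.1 p.2 q.1 q.2)
  simpa only [Finset.sum_product] using h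

/-- Summation along the antidiagonals of a square, for a summand that vanishes below the main
antidiagonal. -/
theorem sum_range_sum_range_eq {V : Type*} [AddCommMonoid V] (k : ℕ) (f : ℕ → ℕ → V)
    (hf : ∀ m n, k ≤ m + n → f m n = 0) :
    ∑ m ∈ Finset.range k, ∑ n ∈ Finset.range k, f m n =
      ∑ l ∈ Finset.range k, ∑ s ∈ Finset.range (l + 1), f s (l - s) := by
  rw [Finset.sum_range_diag_flip]
  refine Finset.sum_congr rfl fun m _ => (Finset.sum_subset ?_ fun n _ hn => hf m n ?_).symm
  · exact Finset.range_mono (Nat.sub_le k m)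
  · have := Finset.mem_range.not.1 hn
    omega

theorem sum_antisymm_tmul {V : Type*} [AddCommGroup V] [Module K V] (F : I → I → V) (m : ℕ)
    (b : B) : ∑ i, ∑ j, F j i ⊗ₜ[K] N.ι m ⁅bs i, bs j⁆ b =
      -∑ i, ∑ j, F i j ⊗ₜ[K] N.ι m ⁅bs i, bs j⁆ b := by
  rw [Finset.sum_comm, ← Finset.sum_neg_distrib]
  refine Finset.sum_congr rfl fun i _ => ?_
  rw [← Finset.sum_neg_distrib]
  refine Finset.sum_congr rfl fun j _ => ?_
  rw [← lie_skew, map_neg, LinearMap.neg_apply, TensorProduct.tmul_neg]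

variable [CharZero K]

/-- The commutator of `φ` with `L ⊗ 1 + 1 ⊗ L`. -/
theorem phiZero_mul_totalL (n : ℕ) (ξ : g) :
    phiZero M N * totalL M.toDiffSgtModule N n ξ =
      totalL M.toDiffSgtModule N n ξ * phiZero M N +
        ∑ i, ∑ k ∈ Finset.range n, TensorProduct.map
          (M.c (bs.coord i) ((n : ℤ) - (k : ℤ) - 1) * parityOp M.gr) (N.ι k ⁅ξ, bs i⁆) := by
  rw [totalL_eq]
  refine TensorProduct.ext' fun a b => ?_
  obtain ⟨k, hk⟩ := N.exists_isBounded b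
  have hc : ∀ (i : I) (m : ℕ), M.c (bs.coord i) (-(m : ℤ) - 1) (M.L n ξ (parityOp M.gr a)) =
      M.L n ξ (M.c (bs.coord i) (-(m : ℤ) - 1) (parityOp M.gr a)) -
        M.c (coad ξ (bs.coord i)) ((n : ℤ) - m - 1) (parityOp M.gr a) := by
    intro i m
    have := congrArg (fun T => T (parityOp M.gr a))
      (M.bracket_L_mul_c n ξ (bs.coord i) (-(m : ℤ) - 1))
    simp only [LinearMap.add_apply, Module.End.mul_apply] at this
    rw [this, show (n : ℤ) + (-(m : ℤ) - 1) = n - m - 1 by ring, add_sub_cancel_right]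
  have hι : ∀ (i : I) (m : ℕ), N.ι m (bs i) (N.L n ξ b) =
      N.L n ξ (N.ι m (bs i) b) - N.ι (n + m) ⁅ξ, bs i⁆ b := fun i m => by
    have := congrArg (fun T => T b) (N.L_mul_ι n m ξ (bs i))
    simp only [LinearMap.add_apply, Module.End.mul_apply] at this
    rw [this, add_sub_cancel_right]
  -- the bounds differ by `n`, to match the term `m = n + p` here with the term `p` in `h2`
  have h1 : phiZero M N (M.L n ξ a ⊗ₜ[K] b) =
      TensorProduct.map (M.L n ξ) 1 (phiZero M N (a ⊗ₜ[K] b)) +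
        ∑ i, ∑ m ∈ Finset.range (n + k),
          M.c (bs.coord i) ((n : ℤ) - m - 1) (parityOp M.gr a) ⊗ₜ[K] N.ι m ⁅ξ, bs i⁆ b := by
    rw [phiZero_tmul _ (hk.mono (Nat.le_add_left k n)),
      phiZero_tmul _ (hk.mono (Nat.le_add_left k n))]
    simp only [parity_apply_of_even _ (M.parity_conj_L n ξ), hc, TensorProduct.sub_tmul,
      Finset.sum_sub_distrib, map_sum, TensorProduct.map_tmul, Module.End.one_apply]
    rw [sub_eq_add_neg]
    congr 1
    rw [Finset.sum_comm, Finset.sum_comm (s := Finset.univ), ← Finset.sum_neg_distrib]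
    refine Finset.sum_congr rfl fun m _ => ?_
    rw [sum_c_coad_tmul_ι, neg_neg]
  have h2 : phiZero M N (a ⊗ₜ[K] N.L n ξ b) =
      TensorProduct.map 1 (N.L n ξ) (phiZero M N (a ⊗ₜ[K] b)) -
        ∑ i, ∑ m ∈ Finset.range k,
          M.c (bs.coord i) (-(m : ℤ) - 1) (parityOp M.gr a) ⊗ₜ[K] N.ι (n + m) ⁅ξ, bs i⁆ b := by
    rw [phiZero_tmul _ (hk.L n ξ), phiZero_tmul _ hk]
    simp only [hι, TensorProduct.tmul_sub, Finset.sum_sub_distrib, map_sum,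
      TensorProduct.map_tmul, Module.End.one_apply]
  have h3 : ∀ (i : I) (m : ℕ), M.c (bs.coord i) ((n : ℤ) - ((n + m : ℕ) : ℤ) - 1) =
      M.c (bs.coord i) (-(m : ℤ) - 1) := fun i m => by
    congr 1; push_cast; ring
  simp only [Finset.sum_range_add, h3, Finset.sum_add_distrib] at h1
  simp only [Module.End.mul_apply, LinearMap.add_apply, map_add, TensorProduct.map_tmul,
    Module.End.one_apply, h1, h2, LinearMap.sum_apply]
  abel

/-- The commutator of `φ` with the total differential. -/
theorem phiZero_mul_totalD :
    phiZero M N * totalD M.toDiffSgtModule N =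
      totalD M.toDiffSgtModule N * phiZero M N +
        (locSum (lieTerm M N) - locSum (dcTerm M N)) := by
  rw [totalD_eq]
  refine TensorProduct.ext' fun a b => ?_
  obtain ⟨k, hk⟩ := N.exists_isBounded b
  have hdc : locSum (dcTerm M N) (a ⊗ₜ[K] b) = ∑ i, ∑ n ∈ Finset.range k,
      (M.d (M.c (bs.coord i) (-(n : ℤ) - 1) (parityOp M.gr a)) +
        M.c (bs.coord i) (-(n : ℤ) - 1) (M.d (parityOp M.gr a))) ⊗ₜ[K] N.ι n (bs i) b :=
    locSum_map_tmul _ (locFinite_ι N bs) a fun p hp => (hk _ hp _).2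
  have hι : ∀ (i : I) (m : ℕ), N.ι m (bs i) (N.d b) =
      N.L m (bs i) b - N.d (N.ι m (bs i) b) := fun i m => by
    have := congrArg (fun T => T b) (N.d_mul_ι m (bs i))
    simp only [LinearMap.add_apply, LinearMap.neg_apply, Module.End.mul_apply] at this
    rw [this]; abel
  simp only [Module.End.mul_apply, LinearMap.add_apply, LinearMap.sub_apply, map_add,
    TensorProduct.map_tmul, Module.End.one_apply, phiZero_tmul _ hk, phiZero_tmul _ hk.d,
    lieTerm_tmul _ hk, hdc, map_sum, parity_apply_of_odd _ M.parity_conj_d,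
    parity_apply_of_odd _ (M.parity_conj_c _ _), parity_parity_apply, hι, map_neg,
    TensorProduct.neg_tmul, TensorProduct.tmul_sub, TensorProduct.add_tmul,
    Finset.sum_neg_distrib, Finset.sum_sub_distrib, Finset.sum_add_distrib]
  abel

/-- The commutator of `φ` with the Lie derivative term, as a sum over all pairs of modes. -/
theorem phiZero_lieTerm_tmul (a : A) {b : B} {k : ℕ} (hk : N.IsBounded k b) :
    phiZero M N (locSum (lieTerm M N) (a ⊗ₜ[K] b)) =
      locSum (lieTerm M N) (phiZero M N (a ⊗ₜ[K] b)) -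
        ∑ i, ∑ j, ∑ m ∈ Finset.range k, ∑ n ∈ Finset.range k,
          M.c (bs.coord i) (-(m : ℤ) - 1) (M.c (bs.coord j) (-(n : ℤ) - 1) (parityOp M.gr a)) ⊗ₜ[K]
            N.ι (m + n) ⁅bs i, bs j⁆ b := by
  have hι : ∀ (i j : I) (m n : ℕ), N.ι m (bs i) (N.L n (bs j) b) =
      N.L n (bs j) (N.ι m (bs i) b) + N.ι (m + n) ⁅bs i, bs j⁆ b := fun i j m n => by
    have := congrArg (fun T => T b) (N.L_mul_ι n m (bs j) (bs i))
    simp only [LinearMap.add_apply, Module.End.mul_apply] at this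
    rw [this, ← lie_skew, map_neg, LinearMap.neg_apply, add_comm n m, neg_add_cancel_right]
  have hcc : ∀ (i j : I) (m n : ℕ),
      M.c (bs.coord j) (-(n : ℤ) - 1) (M.c (bs.coord i) (-(m : ℤ) - 1) (parityOp M.gr a)) =
        -M.c (bs.coord i) (-(m : ℤ) - 1) (M.c (bs.coord j) (-(n : ℤ) - 1) (parityOp M.gr a)) :=
    fun i j m n => congrArg (fun T => T (parityOp M.gr a)) (M.c_mul_c _ _ _ _)
  have h1 : phiZero M N (locSum (lieTerm M N) (a ⊗ₜ[K] b)) =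
      -∑ j, ∑ n ∈ Finset.range k, ∑ i, ∑ m ∈ Finset.range k,
        M.c (bs.coord i) (-(m : ℤ) - 1) (M.c (bs.coord j) (-(n : ℤ) - 1) (parityOp M.gr a)) ⊗ₜ[K]
          N.ι m (bs i) (N.L n (bs j) b) := by
    simp only [lieTerm_tmul _ hk, map_sum, phiZero_tmul _ (hk.L _ _),
      parity_apply_of_odd _ (M.parity_conj_c _ _), map_neg, TensorProduct.neg_tmul,
      Finset.sum_neg_distrib]
  have h2 : locSum (lieTerm M N) (phiZero M N (a ⊗ₜ[K] b)) =
      -∑ j, ∑ n ∈ Finset.range k, ∑ i, ∑ m ∈ Finset.range k,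
        M.c (bs.coord i) (-(m : ℤ) - 1) (M.c (bs.coord j) (-(n : ℤ) - 1) (parityOp M.gr a)) ⊗ₜ[K]
          N.L n (bs j) (N.ι m (bs i) b) := by
    simp only [phiZero_tmul _ hk, map_sum, lieTerm_tmul _ (hk.ι _ _)]
    rw [sum_range_sum_range_comm]
    simp only [← Finset.sum_neg_distrib]
    refine Finset.sum_congr rfl fun j _ => Finset.sum_congr rfl fun n _ =>
      Finset.sum_congr rfl fun i _ => Finset.sum_congr rfl fun m _ => ?_
    rw [hcc, TensorProduct.neg_tmul]
  rw [h1, h2]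
  simp only [hι, TensorProduct.tmul_add, Finset.sum_add_distrib, neg_add]
  rw [← sub_eq_add_neg]
  congr 1
  calc _ = ∑ j, ∑ i, ∑ n ∈ Finset.range k, ∑ m ∈ Finset.range k,
          M.c (bs.coord i) (-(m : ℤ) - 1) (M.c (bs.coord j) (-(n : ℤ) - 1) (parityOp M.gr a)) ⊗ₜ[K]
            N.ι (m + n) ⁅bs i, bs j⁆ b := Finset.sum_congr rfl fun j _ => Finset.sum_comm
    _ = _ := by
      rw [Finset.sum_comm]
      exact Finset.sum_congr rfl fun i _ => Finset.sum_congr rfl fun j _ => Finset.sum_comm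

/-- The difference of the `[d, c]`- and `γ`-terms is given by the normally ordered products
`:c c:`. -/
theorem dcTerm_sub_gammaTerm_tmul (a : A) {b : B} {k : ℕ} (hk : N.IsBounded k b) :
    (2 : K) • (locSum (dcTerm M N) (a ⊗ₜ[K] b) - locSum (gammaTerm M N) (a ⊗ₜ[K] b)) =
      -∑ l ∈ Finset.range k, ∑ i, ∑ j,
        M.cc (bs.coord i) (bs.coord j) (-(l : ℤ) - 1) (parityOp M.gr a) ⊗ₜ[K]
          N.ι l ⁅bs i, bs j⁆ b := by
  have hdc : locSum (dcTerm M N) (a ⊗ₜ[K] b) = ∑ i, ∑ n ∈ Finset.range k,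
      (M.d * M.c (bs.coord i) (-(n : ℤ) - 1) + M.c (bs.coord i) (-(n : ℤ) - 1) * M.d)
        (parityOp M.gr a) ⊗ₜ[K] N.ι n (bs i) b :=
    locSum_map_tmul _ (locFinite_ι N bs) a fun p hp => (hk _ hp _).2
  have hgamma : locSum (gammaTerm M N) (a ⊗ₜ[K] b) = ∑ i, ∑ n ∈ Finset.range k,
      M.gamma (bs.coord i) (-(n : ℤ) - 1) (parityOp M.gr a) ⊗ₜ[K] N.ι n (bs i) b := by
    rw [gammaTerm_eq]
    exact locSum_map_tmul _ (locFinite_ι N bs) a fun p hp => (hk _ hp _).2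
  rw [hdc, hgamma]
  simp only [M.bracket_d_mul_c, LinearMap.add_apply, TensorProduct.add_tmul,
    Finset.sum_add_distrib, add_sub_cancel_left]
  rw [Finset.sum_comm, Finset.smul_sum, ← Finset.sum_neg_distrib]
  refine Finset.sum_congr rfl fun l _ => ?_
  have h2 : (2 : K) * -(2 : K)⁻¹ = -1 := by rw [mul_neg, mul_inv_cancel₀ two_ne_zero]
  simp only [LinearMap.smul_apply, LinearMap.sum_apply, ← TensorProduct.smul_tmul',
    TensorProduct.sum_tmul, ← Finset.smul_sum]
  rw [smul_smul, h2, neg_one_smul, Finset.sum_comm]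
  refine congrArg _ (Finset.sum_congr rfl fun i _ => ?_)
  rw [Finset.sum_comm]
  exact Finset.sum_congr rfl fun j _ => sum_coord_tmul_ι N _ l _ b

theorem phiZero_commute_dcTerm : Commute (phiZero M N) (locSum (dcTerm M N)) :=
  (locSum_commute (locFinite_dcTerm M N) fun _ => (phiZero_commute_of_even M N
    (M.parity_conj_bracket_d_mul_c _ _) (fun _ _ => M.bracket_d_mul_c_commute_c _ _ _ _)
    _ _).symm).symm

/-- The second commutator of `φ` with the total differential. -/
theorem phiZero_mul_second :
    phiZero M N * (locSum (lieTerm M N) - locSum (dcTerm M N)) =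
      (locSum (lieTerm M N) - locSum (dcTerm M N)) * phiZero M N +
        (2 : K) • (locSum (quadTerm M N) + (locSum (dcTerm M N) - locSum (gammaTerm M N))) := by
  refine TensorProduct.ext' fun a b => ?_
  obtain ⟨k, hk⟩ := N.exists_isBounded b
  have hd : phiZero M N (locSum (dcTerm M N) (a ⊗ₜ[K] b)) =
      locSum (dcTerm M N) (phiZero M N (a ⊗ₜ[K] b)) :=
    congrArg (fun T => T (a ⊗ₜ[K] b)) (phiZero_commute_dcTerm M N).eq
  simp only [Module.End.mul_apply, LinearMap.add_apply, LinearMap.sub_apply, map_sub,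
    LinearMap.smul_apply, smul_add, hd, phiZero_lieTerm_tmul M N a hk,
    dcTerm_sub_gammaTerm_tmul M N a hk, quadTerm_tmul a hk]
  -- the sum over all pairs of modes, arranged by the index of `ι`
  have hflip : ∑ i, ∑ j, ∑ m ∈ Finset.range k, ∑ n ∈ Finset.range k,
      M.c (bs.coord i) (-(m : ℤ) - 1) (M.c (bs.coord j) (-(n : ℤ) - 1) (parityOp M.gr a)) ⊗ₜ[K]
        N.ι (m + n) ⁅bs i, bs j⁆ b =
      ∑ l ∈ Finset.range k, ∑ i, ∑ j, (∑ s ∈ Finset.range (l + 1),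
        M.c (bs.coord i) (-(s : ℤ) - 1) * M.c (bs.coord j) (-((l - s : ℕ) : ℤ) - 1))
          (parityOp M.gr a) ⊗ₜ[K] N.ι l ⁅bs i, bs j⁆ b := by
    rw [← sum_sum_range_comm]
    refine Finset.sum_congr rfl fun i _ => Finset.sum_congr rfl fun j _ => ?_
    rw [sum_range_sum_range_eq k _ fun m n hmn => by
      rw [(hk _ hmn _).2, TensorProduct.tmul_zero]]
    refine Finset.sum_congr rfl fun l _ => ?_
    rw [LinearMap.sum_apply, TensorProduct.sum_tmul]
    refine Finset.sum_congr rfl fun s hs => ?_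
    rw [Nat.add_sub_cancel' (Nat.lt_succ_iff.1 (Finset.mem_range.1 hs))]
    rfl
  have hquad : ∑ i, ∑ j, ∑ n ∈ Finset.range k,
      M.ccPos (bs.coord i) (bs.coord j) n (parityOp M.gr a) ⊗ₜ[K] N.ι n ⁅bs i, bs j⁆ b =
      ∑ l ∈ Finset.range k, ∑ i, ∑ j,
        M.ccPos (bs.coord i) (bs.coord j) l (parityOp M.gr a) ⊗ₜ[K] N.ι l ⁅bs i, bs j⁆ b :=
    sum_sum_range_comm _ _
  -- the two infinite sums in `:c c:` contribute equally, as the bracket is antisymmetric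
  simp only [hflip, hquad, M.cc_eq, LinearMap.sub_apply, LinearMap.add_apply,
    TensorProduct.sub_tmul, TensorProduct.add_tmul, Finset.sum_sub_distrib,
    Finset.sum_add_distrib,
    sum_antisymm_tmul N (fun i j => M.ccPos (bs.coord i) (bs.coord j) _ (parityOp M.gr a)),
    Finset.sum_neg_distrib, two_smul]
  abel

end Commutators

end ChiralCartan

namespace ChiralCartan

/-! ### Conjugation by `Φ` -/

section Conjugation

/-- A graded subspace stable under a differential is a graded complex. -/
theorem isGradedComplex_restrict {K V : Type*} [Field K] [AddCommGroup V] [Module K V]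
    {gr : Idx → Submodule K V} (h : DirectSum.IsInternal gr) {S : Submodule K V}
    (hS : ∀ v ∈ S, ∀ i, grProj h i v ∈ S) {d : Module.End K V} (hd : ∀ v ∈ S, d v ∈ S)
    (hmem : ∀ i, ∀ v ∈ gr i, d v ∈ gr (i + (1, 1, 0))) (hsq : ∀ v, d (d v) = 0) :
    IsGradedComplex (subGr gr S) (d.restrict hd) where
  internal := subGr_isInternal h S hS
  d_mem i v hv := hmem i v hv
  d_sq := LinearMap.ext fun v => Subtype.ext (hsq v)

variable {K g A B I : Type*} [Field K] [CharZero K] [LieRing g] [LieAlgebra K g] [AddCommGroup A]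
  [Module K A] [AddCommGroup B] [Module K B] [Fintype I] {bs : Module.Basis I K g}
  (M : ChiralWStarModule bs A) (N : DiffSgtModule K g B)

/-- The operator `Φ = exp φ`. -/
noncomputable def cartanEquiv : (A ⊗[K] B) ≃ₗ[K] (A ⊗[K] B) :=
  locExpEquiv (phiZero_locNilpotent M N)

theorem cartanEquiv_conj_totalD :
    (cartanEquiv M N).conj (totalD M.toDiffSgtModule N) =
      totalD M.toDiffSgtModule N - locSum (gammaTerm M N) + locSum (lieTerm M N) +
        locSum (quadTerm M N) := by
  have hgamma : Commute (phiZero M N) (locSum (gammaTerm M N)) := by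
    rw [gammaTerm_eq]
    exact (locSum_commute (locFinite_map_right _ (locFinite_ι N bs)) fun p =>
      (phiZero_commute_of_even M N (M.parity_conj_gamma _ _) (fun i n => M.c_mul_gamma _ _ _ _)
        _ _).symm).symm
  have hquad : Commute (phiZero M N) (locSum (quadTerm M N)) := by
    refine (locSum_commute (locFinite_quadTerm M N) fun p => ?_).symm
    rw [quadTerm_eq]
    refine (phiZero_commute_of_even M N ?_ (fun i n => ?_) _ _).symm
    · rw [conj_mul M.parity_mul_self, M.parity_conj_c, M.parity_conj_c, neg_mul_neg]
    · rw [Commute, SemiconjBy, ← mul_assoc, M.c_mul_c, neg_mul, mul_assoc, M.c_mul_c, mul_neg,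
        neg_neg, mul_assoc]
  rw [cartanEquiv, locExpEquiv_conj _ (phiZero_mul_totalD M N) (phiZero_mul_second M N)
    (hquad.add_right ((phiZero_commute_dcTerm M N).sub_right hgamma)).eq]
  abel

theorem cartanEquiv_conj_totalL (n : ℕ) (ξ : g) :
    (cartanEquiv M N).conj (totalL M.toDiffSgtModule N n ξ) =
      totalL M.toDiffSgtModule N n ξ +
        ∑ i, ∑ k ∈ Finset.range n, opTensor M.toDiffSgtModule N
          (M.c (bs.coord i) ((n : ℤ) - (k : ℤ) - 1)) (N.ι k ⁅ξ, bs i⁆) := by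
  have hcomm : Commute (phiZero M N) (∑ i, ∑ k ∈ Finset.range n, TensorProduct.map
      (M.c (bs.coord i) ((n : ℤ) - (k : ℤ) - 1) * parityOp M.gr) (N.ι k ⁅ξ, bs i⁆)) :=
    Commute.sum_right _ _ _ fun i _ => Commute.sum_right _ _ _ fun k _ =>
      locSum_commute (locFinite_phiTerm M N) fun p => phiTerm_commute_c M N p _ _ _ _
  rw [cartanEquiv, locExpEquiv_conj _ (Z := 0) (phiZero_mul_totalL M N n ξ)
    (by rw [smul_zero, add_zero, hcomm.eq]) (by rw [mul_zero, zero_mul]), add_zero]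
  simp only [opTensor_ι]

theorem cartanEquiv_conj_totalι (n : ℕ) (ξ : g) :
    (cartanEquiv M N).conj (totalι M.toDiffSgtModule N n ξ) =
      opTensor M.toDiffSgtModule N (M.ι n ξ) 1 := by
  rw [cartanEquiv, locExpEquiv_conj _ (Z := 0) (phiZero_mul_totalι M N n ξ) _
    (by rw [mul_zero, zero_mul]), add_zero, opTensor_one, totalι_eq]
  · refine TensorProduct.ext' fun a b => ?_
    simp only [LinearMap.add_apply, LinearMap.smul_apply, neg_one_smul, add_neg_cancel_right]
  · rw [smul_zero, add_zero]
    exact ((phiZero_commute_parity_ι M N n ξ).smul_right (-1 : K)).eq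

/-- `Φ` preserves all homogeneous components. -/
theorem map_cartanEquiv_totalGr (i : Idx) :
    (totalGr M.toDiffSgtModule N i).map (cartanEquiv M N).toLinearMap =
      totalGr M.toDiffSgtModule N i :=
  locExpEquiv_map_eq _ (phiZero_mem M N i)

theorem cartanEquiv_mem_iff (i : Idx) (v : A ⊗[K] B) :
    cartanEquiv M N v ∈ totalGr M.toDiffSgtModule N i ↔ v ∈ totalGr M.toDiffSgtModule N i := by
  conv_lhs => rw [← map_cartanEquiv_totalGr M N i]
  exact (cartanEquiv M N).injective.mem_set_image

theorem cartanEquiv_conj_apply (X : Module.End K (A ⊗[K] B)) (v : A ⊗[K] B) :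
    (cartanEquiv M N).conj X (cartanEquiv M N v) = cartanEquiv M N (X v) := by
  rw [LinearEquiv.conj_apply_apply, LinearEquiv.symm_apply_apply]

theorem mem_cartanModel {v : A ⊗[K] B} :
    v ∈ cartanModel M N ↔ ∃ w ∈ totalBasic M.toDiffSgtModule N, cartanEquiv M N w = v :=
  Submodule.mem_map

theorem cartanEquiv_conj_totalD_mem_cartanModel {v : A ⊗[K] B} (hv : v ∈ cartanModel M N) :
    (cartanEquiv M N).conj (totalD M.toDiffSgtModule N) v ∈ cartanModel M N := by
  obtain ⟨w, hw, rfl⟩ := (mem_cartanModel M N).1 hv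
  rw [cartanEquiv_conj_apply]
  exact (mem_cartanModel M N).2 ⟨_, totalD_mem_totalBasic _ _ hw, rfl⟩

theorem grProj_cartanEquiv (i : Idx) (v : A ⊗[K] B) :
    grProj (totalGr_isInternal M.toDiffSgtModule N) i (cartanEquiv M N v) =
      cartanEquiv M N (grProj (totalGr_isInternal M.toDiffSgtModule N) i v) := by
  have h := grProj_apply_of_homogeneous (totalGr_isInternal M.toDiffSgtModule N)
    (X := (cartanEquiv M N).toLinearMap) (s := 0)
    (fun j w hw => by rw [add_zero]; exact (cartanEquiv_mem_iff M N j w).2 hw) i v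
  rwa [add_zero] at h

theorem isGradedComplex_totalBasic
    (h : ∀ v ∈ totalBasic M.toDiffSgtModule N,
      totalD M.toDiffSgtModule N v ∈ totalBasic M.toDiffSgtModule N) :
    IsGradedComplex (subGr (totalGr M.toDiffSgtModule N) (totalBasic M.toDiffSgtModule N))
      ((totalD M.toDiffSgtModule N).restrict h) :=
  isGradedComplex_restrict (totalGr_isInternal _ _)
    (fun _ hv i => grProj_mem_totalBasic _ _ hv i) h (totalD_mem _ _)
    (fun v => congrArg (fun T => T v) (totalD_mul_self M.toDiffSgtModule N))

theorem isGradedComplex_cartanModel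
    (h : ∀ v ∈ cartanModel M N,
      (cartanEquiv M N).conj (totalD M.toDiffSgtModule N) v ∈ cartanModel M N) :
    IsGradedComplex (subGr (totalGr M.toDiffSgtModule N) (cartanModel M N))
      (((cartanEquiv M N).conj (totalD M.toDiffSgtModule N)).restrict h) := by
  refine isGradedComplex_restrict (totalGr_isInternal M.toDiffSgtModule N) (fun v hv i => ?_) h
    (fun i v hv => ?_) (fun v => ?_)
  · obtain ⟨w, hw, rfl⟩ := (mem_cartanModel M N).1 hv
    rw [grProj_cartanEquiv]
    exact (mem_cartanModel M N).2 ⟨_, grProj_mem_totalBasic _ _ hw i, rfl⟩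
  · obtain ⟨w, rfl⟩ := (cartanEquiv M N).surjective v
    rw [cartanEquiv_conj_apply, cartanEquiv_mem_iff]
    exact totalD_mem _ _ i w ((cartanEquiv_mem_iff M N i w).1 hv)
  · obtain ⟨w, rfl⟩ := (cartanEquiv M N).surjective v
    rw [cartanEquiv_conj_apply, cartanEquiv_conj_apply, ← Module.End.mul_apply,
      totalD_mul_self, LinearMap.zero_apply, map_zero]

end Conjugation

end ChiralCartan

open scoped TensorProduct in
open ChiralCartan in
theorem mainTheorem3 {K g A B I : Type*} [RCLike K] [LieRing g] [LieAlgebra K g]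
    [AddCommGroup A] [Module K A] [AddCommGroup B] [Module K B] [Fintype I]
    (bs : Module.Basis I K g) (M : ChiralWStarModule bs A) (N : DiffSgtModule K g B) :
    LocFinite (phiTerm M N) ∧ LocFinite (expTerm (phiZero M N)) ∧
    LocFinite (gammaTerm M N) ∧ LocFinite (lieTerm M N) ∧ LocFinite (quadTerm M N) ∧
    ∃ Φ : (A ⊗[K] B) ≃ₗ[K] (A ⊗[K] B),
      Φ.toLinearMap = locExp (phiZero M N) ∧
      Φ.conj (totalD M.toDiffSgtModule N) =
        totalD M.toDiffSgtModule N - locSum (gammaTerm M N) + locSum (lieTerm M N) +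
          locSum (quadTerm M N) ∧
      (∀ (n : ℕ) (ξ : g),
        Φ.conj (totalL M.toDiffSgtModule N n ξ) =
          totalL M.toDiffSgtModule N n ξ +
            ∑ i, ∑ k ∈ Finset.range n, opTensor M.toDiffSgtModule N
              (M.c (bs.coord i) ((n : ℤ) - (k : ℤ) - 1)) (N.ι k ⁅ξ, bs i⁆)) ∧
      (∀ (n : ℕ) (ξ : g),
        Φ.conj (totalι M.toDiffSgtModule N n ξ) = opTensor M.toDiffSgtModule N (M.ι n ξ) 1) ∧
      (∀ i : Idx, (totalGr M.toDiffSgtModule N i).map Φ.toLinearMap =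
        totalGr M.toDiffSgtModule N i) ∧
      ∃ (hbas : ∀ v ∈ totalBasic M.toDiffSgtModule N,
            totalD M.toDiffSgtModule N v ∈ totalBasic M.toDiffSgtModule N)
        (hC : ∀ v ∈ cartanModel M N,
            Φ.conj (totalD M.toDiffSgtModule N) v ∈ cartanModel M N)
        (f : totalBasic M.toDiffSgtModule N ≃ₗ[K] cartanModel M N),
        (∀ v, (f v : A ⊗[K] B) = Φ v) ∧
        IsGradedComplex (subGr (totalGr M.toDiffSgtModule N) (totalBasic M.toDiffSgtModule N))
          ((totalD M.toDiffSgtModule N).restrict hbas) ∧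
        IsGradedComplex (subGr (totalGr M.toDiffSgtModule N) (cartanModel M N))
          ((Φ.conj (totalD M.toDiffSgtModule N)).restrict hC) ∧
        IsGradedComplexIso
          (subGr (totalGr M.toDiffSgtModule N) (totalBasic M.toDiffSgtModule N))
          ((totalD M.toDiffSgtModule N).restrict hbas)
          (subGr (totalGr M.toDiffSgtModule N) (cartanModel M N))
          ((Φ.conj (totalD M.toDiffSgtModule N)).restrict hC) f := by
  refine ⟨locFinite_phiTerm M N, locFinite_expTerm (phiZero_locNilpotent M N),
    locFinite_gammaTerm M N, locFinite_lieTerm M N, locFinite_quadTerm M N, cartanEquiv M N,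
    locExpEquiv_toLinearMap _, cartanEquiv_conj_totalD M N, cartanEquiv_conj_totalL M N,
    cartanEquiv_conj_totalι M N, map_cartanEquiv_totalGr M N,
    fun _ hv => totalD_mem_totalBasic _ _ hv,
    fun _ hv => cartanEquiv_conj_totalD_mem_cartanModel M N hv,
    (cartanEquiv M N).submoduleMap _, fun _ => rfl, isGradedComplex_totalBasic M N _,
    isGradedComplex_cartanModel M N _, fun i u => cartanEquiv_mem_iff M N i u, fun u => ?_⟩
  exact Subtype.ext (cartanEquiv_conj_apply M N (totalD M.toDiffSgtModule N) u).symm
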